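/- Throughout, graphs are finite, simple and undirected. A graph $H$ is a minor of a graph $G$ if it can be obtained from $G$ by deleting vertices, deleting edges and contracting edges; equivalently, if there are pairwise disjoint sets $B_h \subseteq V(G)$ $(h \in V(H))$, each inducing a non-empty connected subgraph of $G$, such that $G$ has an edge between $B_h$ and $B_{h'}$ whenever $hh' \in E(H)$. The graph $G$ is $H$-minor-free if $H$ is not a minor of $G$. Fix $k \in \mathbb{N}$. A network is a connected graph $G$ on $n$ vertices together with an injective assignment of identifiers $\mathrm{id}\colon V(G) \to \{1,\dots,n^k\}$. A verifier is a map $A$ which is evaluated at each vertex $v$ of a network whose vertices carry certificates $c(v) \in \{0,1\}^*$: its input is the identifier and the certificate of $v$, together with the set of pairs $(\mathrm{id}(w), c(w))$ over all neighbours $w$ of $v$, and its output is "accept" or "reject". A graph class $\mathcal{C}$ has a local certification (proof-labeling scheme) with $O(\log n)$-bit certificates if there are a verifier $A$ and a function $f\colon \mathbb{N} \to \mathbb{N}$ with $f(n) = O(\log n)$ such that, for every network $(G, \mathrm{id})$ with $n$ vertices: 1. if $G \in \mathcal{C}$, then there is an assignment $c$ of certificates of at most $f(n)$ bits each for which $A$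 accepts at every vertex; 2. if $G \notin \mathcal{C}$, then for every assignment $c$ of certificates, of any length, $A$ rejects at some vertex at least. **Theorem.** For every graph $H$ with at most $4$ vertices and every $k \in \mathbb{N}$, the class of $H$-minor-free graphs has a local certification with $O(\log n)$-bit certificates. -/

import Mathlib

/-- `H` is a minor of `G`: there are pairwise disjoint branch sets in `G`, one for each vertex
of `H`, each inducing a (nonempty) connected subgraph, with an edge of `G` between the branch
sets of any two adjacent vertices of `H`. -/
def IsMinor {W V : Type*} (H : SimpleGraph W) (G : SimpleGraph V) : Prop :=
  ∃ B : W → Set V,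
    (∀ i, (G.induce (B i)).Connected) ∧
    (∀ i j, i ≠ j → Disjoint (B i) (B j)) ∧
    (∀ i j, H.Adj i j → ∃ x ∈ B i, ∃ y ∈ B j, G.Adj x y)

/-- A class of graphs. -/
abbrev GraphClass : Type 1 := ∀ V : Type, SimpleGraph V → Prop

/-- The class of `H`-minor-free graphs. -/
def minorFree {W : Type*} (H : SimpleGraph W) : GraphClass :=
  fun _ G => ¬ IsMinor H G

/-- Certificates are bit strings; the size of a certificate is its length. -/
abbrev Certificate : Type := List Bool

/-- A verifier, run at a node, sees the identifier of the node, the certificate of the node, and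
the set of pairs (identifier, certificate) of its neighbours; it outputs `true` (accept) or
`false` (reject). -/
abbrev Verifier : Type := ℕ → Certificate → Finset (ℕ × Certificate) → Bool

/-- Unique identifiers in the polynomial range `[1, n ^ k]`, where `n` is the number of
vertices. -/
structure IsIdentifierAssignment (k : ℕ) {V : Type} [Fintype V] (ident : V → ℕ) : Prop where
  injective : Function.Injective ident
  one_le : ∀ v, 1 ≤ ident v
  le_pow : ∀ v, ident v ≤ Fintype.card V ^ k

open Classical in
/-- The pairs (identifier, certificate) of the neighbours of `v`. -/
noncomputable def neighborView {V : Type} [Fintype V] (G : SimpleGraph V) (ident : V → ℕ)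
    (c : V → Certificate) (v : V) : Finset (ℕ × Certificate) :=
  (Finset.univ.filter fun w => G.Adj v w).image fun w => (ident w, c w)

/-- The verifier accepts: all nodes output accept. -/
def Verifier.Accepts (A : Verifier) {V : Type} [Fintype V] (G : SimpleGraph V) (ident : V → ℕ)
    (c : V → Certificate) : Prop :=
  ∀ v, A (ident v) (c v) (neighborView G ident c v) = true

/-- `A` certifies the class `𝒞` with certificates of at most `f n` bits on `n`-vertex graphs.
Networks are finite connected graphs with unique identifiers in `[1, n ^ k]`. Soundness is
required against certificates of every length. -/
structure Verifier.Certifies (A : Verifier) (k : ℕ) (𝒞 : GraphClass) (f : ℕ → ℕ) : Prop where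
  complete : ∀ (V : Type) [Fintype V] (G : SimpleGraph V) (ident : V → ℕ),
    G.Connected → IsIdentifierAssignment k ident → 𝒞 V G →
      ∃ c : V → Certificate, (∀ v, (c v).length ≤ f (Fintype.card V)) ∧ A.Accepts G ident c
  sound : ∀ (V : Type) [Fintype V] (G : SimpleGraph V) (ident : V → ℕ),
    G.Connected → IsIdentifierAssignment k ident → ¬ 𝒞 V G →
      ∀ c : V → Certificate, ¬ A.Accepts G ident c

/-- The class `𝒞` has a local certification with `O(log n)`-bit certificates, for networks with
identifiers in `[1, n ^ k]`. -/
def HasLogCertification (k : ℕ) (𝒞 : GraphClass) : Prop :=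
  ∃ (A : Verifier) (f : ℕ → ℕ), A.Certifies k 𝒞 f ∧
    (fun n : ℕ => (f n : ℝ)) =O[Filter.atTop] (fun n : ℕ => Real.log n)

/-! The certificates describe a rooted tree that can be checked locally and that excludes the minor.
In a `HubTree` every vertex has at most one parent and at most one hub. The hub of a vertex is the
parent or the hub of its parent, hence a proper ancestor, and every edge of the graph leads from a
vertex to its parent or its hub. So the subtree of `w` has at most two outer neighbours, the parent
and the hub of `w`. In a model of a minor, take the branch set whose top vertex `w` is deepest:
every branch set adjacent to it contains one of these two vertices (`HubTree.exists_deepest`). Hence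
some vertex of the minor has degree at most two, and `K₄` is not a minor.

Conversely, a connected graph without `K₄` minor has such a tree. It has a vertex `x` of degree at
most two (via `isMinor_K4_of_hasThree`). Contract `x` into a neighbour, take a tree by induction and
put `x` back as a pendant vertex, as an ear on an edge, or as a subdivision vertex
(`exists_routedTree`). Subdividing may separate a vertex from its parent. The parent's data then
travel along a route in the graph, and the routes are arranged so that each vertex is interior to at
most one of them. Thus boundedly many numbers of polynomial size per vertex suffice.

For the diamond, `C₄` and the triangle the tree is a normal spanning tree, and the hubs are the ends
of back links from subtrees. Without diamond minor, back links are unique, are passed on to the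
parent in a controlled way and come from at most one child (`NormalTree.cactusTree`). Such a
`CactusTree` has no diamond minor, because the part of the tree hanging between a vertex and its hub
is attached to the rest by two edges (`CactusTree.adj_between`). For `C₄` each hub must in addition
be the grandparent; for the triangle there are no hubs at all.

For the remaining graphs, the connected minor-free graphs form simple classes: stars or at most
three vertices for `P₄` and two disjoint edges; maximum degree two for the claw; no triangle minor
or maximum degree two for the paw and for the triangle with an isolated vertex. All other graphs on
at most four vertices are minors of every connected graph with at least as many vertices, so that
excluding them bounds the number of vertices. A finite check over the graphs on `Fin 4` shows that
no case is missing. -/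

/-! ### Encoding labels as bit strings -/

/-- A vector of natural numbers coded as a single natural number. -/
def vecCode : ∀ m : ℕ, (Fin m → ℕ) → ℕ
  | 0, _ => 0
  | m + 1, x => Nat.pair (x 0) (vecCode m (Fin.tail x))

theorem vecCode_injective : ∀ m, Function.Injective (vecCode m)
  | 0 => fun x y _ => funext fun i => i.elim0
  | m + 1 => fun x y h => by
    obtain ⟨h0, h1⟩ := Nat.pair_eq_pair.mp h
    rw [← Fin.cons_self_tail x, ← Fin.cons_self_tail y, h0, vecCode_injective m h1]

/-- Each use of `Nat.pair` at most squares the bound, which gives the exponent `2 ^ m`. For fixed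
`m` the code of polynomially bounded numbers is therefore polynomially bounded and has logarithmic
length. -/
theorem vecCode_lt {B : ℕ} : ∀ (m : ℕ) (x : Fin m → ℕ), (∀ i, x i ≤ B) →
    vecCode m x < (B + 1) ^ 2 ^ m
  | 0, x, _ => by simp [vecCode]
  | m + 1, x, h => by
    have ih := vecCode_lt m (Fin.tail x) fun i => h i.succ
    have h1 : max (x 0) (vecCode m (Fin.tail x)) + 1 ≤ (B + 1) ^ 2 ^ m := by
      have h2 : B + 1 ≤ (B + 1) ^ 2 ^ m := Nat.le_self_pow (by positivity) _
      have h3 := h 0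
      omega
    calc vecCode (m + 1) x < (max (x 0) (vecCode m (Fin.tail x)) + 1) ^ 2 :=
          Nat.pair_lt_max_add_one_sq _ _
      _ ≤ ((B + 1) ^ 2 ^ m) ^ 2 := Nat.pow_le_pow_left h1 2
      _ = (B + 1) ^ 2 ^ (m + 1) := by rw [← pow_mul, pow_succ]

theorem nat_bits_injective : Function.Injective Nat.bits := by
  intro a b h
  have : ∀ n : ℕ, n.bits.foldr Nat.bit 0 = n := by
    intro n
    induction n using Nat.binaryRec' with
    | zero => simp
    | bit b n hn ih => rw [Nat.bits_append_bit n b hn, List.foldr_cons, ih]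
  rw [← this a, ← this b, h]

/-- The length of the certificates that code vectors of `m` numbers, each at most
`(n + 1) ^ K`. -/
def certLength (K m n : ℕ) : ℕ := (Nat.log 2 n + 2) * ((K + 1) * 2 ^ m)

theorem length_bits_vecCode_le {K m n : ℕ} (x : Fin m → ℕ) (hx : ∀ i, x i ≤ (n + 1) ^ K) :
    (Nat.bits (vecCode m x)).length ≤ certLength K m n := by
  rw [Nat.size_eq_bits_len, Nat.size_le]
  have h1 : n + 2 ≤ 2 ^ (Nat.log 2 n + 2) := by
    have := Nat.lt_pow_succ_log_self (b := 2) (by norm_num) n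
    rw [Nat.succ_eq_add_one, pow_succ] at this
    rw [pow_succ, pow_succ]
    omega
  have h2 : (n + 1) ^ K + 1 ≤ (n + 2) ^ (K + 1) := by
    have h3 : (n + 1) ^ K ≤ (n + 2) ^ K := Nat.pow_le_pow_left (by omega) K
    have h4 : 1 ≤ (n + 2) ^ K := Nat.one_le_pow _ _ (by omega)
    rw [pow_succ]
    nlinarith
  calc vecCode m x < ((n + 1) ^ K + 1) ^ 2 ^ m := vecCode_lt m x hx
    _ ≤ ((n + 2) ^ (K + 1)) ^ 2 ^ m := Nat.pow_le_pow_left h2 _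
    _ = (n + 2) ^ ((K + 1) * 2 ^ m) := by rw [← pow_mul]
    _ ≤ (2 ^ (Nat.log 2 n + 2)) ^ ((K + 1) * 2 ^ m) := Nat.pow_le_pow_left h1 _
    _ = 2 ^ certLength K m n := by rw [← pow_mul, certLength]

theorem certLength_isBigO (K m : ℕ) :
    (fun n : ℕ => (certLength K m n : ℝ)) =O[Filter.atTop] (fun n : ℕ => Real.log n) := by
  -- For `n ≥ 2` both `Nat.log 2 n` and `1` are at most `Real.log n / Real.log 2`, so `Nat.log 2 n +
  -- 2` is at most three times this quotient.
  refine Asymptotics.IsBigO.of_bound (3 / Real.log 2 * ((K + 1) * 2 ^ m)) ?_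
  filter_upwards [Filter.eventually_ge_atTop 2] with n hn
  have hl2 : 0 < Real.log 2 := Real.log_pos (by norm_num)
  have hn' : (2 : ℝ) ≤ n := by exact_mod_cast hn
  have h0 : Real.log 2 ≤ Real.log n := Real.log_le_log (by norm_num) hn'
  have h1 : (Nat.log 2 n : ℝ) * Real.log 2 ≤ Real.log n := by
    rw [← Real.log_pow]
    refine Real.log_le_log (by positivity) ?_
    exact_mod_cast Nat.pow_log_le_self 2 (by omega)
  have h2 : (Nat.log 2 n : ℝ) + 2 ≤ 3 / Real.log 2 * Real.log n := by
    rw [div_mul_eq_mul_div, le_div_iff₀ hl2]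
    nlinarith
  rw [Real.norm_of_nonneg (by positivity), Real.norm_of_nonneg (by linarith)]
  unfold certLength
  push_cast
  calc ((Nat.log 2 n : ℝ) + 2) * ((K + 1) * 2 ^ m)
      ≤ (3 / Real.log 2 * Real.log n) * ((K + 1) * 2 ^ m) := by gcongr
    _ = _ := by ring

/-! ### Certification by numerical labels -/

/-- The identifiers and labels of the neighbours of `v`. -/
def labelView {V L : Type} (G : SimpleGraph V) (ident : V → ℕ) (c : V → L) (v : V) :
    Set (ℕ × L) :=
  {q | ∃ w, G.Adj v w ∧ q = (ident w, c w)}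

/-- A class is certified by labels that are coded by boundedly many numbers of polynomial size. -/
theorem hasLogCertification_of_labels {k : ℕ} {𝒞 : GraphClass} {L : Type} {m : ℕ}
    (enc : L → Fin m → ℕ) (henc : Function.Injective enc)
    (A : ℕ → L → Set (ℕ × L) → Prop) (K : ℕ)
    (complete : ∀ (V : Type) [Fintype V] (G : SimpleGraph V) (ident : V → ℕ),
      G.Connected → IsIdentifierAssignment k ident → 𝒞 V G →
        ∃ c : V → L, (∀ v i, enc (c v) i ≤ (Fintype.card V + 1) ^ K) ∧
          ∀ v, A (ident v) (c v) (labelView G ident c v))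
    (sound : ∀ (V : Type) [Fintype V] (G : SimpleGraph V) (ident : V → ℕ),
      G.Connected → IsIdentifierAssignment k ident → ∀ c : V → L,
        (∀ v, A (ident v) (c v) (labelView G ident c v)) → 𝒞 V G) :
    HasLogCertification k 𝒞 := by
  classical
  let e : L → Certificate := fun l => Nat.bits (vecCode m (enc l))
  have he : Function.Injective e :=
    nat_bits_injective.comp ((vecCode_injective m).comp henc)
  -- Soundness concerns arbitrary bit strings, so strings that code no label are rejected, at the
  -- vertex itself and at its neighbours. All other strings decode uniquely since `e` is injective.
  refine ⟨fun i b s => decide (∃ l, b = e l ∧ (∀ q ∈ s, ∃ l', q.2 = e l') ∧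
    A i l {q | (q.1, e q.2) ∈ s}), certLength K m, ⟨?_, ?_⟩, certLength_isBigO K m⟩
  · intro V _ G ident hG hid hC
    obtain ⟨c, hc, hA⟩ := complete V G ident hG hid hC
    refine ⟨fun v => e (c v), fun v => length_bits_vecCode_le _ (hc v), fun v => ?_⟩
    rw [decide_eq_true_iff]
    refine ⟨c v, rfl, ?_, ?_⟩
    · intro q hq
      obtain ⟨w, -, rfl⟩ := Finset.mem_image.mp hq
      exact ⟨_, rfl⟩
    · convert hA v using 1
      ext ⟨i, l⟩
      simp only [neighborView, Finset.mem_image, Finset.mem_filter, Finset.mem_univ, true_and,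
        Prod.mk.injEq, Set.mem_ofPred_eq, labelView]
      constructor
      · rintro ⟨w, hw, rfl, h⟩
        exact ⟨w, hw, rfl, (he h).symm⟩
      · rintro ⟨w, hw, rfl, rfl⟩
        exact ⟨w, hw, rfl, rfl⟩
  · intro V _ G ident hG hid hC b hacc
    apply hC
    have hacc' := fun v => of_decide_eq_true (hacc v)
    choose c hc _ hA using hacc'
    refine sound V G ident hG hid c fun v => ?_
    convert hA v using 1
    ext ⟨i, l⟩
    simp only [neighborView, Finset.mem_image, Finset.mem_filter, Finset.mem_univ, true_and,
        Prod.mk.injEq, Set.mem_ofPred_eq, labelView]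
    constructor
    · rintro ⟨w, hw, rfl, rfl⟩
      exact ⟨w, hw, rfl, hc w⟩
    · rintro ⟨w, hw, rfl, h⟩
      exact ⟨w, hw, rfl, (he ((hc w).symm.trans h)).symm⟩

/-- Certification only depends on the connected members of a class. -/
theorem HasLogCertification.congr {k : ℕ} {𝒞 𝒟 : GraphClass} (h : HasLogCertification k 𝒞)
    (hiff : ∀ (V : Type) [Fintype V] (G : SimpleGraph V), G.Connected → (𝒞 V G ↔ 𝒟 V G)) :
    HasLogCertification k 𝒟 := by
  obtain ⟨A, f, hA, hf⟩ := h
  refine ⟨A, f, ⟨?_, ?_⟩, hf⟩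
  · intro V _ G ident hG hid hC
    exact hA.complete V G ident hG hid ((hiff V G hG).mpr hC)
  · intro V _ G ident hG hid hC
    exact hA.sound V G ident hG hid fun h => hC ((hiff V G hG).mp h)

/-- In a connected graph, a function that is constant along edges is constant. -/
theorem SimpleGraph.Connected.eq_of_adj_eq {V α : Type*} {G : SimpleGraph V} (hG : G.Connected)
    {f : V → α} (hf : ∀ x y, G.Adj x y → f x = f y) (x y : V) : f x = f y := by
  obtain ⟨p⟩ := hG.preconnected x y
  induction p with
  | nil => rfl
  | cons h _ ih => exact (hf _ _ h).trans ih

/-- Unions of certifiable classes are certifiable. -/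
theorem HasLogCertification.union {k : ℕ} {𝒞 𝒟 : GraphClass} (h₁ : HasLogCertification k 𝒞)
    (h₂ : HasLogCertification k 𝒟) : HasLogCertification k fun V G => 𝒞 V G ∨ 𝒟 V G := by
  classical
  obtain ⟨A, f, hA, hf⟩ := h₁
  obtain ⟨B, g, hB, hg⟩ := h₂
  let tl : Finset (ℕ × Certificate) → Finset (ℕ × Certificate) :=
    fun s => s.image fun q => (q.1, q.2.tail)
  have htl : ∀ {V : Type} [Fintype V] (G : SimpleGraph V) (ident : V → ℕ) (c : V → Certificate)
      (v : V), tl (neighborView G ident c v) = neighborView G ident (fun v => (c v).tail) v := by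
    intro V _ G ident c v
    simp only [tl, neighborView, Finset.image_image]
    rfl
  -- The first bit selects the verifier. Comparing it with the neighbours makes the choice global in
  -- a connected graph; an empty certificate satisfies neither alternative.
  refine ⟨fun i b s => decide ((∀ q ∈ s, q.2.head? = b.head?) ∧
    (b.head? = some true ∧ A i b.tail (tl s) = true ∨
      b.head? = some false ∧ B i b.tail (tl s) = true)), fun n => f n + g n + 1, ⟨?_, ?_⟩, ?_⟩
  · rintro V _ G ident hG hid (hC | hC)
    · obtain ⟨c, hc, hacc⟩ := hA.complete V G ident hG hid hC
      refine ⟨fun v => true :: c v, fun v => ?_, fun v => ?_⟩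
      · have := hc v
        simp only [List.length_cons]
        omega
      · rw [decide_eq_true_iff, htl]
        refine ⟨?_, Or.inl ⟨rfl, hacc v⟩⟩
        intro q hq
        obtain ⟨w, -, rfl⟩ := Finset.mem_image.mp hq
        rfl
    · obtain ⟨c, hc, hacc⟩ := hB.complete V G ident hG hid hC
      refine ⟨fun v => false :: c v, fun v => ?_, fun v => ?_⟩
      · have := hc v
        simp only [List.length_cons]
        omega
      · rw [decide_eq_true_iff, htl]
        refine ⟨?_, Or.inr ⟨rfl, hacc v⟩⟩
        intro q hq
        obtain ⟨w, -, rfl⟩ := Finset.mem_image.mp hq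
        rfl
  · intro V _ G ident hG hid hC c hacc
    have hacc' := fun v => of_decide_eq_true (hacc v)
    have hhd : ∀ x y, (c x).head? = (c y).head? := by
      refine hG.eq_of_adj_eq fun x y hxy => ?_
      refine ((hacc' x).1 (ident y, c y) ?_).symm
      exact Finset.mem_image.mpr ⟨y, by simpa using hxy, rfl⟩
    obtain ⟨v₀⟩ := hG.nonempty
    rcases (hacc' v₀).2 with ⟨h0, -⟩ | ⟨h0, -⟩
    · refine hA.sound V G ident hG hid (fun h => hC (Or.inl h)) (fun v => (c v).tail) fun v => ?_
      rcases (hacc' v).2 with ⟨-, h⟩ | ⟨h, -⟩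
      · rwa [htl] at h
      · rw [hhd v v₀, h0] at h
        simp at h
    · refine hB.sound V G ident hG hid (fun h => hC (Or.inr h)) (fun v => (c v).tail) fun v => ?_
      rcases (hacc' v).2 with ⟨h, -⟩ | ⟨-, h⟩
      · rw [hhd v v₀, h0] at h
        simp at h
      · rwa [htl] at h
  · have h1 : (fun _ : ℕ => (1 : ℝ)) =O[Filter.atTop] (fun n : ℕ => Real.log n) := by
      have : Filter.Tendsto (fun n : ℕ => Real.log n) Filter.atTop Filter.atTop :=
        Real.tendsto_log_atTop.comp tendsto_natCast_atTop_atTop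
      exact (Asymptotics.isLittleO_const_left.mpr
        (Or.inr (Filter.tendsto_abs_atTop_atTop.comp this))).isBigO
    have := (hf.add hg).add h1
    simpa using this

/-! ### Connected vertex sets and minors -/

/-- The set `B` is nonempty and connected in `G`: a subset of `B` that is not empty and closed
under adjacency in `B` is all of `B`. -/
def ConnSet {V : Type*} (G : SimpleGraph V) (B : Set V) : Prop :=
  B.Nonempty ∧ ∀ C : Set V, (∃ x ∈ B, x ∈ C) →
    (∀ a b, a ∈ B → a ∈ C → b ∈ B → G.Adj a b → b ∈ C) → B ⊆ C

section ConnSet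

variable {V : Type*} {G G' : SimpleGraph V} {B D : Set V}

/-- A walk inside `B` cannot leave a closed set, and the set of vertices reachable inside `B` is
closed. The closure form spares the later arguments walks and subtypes. -/
theorem induce_connected_iff : (G.induce B).Connected ↔ ConnSet G B := by
  constructor
  · intro h
    refine ⟨Set.nonempty_coe_sort.mp h.nonempty, ?_⟩
    rintro C ⟨x, hxB, hxC⟩ hcl y hy
    obtain ⟨p⟩ := h.preconnected ⟨x, hxB⟩ ⟨y, hy⟩
    have key : ∀ (u v : B) (p : (G.induce B).Walk u v), (u : V) ∈ C → (v : V) ∈ C := by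
      intro u v p
      induction p with
      | nil => exact id
      | @cons a b c hab _ ih =>
        intro ha
        exact ih (hcl a b a.2 ha b.2 hab)
    exact key _ _ p hxC
  · rintro ⟨hne, h⟩
    have : Nonempty B := Set.nonempty_coe_sort.mpr hne
    refine SimpleGraph.Connected.mk ?_
    rintro ⟨x, hx⟩ ⟨y, hy⟩
    have := h {z | ∃ hz : z ∈ B, (G.induce B).Reachable ⟨x, hx⟩ ⟨z, hz⟩}
      ⟨x, hx, hx, SimpleGraph.Reachable.refl _⟩ ?_ hy
    · exact this.2
    · rintro a b ha ⟨_, hra⟩ hb hab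
      exact ⟨hb, hra.trans (SimpleGraph.Adj.reachable (by simpa using hab))⟩

theorem connSet_univ_iff : ConnSet G Set.univ ↔ G.Connected := by
  constructor
  · rintro ⟨⟨x, -⟩, h⟩
    have : Nonempty V := ⟨x⟩
    refine SimpleGraph.Connected.mk fun a b => ?_
    exact h {z | G.Reachable a z} ⟨a, trivial, SimpleGraph.Reachable.refl _⟩
      (fun u v _ hu _ huv => SimpleGraph.Reachable.trans hu huv.reachable) (Set.mem_univ b)
  · intro h
    obtain ⟨x⟩ := h.nonempty
    refine ⟨⟨x, trivial⟩, ?_⟩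
    rintro C ⟨u, -, hu⟩ hcl v -
    obtain ⟨p⟩ := h.preconnected u v
    induction p with
    | nil => exact hu
    | cons hab _ ih => exact ih (hcl _ _ trivial hu trivial hab)

theorem ConnSet.singleton (x : V) : ConnSet G {x} := by
  refine ⟨⟨x, rfl⟩, ?_⟩
  rintro C ⟨y, rfl, hy⟩ - z rfl
  exact hy

theorem ConnSet.mono (h : ConnSet G B)
    (hle : ∀ a b, a ∈ B → b ∈ B → G.Adj a b → G'.Adj a b) : ConnSet G' B :=
  ⟨h.1, fun C hx hcl => h.2 C hx fun a b ha haC hb hab => hcl a b ha haC hb (hle a b ha hb hab)⟩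

/-- Leaving a set inside a connected set uses an edge. -/
theorem ConnSet.exists_adj (h : ConnSet G B) {C : Set V} {x y : V} (hx : x ∈ B) (hxC : x ∈ C)
    (hy : y ∈ B) (hyC : y ∉ C) : ∃ a ∈ B, ∃ b ∈ B, a ∈ C ∧ b ∉ C ∧ G.Adj a b := by
  by_contra hcon
  push Not at hcon
  exact hyC (h.2 C ⟨x, hx, hxC⟩ (fun a b ha haC hb hab => by
    by_contra hbC
    exact hcon a ha b hb haC hbC hab) hy)

/-- Two connected sets that meet or are joined by an edge have a connected union. -/
theorem ConnSet.union (hB : ConnSet G B) (hD : ConnSet G D) {x y : V} (hx : x ∈ B) (hy : y ∈ D)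
    (hxy : x = y ∨ G.Adj x y) : ConnSet G (B ∪ D) := by
  refine ⟨⟨x, Or.inl hx⟩, ?_⟩
  intro C hC hcl
  have hBC : ∀ z ∈ B, z ∈ C → B ⊆ C := fun z hz hzC => hB.2 C ⟨z, hz, hzC⟩
    fun a b ha haC hb hab => hcl a b (Or.inl ha) haC (Or.inl hb) hab
  have hDC : ∀ z ∈ D, z ∈ C → D ⊆ C := fun z hz hzC => hD.2 C ⟨z, hz, hzC⟩
    fun a b ha haC hb hab => hcl a b (Or.inr ha) haC (Or.inr hb) hab
  have hxyC : x ∈ C ↔ y ∈ C := by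
    rcases hxy with rfl | hxy
    · rfl
    · exact ⟨fun h => hcl x y (Or.inl hx) h (Or.inr hy) hxy,
        fun h => hcl y x (Or.inr hy) h (Or.inl hx) hxy.symm⟩
  obtain ⟨z, hz | hz, hzC⟩ := hC
  · have h1 := hBC z hz hzC
    exact Set.union_subset h1 (hDC y hy (hxyC.mp (h1 hx)))
  · have h1 := hDC z hz hzC
    exact Set.union_subset (hBC x hx (hxyC.mpr (h1 hy))) h1

theorem ConnSet.insert (hB : ConnSet G B) {x y : V} (hx : x ∈ B) (hxy : G.Adj x y) :
    ConnSet G (insert y B) := by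
  have := hB.union (ConnSet.singleton y) hx rfl (Or.inr hxy)
  rwa [Set.union_comm] at this

/-- A set in which every vertex is linked to a fixed one by a relation made of edges inside the
set is connected. -/
theorem ConnSet.of_reflTransGen {r : V → V → Prop} {w : V} (hw : w ∈ B)
    (hr : ∀ x ∈ B, Relation.ReflTransGen r x w)
    (hadj : ∀ x y, x ∈ B → x ≠ w → r x y → G.Adj x y ∧ y ∈ B) : ConnSet G B := by
  have key : ∀ C : Set V, (∀ a b, a ∈ B → a ∈ C → b ∈ B → G.Adj a b → b ∈ C) →
      ∀ x, Relation.ReflTransGen r x w → x ∈ B → (x ∈ C ↔ w ∈ C) := by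
    intro C hcl x hxw
    induction hxw using Relation.ReflTransGen.head_induction_on with
    | refl => exact fun _ => Iff.rfl
    | head hxy hyw ih =>
      rename_i x y
      intro hx
      by_cases hxw : x = w
      · rw [hxw]
      · obtain ⟨h1, h2⟩ := hadj x y hx hxw hxy
        rw [← ih h2]
        exact ⟨fun h => hcl x y hx h h2 h1, fun h => hcl y x h2 h hx h1.symm⟩
  refine ⟨⟨w, hw⟩, ?_⟩
  rintro C ⟨x, hx, hxC⟩ hcl y hy
  exact (key C hcl y (hr y hy) hy).mpr ((key C hcl x (hr x hx) hx).mp hxC)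

end ConnSet

/-! ### Minors, subgraphs and edge contraction -/

section Minor

variable {V W U : Type*} {G G' : SimpleGraph V} {H : SimpleGraph W}

theorem isMinor_iff : IsMinor H G ↔ ∃ B : W → Set V, (∀ i, ConnSet G (B i)) ∧
    (∀ i j, i ≠ j → ∀ x ∈ B i, x ∉ B j) ∧
    ∀ i j, H.Adj i j → ∃ x ∈ B i, ∃ y ∈ B j, G.Adj x y := by
  simp only [IsMinor, induce_connected_iff, Set.disjoint_left]

/-- Being a minor is monotone in the smaller graph. -/
theorem IsMinor.of_injective {K : SimpleGraph U} (h : IsMinor H G) (f : U → W)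
    (hf : Function.Injective f) (hadj : ∀ i j, K.Adj i j → H.Adj (f i) (f j)) : IsMinor K G := by
  obtain ⟨B, h1, h2, h3⟩ := h
  exact ⟨fun i => B (f i), fun i => h1 _, fun i j hij => h2 _ _ (hf.ne hij),
    fun i j hij => h3 _ _ (hadj i j hij)⟩

/-- A subgraph is a minor. -/
theorem isMinor_of_injective (f : W → V) (hf : Function.Injective f)
    (hadj : ∀ i j, H.Adj i j → G.Adj (f i) (f j)) : IsMinor H G := by
  rw [isMinor_iff]
  refine ⟨fun i => {f i}, fun i => ConnSet.singleton _, ?_, ?_⟩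
  · rintro i j hij x rfl h
    exact hij (hf h)
  · intro i j hij
    exact ⟨_, rfl, _, rfl, hadj i j hij⟩

theorem IsMinor.mono (h : IsMinor H G) (hle : G ≤ G') : IsMinor H G' := by
  rw [isMinor_iff] at h ⊢
  obtain ⟨B, h1, h2, h3⟩ := h
  refine ⟨B, fun i => (h1 i).mono fun a b _ _ hab => hle hab, h2, fun i j hij => ?_⟩
  obtain ⟨x, hx, y, hy, hxy⟩ := h3 i j hij
  exact ⟨x, hx, y, hy, hle hxy⟩

theorem IsMinor.card_le [Fintype V] [Fintype W] (h : IsMinor H G) :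
    Fintype.card W ≤ Fintype.card V := by
  rw [isMinor_iff] at h
  obtain ⟨B, h1, h2, -⟩ := h
  choose f hf using fun i => (h1 i).1
  refine Fintype.card_le_of_injective f fun i j hij => ?_
  by_contra hne
  exact h2 i j hne (f i) (hf i) (hij ▸ hf j)

/-- If `G'` arises from `G` by contracting the edge `xs` to `s` (and possibly deleting edges), then
minors of `G'` without isolated vertices are minors of `G`. -/
theorem IsMinor.of_contract (h : IsMinor H G') {x s : V} (hxs : G.Adj x s)
    (hH : ∀ i, ∃ j, H.Adj i j)
    (hG : ∀ u v, G'.Adj u v → u ≠ x ∧ v ≠ x ∧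
      (G.Adj u v ∨ (u = s ∧ G.Adj x v) ∨ (v = s ∧ G.Adj x u))) : IsMinor H G := by
  classical
  rw [isMinor_iff] at h ⊢
  obtain ⟨B, h1, h2, h3⟩ := h
  -- Here `hH` is needed: `x` is isolated in `G'`, so a branch set containing it would be `{x}` and
  -- could not be joined to another one.
  have hx : ∀ i, x ∉ B i := by
    intro i hxi
    obtain ⟨j, hij⟩ := hH i
    obtain ⟨u, hu, v, hv, huv⟩ := h3 i j hij
    obtain ⟨a, -, b, -, rfl, -, hab⟩ := (h1 i).exists_adj (C := {x}) hxi rfl hu (hG u v huv).1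
    exact (hG _ _ hab).1 rfl
  -- Undoing the contraction: `x` joins the branch set that contains `s`, if there is one.
  refine ⟨fun i => {z | z ∈ B i ∨ (z = x ∧ s ∈ B i)}, ?_, ?_, ?_⟩
  · intro i
    obtain ⟨y, hy⟩ := (h1 i).1
    refine ⟨⟨y, Or.inl hy⟩, ?_⟩
    rintro C hzC hcl
    have hz' : ∃ z ∈ B i, z ∈ C := by
      obtain ⟨z, hz | ⟨rfl, hs⟩, hzC⟩ := hzC
      · exact ⟨z, hz, hzC⟩
      · exact ⟨s, hs, hcl z s (Or.inr ⟨rfl, hs⟩) hzC (Or.inl hs) hxs⟩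
    have hB : B i ⊆ C := by
      refine (h1 i).2 C hz' fun a b ha haC hb hab => ?_
      obtain ⟨-, -, hab | ⟨rfl, hab⟩ | ⟨rfl, hab⟩⟩ := hG a b hab
      · exact hcl a b (Or.inl ha) haC (Or.inl hb) hab
      · exact hcl x b (Or.inr ⟨rfl, ha⟩) (hcl a x (Or.inl ha) haC (Or.inr ⟨rfl, ha⟩) hxs.symm)
          (Or.inl hb) hab
      · exact hcl x b (Or.inr ⟨rfl, hb⟩) (hcl a x (Or.inl ha) haC (Or.inr ⟨rfl, hb⟩) hab.symm)
          (Or.inl hb) hxs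
    rintro z (hz | ⟨rfl, hs⟩)
    · exact hB hz
    · exact hcl s z (Or.inl hs) (hB hs) (Or.inr ⟨rfl, hs⟩) hxs.symm
  · rintro i j hij z (hz | ⟨rfl, hs⟩) (hz' | ⟨hzx, hs'⟩)
    · exact h2 i j hij z hz hz'
    · exact hx i (hzx ▸ hz)
    · exact hx j hz'
    · exact h2 i j hij s hs hs'
  · intro i j hij
    obtain ⟨u, hu, v, hv, huv⟩ := h3 i j hij
    obtain ⟨-, -, huv | ⟨rfl, huv⟩ | ⟨rfl, huv⟩⟩ := hG u v huv
    · exact ⟨u, Or.inl hu, v, Or.inl hv, huv⟩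
    · exact ⟨x, Or.inr ⟨rfl, hu⟩, v, Or.inl hv, huv⟩
    · exact ⟨u, Or.inl hu, x, Or.inr ⟨rfl, hv⟩, huv.symm⟩

end Minor

/-! ### Trees with hubs -/

/-- A forest structure on the vertices of `G`, given by a parent relation `P` and a second
relation `Q` which links a vertex to its hub, one of its proper ancestors. Each edge of `G` joins a
vertex to its parent or to its hub. -/
structure HubTree {V : Type*} (G : SimpleGraph V) (P Q : V → V → Prop) (depth : V → ℕ) :
    Prop where
  parent_unique : ∀ {v u u'}, P v u → P v u' → u = u'
  hub_unique : ∀ {v u u'}, Q v u → Q v u' → u = u'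
  depth_lt : ∀ {v u}, P v u → depth u < depth v
  hub_step : ∀ {v a}, Q v a → ∃ u, P v u ∧ (P u a ∨ Q u a)
  adj : ∀ {x y}, G.Adj x y → (P x y ∨ Q x y) ∨ (P y x ∨ Q y x)

namespace HubTree

variable {V W : Type*} {G : SimpleGraph V} {H : SimpleGraph W} {P Q : V → V → Prop}
  {depth : V → ℕ} {B : Set V}

open Relation

/-- By `hub_step` the hub is handed up from parent to parent until it is the parent itself; this
ends because the depth decreases. -/
theorem transGen_of_hub (h : HubTree G P Q depth) {v a : V} (hva : Q v a) : TransGen P v a := by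
  induction hd : depth v using Nat.strong_induction_on generalizing v with
  | _ n ih =>
    obtain ⟨u, hu, hua | hua⟩ := h.hub_step hva
    · exact TransGen.tail (TransGen.single hu) hua
    · exact TransGen.head hu (ih _ (hd ▸ h.depth_lt hu) hua rfl)

theorem depth_le (h : HubTree G P Q depth) {v a : V} (hva : ReflTransGen P v a) :
    depth a ≤ depth v := by
  induction hva with
  | refl => exact le_rfl
  | tail _ hbc ih => exact (h.depth_lt hbc).le.trans ih

theorem depth_lt_of_transGen (h : HubTree G P Q depth) {v a : V} (hva : TransGen P v a) :
    depth a < depth v := by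
  obtain ⟨b, hb, hba⟩ := TransGen.tail'_iff.mp hva
  exact (h.depth_lt hba).trans_le (h.depth_le hb)

theorem eq_of_depth_le (h : HubTree G P Q depth) {v a : V} (hva : ReflTransGen P v a)
    (hd : depth v ≤ depth a) : v = a := by
  rcases reflTransGen_iff_eq_or_transGen.mp hva with h1 | h1
  · exact h1.symm
  · exact absurd (h.depth_lt_of_transGen h1) (by omega)

/-- Ancestors of a vertex are comparable. -/
theorem comparable (h : HubTree G P Q depth) {x v w : V} (hv : ReflTransGen P x v)
    (hw : ReflTransGen P x w) : ReflTransGen P v w ∨ ReflTransGen P w v := by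
  induction hv with
  | refl => exact Or.inl hw
  | tail _ hbc ih =>
    rename_i b c
    rcases ih with h1 | h1
    · rcases h1.cases_head with rfl | ⟨d, hd, hdw⟩
      · exact Or.inr (ReflTransGen.single hbc)
      · exact Or.inl (h.parent_unique hd hbc ▸ hdw)
    · exact Or.inr (h1.tail hbc)

/-- The parent and the hub of a descendant of `w` are descendants of `w`, or the parent or hub of
`w`. -/
theorem link_of_descendant (h : HubTree G P Q depth) {w x y : V} (hx : ReflTransGen P x w)
    (hxy : P x y ∨ Q x y) : ReflTransGen P y w ∨ P w y ∨ Q w y := by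
  induction hx using ReflTransGen.head_induction_on generalizing y with
  | refl => exact Or.inr hxy
  | head hab hbw ih =>
    rename_i a b
    rcases hxy with hxy | hxy
    · rw [h.parent_unique hxy hab]
      exact Or.inl hbw
    · obtain ⟨u, hu, hu'⟩ := h.hub_step hxy
      rw [h.parent_unique hu hab] at hu'
      exact ih hu'

/-- The neighbours of the subtree of `w` are the parent and the hub of `w`. -/
theorem adj_descendant (h : HubTree G P Q depth) {w x y : V} (hx : ReflTransGen P x w)
    (hxy : G.Adj x y) : ReflTransGen P y w ∨ P w y ∨ Q w y := by
  rcases h.adj hxy with h1 | h1 | h1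
  · exact h.link_of_descendant hx h1
  · exact Or.inl (ReflTransGen.head h1 hx)
  · exact Or.inl ((h.transGen_of_hub h1).to_reflTransGen.trans hx)

theorem depth_link_lt (h : HubTree G P Q depth) {w z : V} (hz : P w z ∨ Q w z) :
    depth z < depth w := by
  rcases hz with hz | hz
  · exact h.depth_lt hz
  · exact h.depth_lt_of_transGen (h.transGen_of_hub hz)

/-- A connected set that leaves the subtree of `w` contains the parent or the hub of `w`. -/
theorem exists_link_mem (h : HubTree G P Q depth) (hB : ConnSet G B) {w x y : V} (hx : x ∈ B)
    (hxw : ReflTransGen P x w) (hy : y ∈ B) (hyw : ¬ ReflTransGen P y w) :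
    ∃ z ∈ B, P w z ∨ Q w z := by
  obtain ⟨a, -, b, hb, ha, hbw, hab⟩ :=
    hB.exists_adj (C := {z | ReflTransGen P z w}) hx hxw hy hyw
  rcases h.adj_descendant ha hab with h1 | h1
  · exact absurd h1 hbw
  · exact ⟨b, hb, h1⟩

/-- A connected set has a common ancestor in it. -/
theorem exists_top (h : HubTree G P Q depth) (hB : ConnSet G B) :
    ∃ w ∈ B, ∀ x ∈ B, ReflTransGen P x w := by
  classical
  -- A vertex of least depth is the top: leaving its subtree would put its parent or its hub into
  -- `B`, and both have smaller depth.
  obtain ⟨w, hw, hmin⟩ : ∃ w ∈ B, ∀ x ∈ B, depth w ≤ depth x := by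
    have hne : (depth '' B).Nonempty := hB.1.image _
    obtain ⟨w, hw, hwd⟩ := Nat.sInf_mem hne
    exact ⟨w, hw, fun x hx => hwd ▸ Nat.sInf_le ⟨x, hx, rfl⟩⟩
  refine ⟨w, hw, fun x hx => ?_⟩
  by_contra hcon
  obtain ⟨z, hz, hz'⟩ := h.exists_link_mem hB hw ReflTransGen.refl hx hcon
  exact absurd (hmin z hz) (by have := h.depth_link_lt hz'; omega)

/-- In a model of a minor there is a branch set with a top vertex `w` which is deepest: all branch
sets adjacent to it contain the parent or the hub of `w`, and no other branch set lies inside the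
subtree of `w`. -/
theorem exists_deepest [Finite W] [Nonempty W] (h : HubTree G P Q depth) {B : W → Set V}
    (h1 : ∀ i, ConnSet G (B i)) (h2 : ∀ i j, i ≠ j → ∀ x ∈ B i, x ∉ B j)
    (h3 : ∀ i j, H.Adj i j → ∃ x ∈ B i, ∃ y ∈ B j, G.Adj x y) :
    ∃ i, ∃ w ∈ B i, (∀ x ∈ B i, ReflTransGen P x w) ∧
      (∀ j, j ≠ i → ∃ x ∈ B j, ¬ ReflTransGen P x w) ∧
      ∀ j, H.Adj i j → ∃ z ∈ B j, P w z ∨ Q w z := by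
  choose t ht htop using fun i => h.exists_top (h1 i)
  -- If the top of another branch set were in the subtree of `t i`, maximality of the depth would
  -- make it equal to `t i`, against disjointness. So each other branch set has a vertex outside
  -- this subtree.
  obtain ⟨i, hi⟩ := Finite.exists_max fun i => depth (t i)
  have hout : ∀ j, j ≠ i → ¬ ReflTransGen P (t j) (t i) := by
    intro j hj hcon
    have := h.eq_of_depth_le hcon (hi j)
    exact h2 j i hj _ (ht j) (this ▸ ht i)
  refine ⟨i, t i, ht i, htop i, fun j hj => ⟨t j, ht j, hout j hj⟩, fun j hij => ?_⟩
  obtain ⟨x, hx, y, hy, hxy⟩ := h3 i j hij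
  rcases h.adj_descendant (htop i x hx) hxy with hyw | hyw
  · exact h.exists_link_mem (h1 j) hy hyw (ht j) (hout j hij.ne')
  · exact ⟨y, hy, hyw⟩

/-- A graph with a hub tree has no minor all of whose vertices have three neighbours. -/
theorem not_isMinor_of_three [Finite W] [Nonempty W] (h : HubTree G P Q depth)
    (hH : ∀ i, ∃ a b c, a ≠ b ∧ a ≠ c ∧ b ≠ c ∧ H.Adj i a ∧ H.Adj i b ∧ H.Adj i c) :
    ¬ IsMinor H G := by
  rw [isMinor_iff]
  rintro ⟨B, h1, h2, h3⟩
  obtain ⟨i, w, -, -, -, hn⟩ := h.exists_deepest h1 h2 h3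
  obtain ⟨a, b, c, hab, hac, hbc, ha, hb, hc⟩ := hH i
  obtain ⟨x, hx, hx'⟩ := hn a ha
  obtain ⟨y, hy, hy'⟩ := hn b hb
  obtain ⟨z, hz, hz'⟩ := hn c hc
  have hxy : x ≠ y := fun e => h2 a b hab x hx (e ▸ hy)
  have hxz : x ≠ z := fun e => h2 a c hac x hx (e ▸ hz)
  have hyz : y ≠ z := fun e => h2 b c hbc y hy (e ▸ hz)
  -- Pigeonhole: three different vertices cannot all be the parent or the hub of `w`.
  rcases hx' with hx' | hx' <;> rcases hy' with hy' | hy' <;> rcases hz' with hz' | hz'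
  all_goals first
    | exact hxy (h.parent_unique hx' hy')
    | exact hxz (h.parent_unique hx' hz')
    | exact hyz (h.parent_unique hy' hz')
    | exact hxy (h.hub_unique hx' hy')
    | exact hxz (h.hub_unique hx' hz')
    | exact hyz (h.hub_unique hy' hz')

/-- A graph with a tree without hubs has no minor all of whose vertices have two neighbours. -/
theorem not_isMinor_of_two [Finite W] [Nonempty W] (h : HubTree G P Q depth)
    (hQ : ∀ x y, ¬ Q x y) (hH : ∀ i, ∃ a b, a ≠ b ∧ H.Adj i a ∧ H.Adj i b) :
    ¬ IsMinor H G := by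
  rw [isMinor_iff]
  rintro ⟨B, h1, h2, h3⟩
  obtain ⟨i, w, -, -, -, hn⟩ := h.exists_deepest h1 h2 h3
  obtain ⟨a, b, hab, ha, hb⟩ := hH i
  obtain ⟨x, hx, hx' | hx'⟩ := hn a ha
  swap
  · exact hQ _ _ hx'
  obtain ⟨y, hy, hy' | hy'⟩ := hn b hb
  swap
  · exact hQ _ _ hy'
  exact h2 a b hab x hx (h.parent_unique hx' hy' ▸ hy)

end HubTree

/-! ### Vertices of small degree in graphs without `K₄` minor -/

/-- Some edge joins `A` to `B`. -/
def Linked {V : Type*} (G : SimpleGraph V) (A B : Set V) : Prop := ∃ x ∈ A, ∃ y ∈ B, G.Adj x y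

theorem Linked.symm {V : Type*} {G : SimpleGraph V} {A B : Set V} (h : Linked G A B) :
    Linked G B A := by
  obtain ⟨x, hx, y, hy, hxy⟩ := h
  exact ⟨y, hy, x, hx, hxy.symm⟩

theorem Linked.mono {V : Type*} {G : SimpleGraph V} {A B A' B' : Set V} (h : Linked G A B)
    (hA : A ⊆ A') (hB : B ⊆ B') : Linked G A' B' := by
  obtain ⟨x, hx, y, hy, hxy⟩ := h
  exact ⟨x, hA hx, y, hB hy, hxy⟩

theorem SimpleGraph.Adj.linked {V : Type*} {G : SimpleGraph V} {A B : Set V} {x y : V}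
    (h : G.Adj x y) (hx : x ∈ A) (hy : y ∈ B) : Linked G A B := ⟨x, hx, y, hy, h⟩

/-- Four branch sets give a minor on four vertices. -/
theorem isMinor_of_four {V : Type*} {G : SimpleGraph V} {H : SimpleGraph (Fin 4)}
    {A B C D : Set V} (hA : ConnSet G A) (hB : ConnSet G B) (hC : ConnSet G C) (hD : ConnSet G D)
    (hAB : Disjoint A B) (hAC : Disjoint A C) (hAD : Disjoint A D) (hBC : Disjoint B C)
    (hBD : Disjoint B D) (hCD : Disjoint C D)
    (l01 : H.Adj 0 1 → Linked G A B) (l02 : H.Adj 0 2 → Linked G A C)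
    (l03 : H.Adj 0 3 → Linked G A D) (l12 : H.Adj 1 2 → Linked G B C)
    (l13 : H.Adj 1 3 → Linked G B D) (l23 : H.Adj 2 3 → Linked G C D) : IsMinor H G := by
  refine ⟨![A, B, C, D], ?_, ?_, ?_⟩
  · intro i
    rw [induce_connected_iff]
    fin_cases i <;> assumption
  · intro i j hij
    fin_cases i <;> fin_cases j
    all_goals first
      | exact absurd rfl hij
      | assumption
      | exact Disjoint.symm (by assumption)
  · intro i j hij
    change Linked G _ _
    fin_cases i <;> fin_cases j
    all_goals first
      | exact absurd hij H.irrefl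
      | exact l01 hij
      | exact l02 hij
      | exact l03 hij
      | exact l12 hij
      | exact l13 hij
      | exact l23 hij
      | exact (l01 hij.symm).symm
      | exact (l02 hij.symm).symm
      | exact (l03 hij.symm).symm
      | exact (l12 hij.symm).symm
      | exact (l13 hij.symm).symm
      | exact (l23 hij.symm).symm

/-- The vertex `x` has three neighbours. -/
def HasThree {V : Type*} (G : SimpleGraph V) (x : V) : Prop :=
  ∃ a b c, a ≠ b ∧ a ≠ c ∧ b ≠ c ∧ G.Adj x a ∧ G.Adj x b ∧ G.Adj x c

/-- The graph with the edges of `G` inside `T`. -/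
def SimpleGraph.restrictTo {V : Type*} (G : SimpleGraph V) (T : Set V) : SimpleGraph V where
  Adj u v := G.Adj u v ∧ u ∈ T ∧ v ∈ T
  symm := ⟨fun _ _ h => ⟨h.1.symm, h.2.2, h.2.1⟩⟩
  loopless := ⟨fun _ h => G.irrefl h.1⟩

theorem SimpleGraph.restrictTo_le {V : Type*} (G : SimpleGraph V) (T : Set V) :
    G.restrictTo T ≤ G := fun _ _ h => h.1

/-- The graph `G` with `x` contracted into `s`; `x` becomes isolated. -/
def SimpleGraph.contractTo {V : Type*} (G : SimpleGraph V) (x s : V) : SimpleGraph V where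
  Adj u v := u ≠ v ∧ u ≠ x ∧ v ≠ x ∧ (G.Adj u v ∨ (u = s ∧ G.Adj x v) ∨ (v = s ∧ G.Adj x u))
  symm := ⟨fun _ _ h => ⟨h.1.symm, h.2.2.1, h.2.1, h.2.2.2.elim (fun h => Or.inl h.symm)
    fun h => Or.inr h.symm⟩⟩
  loopless := ⟨fun _ h => h.1 rfl⟩

/-- `Y` consists of the vertices of `T` that are linked to `y` by a chain of edges inside `T`. -/
theorem exists_component {V : Type*} (G : SimpleGraph V) {T : Set V} {y : V} (hy : y ∈ T) :
    ∃ Y ⊆ T, y ∈ Y ∧ ConnSet G Y ∧ ∀ a ∈ Y, ∀ b ∈ T, G.Adj a b → b ∈ Y := by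
  refine ⟨{z | z ∈ T ∧ Relation.ReflTransGen (fun a b => G.Adj a b ∧ b ∈ T) z y},
    fun z hz => hz.1, ⟨hy, Relation.ReflTransGen.refl⟩, ?_, ?_⟩
  · refine ConnSet.of_reflTransGen (r := fun a b => G.Adj a b ∧ b ∈ T ∧
      Relation.ReflTransGen (fun a b => G.Adj a b ∧ b ∈ T) b y) (w := y)
      ⟨hy, Relation.ReflTransGen.refl⟩ ?_ ?_
    · rintro x ⟨-, hx⟩
      induction hx using Relation.ReflTransGen.head_induction_on with
      | refl => exact Relation.ReflTransGen.refl
      | head hab hb ih => exact Relation.ReflTransGen.head ⟨hab.1, hab.2, hb⟩ ih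
    · rintro a b - - ⟨h1, h2, h3⟩
      exact ⟨h1, h2, h3⟩
  · rintro a ⟨haT, ha⟩ b hb hab
    exact ⟨hb, Relation.ReflTransGen.head ⟨hab.symm, haT⟩ ha⟩

theorem exists_adj_top_fin_four (i : Fin 4) : ∃ j, (⊤ : SimpleGraph (Fin 4)).Adj i j := by
  revert i
  simp only [SimpleGraph.top_adj]
  decide

/-- The induction step of `isMinor_K4_of_hasThree` at a vertex `x` adjacent to `s`. -/
theorem isMinor_K4_step {V : Type*} {T : Set V} {G : SimpleGraph V} {s t x : V}
    (ih : ∀ T' ⊂ T, ∀ (G' : SimpleGraph V) (s' t' : V), (∀ u v, G'.Adj u v → u ∈ T') →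
      G'.Adj s' t' → (∃ x ∈ T', x ≠ s' ∧ x ≠ t') →
      (∀ x ∈ T', x ≠ s' → x ≠ t' → HasThree G' x) → IsMinor (⊤ : SimpleGraph (Fin 4)) G')
    (hT : ∀ u v, G.Adj u v → u ∈ T) (hst : G.Adj s t)
    (h3 : ∀ x ∈ T, x ≠ s → x ≠ t → HasThree G x)
    (hxs : G.Adj x s) (hxt : x ≠ t) : IsMinor (⊤ : SimpleGraph (Fin 4)) G := by
  by_contra hK
  have hT' : ∀ u v, G.Adj u v → v ∈ T := fun u v h => hT v u h.symm
  have hxT := hT _ _ hxs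
  have hsT := hT _ _ hst
  have htT := hT' _ _ hst
  have hxs' := hxs.ne
  have hst' := hst.ne
  set X : Set V := {y | y ∈ T ∧ y ≠ x ∧ y ≠ s ∧ y ≠ t} with hX
  have hcases : ∀ u v, G.Adj u v → v ∈ X ∨ v = x ∨ v = s ∨ v = t := by
    intro u v huv
    by_cases h1 : v = x
    · exact Or.inr (Or.inl h1)
    by_cases h2 : v = s
    · exact Or.inr (Or.inr (Or.inl h2))
    by_cases h4 : v = t
    · exact Or.inr (Or.inr (Or.inr h4))
    · exact Or.inl ⟨hT' _ _ huv, h1, h2, h4⟩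
  -- a union of components of `G[X]` is adjacent to `x`, `s` and `t`
  have hcomp : ∀ Y ⊆ X, Y.Nonempty → (∀ a ∈ Y, ∀ b ∈ X, G.Adj a b → b ∈ Y) →
      Linked G Y {x} ∧ Linked G Y {s} ∧ Linked G Y {t} := by
    intro Y hYX ⟨y, hy⟩ hcl
    -- If `Y` misses one of `x`, `s`, `t`, the induction hypothesis applies to `Y` with the other
    -- two, which need an edge between them: `st` and `xs` are in `G`, and `xt` arises by
    -- contracting `s` into `x`. The vertices of `Y` keep all their neighbours.
    refine ⟨?_, ?_, ?_⟩ <;> by_contra hno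
    · refine hK (IsMinor.mono (ih {z | z ∈ Y ∨ z = s ∨ z = t} ?_ (G.restrictTo
        {z | z ∈ Y ∨ z = s ∨ z = t}) s t (fun u v h => h.2.1) ⟨hst, by simp, by simp⟩
        ⟨y, Or.inl hy, (hYX hy).2.2.1, (hYX hy).2.2.2⟩ ?_) (G.restrictTo_le _))
      · refine ⟨?_, fun hsub => ?_⟩
        · rintro z (hz | rfl | rfl)
          exacts [(hYX hz).1, hsT, htT]
        · rcases hsub hxT with h | h | h
          exacts [(hYX h).2.1 rfl, hxs' h, hxt h]
      · rintro z (hz | rfl | rfl) hz1 hz2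
        · obtain ⟨a, b, c, hab, hac, hbc, ha, hb, hc⟩ := h3 z (hYX hz).1 hz1 hz2
          have key : ∀ v, G.Adj z v → (G.restrictTo {z | z ∈ Y ∨ z = s ∨ z = t}).Adj z v := by
            intro v hv
            refine ⟨hv, Or.inl hz, ?_⟩
            rcases hcases _ _ hv with h | h | h | h
            · exact Or.inl (hcl z hz v h hv)
            · exact absurd (hv.linked hz h) hno
            · exact Or.inr (Or.inl h)
            · exact Or.inr (Or.inr h)
          exact ⟨a, b, c, hab, hac, hbc, key a ha, key b hb, key c hc⟩
        · exact absurd rfl hz1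
        · exact absurd rfl hz2
    · have hadj : ((G.contractTo s x).restrictTo {z | z ∈ Y ∨ z = x ∨ z = t}).Adj x t :=
        ⟨⟨hxt, hxs', hst'.symm, Or.inr (Or.inl ⟨rfl, hst⟩)⟩, by simp, by simp⟩
      refine hK (IsMinor.of_contract (IsMinor.mono (ih {z | z ∈ Y ∨ z = x ∨ z = t} ?_
        ((G.contractTo s x).restrictTo {z | z ∈ Y ∨ z = x ∨ z = t}) x t (fun u v h => h.2.1) hadj
        ⟨y, Or.inl hy, (hYX hy).2.1, (hYX hy).2.2.2⟩ ?_) (SimpleGraph.restrictTo_le _ _))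
        hxs.symm exists_adj_top_fin_four fun u v h => ⟨h.2.1, h.2.2.1, h.2.2.2⟩)
      · refine ⟨?_, fun hsub => ?_⟩
        · rintro z (hz | rfl | rfl)
          exacts [(hYX hz).1, hxT, htT]
        · rcases hsub hsT with h | h | h
          exacts [(hYX h).2.2.1 rfl, hxs' h.symm, hst' h]
      · rintro z (hz | rfl | rfl) hz1 hz2
        · obtain ⟨a, b, c, hab, hac, hbc, ha, hb, hc⟩ := h3 z (hYX hz).1 (hYX hz).2.2.1 hz2
          have key : ∀ v, G.Adj z v →
              ((G.contractTo s x).restrictTo {z | z ∈ Y ∨ z = x ∨ z = t}).Adj z v := by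
            intro v hv
            have hvs : v ≠ s := fun h => hno (hv.linked hz h)
            refine ⟨⟨hv.ne, (hYX hz).2.2.1, hvs, Or.inl hv⟩, Or.inl hz, ?_⟩
            rcases hcases _ _ hv with h | h | h | h
            · exact Or.inl (hcl z hz v h hv)
            · exact Or.inr (Or.inl h)
            · exact absurd h hvs
            · exact Or.inr (Or.inr h)
          exact ⟨a, b, c, hab, hac, hbc, key a ha, key b hb, key c hc⟩
        · exact absurd rfl hz1
        · exact absurd rfl hz2
    · refine hK (IsMinor.mono (ih {z | z ∈ Y ∨ z = x ∨ z = s} ?_ (G.restrictTo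
        {z | z ∈ Y ∨ z = x ∨ z = s}) x s (fun u v h => h.2.1) ⟨hxs, by simp, by simp⟩
        ⟨y, Or.inl hy, (hYX hy).2.1, (hYX hy).2.2.1⟩ ?_) (G.restrictTo_le _))
      · refine ⟨?_, fun hsub => ?_⟩
        · rintro z (hz | rfl | rfl)
          exacts [(hYX hz).1, hxT, hsT]
        · rcases hsub htT with h | h | h
          exacts [(hYX h).2.2.2 rfl, hxt h.symm, hst' h.symm]
      · rintro z (hz | rfl | rfl) hz1 hz2
        · obtain ⟨a, b, c, hab, hac, hbc, ha, hb, hc⟩ := h3 z (hYX hz).1 hz2 (hYX hz).2.2.2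
          have key : ∀ v, G.Adj z v → (G.restrictTo {z | z ∈ Y ∨ z = x ∨ z = s}).Adj z v := by
            intro v hv
            refine ⟨hv, Or.inl hz, ?_⟩
            rcases hcases _ _ hv with h | h | h | h
            · exact Or.inl (hcl z hz v h hv)
            · exact Or.inr (Or.inl h)
            · exact Or.inr (Or.inr h)
            · exact absurd (hv.linked hz h) hno
          exact ⟨a, b, c, hab, hac, hbc, key a ha, key b hb, key c hc⟩
        · exact absurd rfl hz1
        · exact absurd rfl hz2
  have hxX : x ∉ X := fun h => h.2.1 rfl
  have hsX : s ∉ X := fun h => h.2.2.1 rfl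
  have htX : t ∉ X := fun h => h.2.2.2 rfl
  obtain ⟨y₀, hy₀, hxy₀⟩ : ∃ y ∈ X, G.Adj x y := by
    obtain ⟨a, b, c, hab, hac, hbc, ha, hb, hc⟩ := h3 x hxT hxs' hxt
    by_contra hno
    push Not at hno
    have key : ∀ v, G.Adj x v → v = s ∨ v = t := by
      intro v hv
      rcases hcases _ _ hv with h | h | h | h
      · exact absurd hv (hno v h)
      · exact absurd h hv.ne'
      · exact Or.inl h
      · exact Or.inr h
    grind
  obtain ⟨Y, hYX, hy₀Y, hYc, hYcl⟩ := exists_component G hy₀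
  obtain ⟨hYx, hYs, hYt⟩ := hcomp Y hYX ⟨_, hy₀Y⟩ hYcl
  -- Otherwise `x`, `s`, `t` form a triangle, and `Y` is joined to all three.
  have hxt' : ¬ G.Adj x t := by
    intro hxt'
    refine hK (isMinor_of_four (ConnSet.singleton x) (ConnSet.singleton s) (ConnSet.singleton t)
      hYc ?_ ?_ ?_ ?_ ?_ ?_ (fun _ => hxs.linked rfl rfl) (fun _ => hxt'.linked rfl rfl)
      (fun _ => hYx.symm) (fun _ => hst.linked rfl rfl) (fun _ => hYs.symm) (fun _ => hYt.symm))
    all_goals simp only [Set.disjoint_singleton_left, Set.mem_singleton_iff]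
    exacts [hxs', hxt, fun h => hxX (hYX h), hst', fun h => hsX (hYX h), fun h => htX (hYX h)]
  -- A second component `Y'` of `G[X]` would give the `K₄` model `{s}`, `{t}`, `Y`, `Y' ∪ {x}`.
  have hXc : ConnSet G X := by
    have hXY : X ⊆ Y := by
      intro y₁ hy₁
      by_contra hy₁Y
      obtain ⟨Y', hYX', hy₁Y', hYc', hYcl'⟩ := exists_component G hy₁
      obtain ⟨hYx', hYs', hYt'⟩ := hcomp Y' hYX' ⟨_, hy₁Y'⟩ hYcl'
      have hdis : Disjoint Y Y' := by
        rw [Set.disjoint_left]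
        intro z hz hz'
        exact hy₁Y (hYc'.2 Y ⟨z, hz', hz⟩
          (fun a b ha haY hb hab => hYcl a haY b (hYX' hb) hab) hy₁Y')
      obtain ⟨u, hu, v, rfl, huv⟩ := hYx'
      refine hK (isMinor_of_four (ConnSet.singleton s) (ConnSet.singleton t) hYc
        (hYc'.insert hu huv) ?_ ?_ ?_ ?_ ?_ ?_ (fun _ => hst.linked rfl rfl) (fun _ => hYs.symm)
        (fun _ => hxs.symm.linked rfl (Or.inl rfl)) (fun _ => hYt.symm)
        (fun _ => hYt'.symm.mono subset_rfl (Set.subset_insert _ _))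
        (fun _ => hYx.mono subset_rfl (by simp)))
      all_goals simp only [Set.disjoint_singleton_left, Set.mem_singleton_iff,
        Set.disjoint_insert_right]
      exacts [hst', fun h => hsX (hYX h), ⟨hxs', fun h => hsX (hYX' h)⟩,
        fun h => htX (hYX h), ⟨hxt, fun h => htX (hYX' h)⟩,
        ⟨fun h => hxX (hYX h), hdis⟩]
    rwa [← hXY.antisymm hYX] at hYc
  clear hYx hYs hYt hYcl hYc
  -- Contracting `x` into `s` only costs common neighbours of `x` and `s` a neighbour. If each of
  -- them has two neighbours besides `x` and `s`, all vertices other than `s` and `t` keep three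
  -- neighbours and induction applies.
  by_cases hy : ∃ y ∈ X, G.Adj y x ∧ G.Adj y s ∧ ∃ z, ∀ u, G.Adj y u → u = x ∨ u = s ∨ u = z
  swap
  · push Not at hy
    refine hK (IsMinor.of_contract (ih (T \ {x}) ⟨Set.sdiff_subset, fun h => (h hxT).2 rfl⟩
      (G.contractTo x s) s t ?_ ⟨hst', hxs'.symm, hxt.symm, Or.inl hst⟩
      ⟨y₀, ⟨hy₀.1, hy₀.2.1⟩, hy₀.2.2⟩ ?_) hxs exists_adj_top_fin_four
      fun u v h => ⟨h.2.1, h.2.2.1, h.2.2.2⟩)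
    · rintro u v ⟨-, hu, -, h | ⟨rfl, -⟩ | ⟨-, h⟩⟩
      exacts [⟨hT _ _ h, hu⟩, ⟨hsT, hu⟩, ⟨hT' _ _ h, hu⟩]
    · rintro v ⟨hvT, hvx⟩ hvs hvt
      replace hvx : v ≠ x := hvx
      have key : ∀ u, G.Adj v u → u ≠ x → (G.contractTo x s).Adj v u :=
        fun u hu hux => ⟨hu.ne, hvx, hux, Or.inl hu⟩
      have hs : G.Adj v x → (G.contractTo x s).Adj v s :=
        fun hv => ⟨hvs, hvx, hxs'.symm, Or.inr (Or.inr ⟨rfl, hv.symm⟩)⟩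
      obtain ⟨a, b, c, hab, hac, hbc, ha, hb, hc⟩ := h3 v hvT hvs hvt
      by_cases hvx' : G.Adj v x
      · by_cases hvs' : G.Adj v s
        · have hy' := hy v ⟨hvT, hvx, hvs, hvt⟩ hvx' hvs'
          -- The argument `x` is a dummy: it yields a neighbour other than `x` and `s`, and the next
          -- call yields one that also differs from it.
          obtain ⟨u, hu, hux, hus, -⟩ := hy' x
          obtain ⟨u', hu', hux', hus', huu'⟩ := hy' u
          exact ⟨s, u, u', Ne.symm hus, Ne.symm hus', Ne.symm huu', hs hvx', key u hu hux,
            key u' hu' hux'⟩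
        · have hs' := hs hvx'
          by_cases hax : a = x
          · subst hax
            exact ⟨s, b, c, fun h => hvs' (h ▸ hb), fun h => hvs' (h ▸ hc), hbc, hs',
              key b hb hab.symm, key c hc hac.symm⟩
          by_cases hbx : b = x
          · subst hbx
            exact ⟨s, a, c, fun h => hvs' (h ▸ ha), fun h => hvs' (h ▸ hc), hac, hs',
              key a ha hab, key c hc hbc.symm⟩
          · exact ⟨s, a, b, fun h => hvs' (h ▸ ha), fun h => hvs' (h ▸ hb), hab, hs',
              key a ha hax, key b hb hbx⟩
      · exact ⟨a, b, c, hab, hac, hbc, key a ha fun h => hvx' (h ▸ ha),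
          key b hb fun h => hvx' (h ▸ hb), key c hc fun h => hvx' (h ▸ hc)⟩
  obtain ⟨y, hyX, hyx, hys, z, hz⟩ := hy
  have hyz : G.Adj y z ∧ z ≠ x ∧ z ≠ s := by
    obtain ⟨a, b, c, hab, hac, hbc, ha, hb, hc⟩ := h3 y hyX.1 hyX.2.2.1 hyX.2.2.2
    have := hz a ha
    have := hz b hb
    have := hz c hc
    grind
  obtain ⟨hyz, hzx, hzs⟩ := hyz
  -- If `z = t`, then `y` has no neighbour in the connected set `X`, so `X = {y}` and `x` has no
  -- neighbours besides `s` and `y`.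
  have hzt : z ≠ t := by
    rintro rfl
    have hXy : X ⊆ {y} := by
      refine hXc.2 {y} ⟨y, hyX, rfl⟩ ?_
      rintro a b - rfl hb hab
      rcases hz b hab with rfl | rfl | rfl
      exacts [absurd hb hxX, absurd hb hsX, absurd hb htX]
    obtain ⟨a, b, c, hab, hac, hbc, ha, hb, hc⟩ := h3 x hxT hxs' hxt
    have key : ∀ v, G.Adj x v → v = s ∨ v = y := by
      intro v hv
      rcases hcases _ _ hv with h | h | h | h
      · exact Or.inr (hXy h)
      · exact absurd h hv.ne'
      · exact Or.inl h
      · exact absurd (h ▸ hv) hxt'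
    have := key a ha
    have := key b hb
    have := key c hc
    grind
  have hzX : z ∈ X := ⟨hT' _ _ hyz, hzx, hzs, hzt⟩
  have hyx' := hyx.ne
  have hys' := hys.ne
  have hyz' := hyz.ne
  have hyt' : y ≠ t := hyX.2.2.2
  -- If `x` and `z` are not adjacent, contract `y` into `x`: then `x` and `z` lose the neighbour `y`
  -- and gain each other. No vertex besides `x`, `s` and `z` is adjacent to `y`.
  by_cases hzx' : G.Adj z x
  swap
  · refine hK (IsMinor.of_contract (ih (T \ {y}) ⟨Set.sdiff_subset, fun h => (h hyX.1).2 rfl⟩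
      (G.contractTo y x) s t ?_ ⟨hst', hys'.symm, hyt'.symm, Or.inl hst⟩
      ⟨x, ⟨hxT, hyx'.symm⟩, hxs', hxt⟩ ?_) hyx exists_adj_top_fin_four
      fun u v h => ⟨h.2.1, h.2.2.1, h.2.2.2⟩)
    · rintro u v ⟨-, hu, -, h | ⟨rfl, -⟩ | ⟨-, h⟩⟩
      exacts [⟨hT _ _ h, hu⟩, ⟨hxT, hu⟩, ⟨hT' _ _ h, hu⟩]
    · rintro v ⟨hvT, hvy⟩ hvs hvt
      replace hvy : v ≠ y := hvy
      have key : ∀ u, G.Adj v u → u ≠ y → (G.contractTo y x).Adj v u :=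
        fun u hu huy => ⟨hu.ne, hvy, huy, Or.inl hu⟩
      have hxz : (G.contractTo y x).Adj x z :=
        ⟨hzx.symm, hyx'.symm, hyz'.symm, Or.inr (Or.inl ⟨rfl, hyz⟩)⟩
      have repl : ∀ q, ¬ G.Adj v q → (G.contractTo y x).Adj v q → HasThree (G.contractTo y x) v := by
        intro q hvq hq
        obtain ⟨a, b, c, hab, hac, hbc, ha, hb, hc⟩ := h3 v hvT hvs hvt
        by_cases hay : a = y
        · subst hay
          exact ⟨q, b, c, fun h => hvq (h ▸ hb), fun h => hvq (h ▸ hc), hbc, hq,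
            key b hb hab.symm, key c hc hac.symm⟩
        by_cases hby : b = y
        · subst hby
          exact ⟨q, a, c, fun h => hvq (h ▸ ha), fun h => hvq (h ▸ hc), hac, hq,
            key a ha hab, key c hc hbc.symm⟩
        · exact ⟨q, a, b, fun h => hvq (h ▸ ha), fun h => hvq (h ▸ hb), hab, hq,
            key a ha hay, key b hb hby⟩
      by_cases hvx : v = x
      · subst hvx
        exact repl z (fun h => hzx' h.symm) hxz
      by_cases hvz : v = z
      · subst hvz
        exact repl x hzx' hxz.symm
      obtain ⟨a, b, c, hab, hac, hbc, ha, hb, hc⟩ := h3 v hvT hvs hvt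
      have hvy' : ∀ u, G.Adj v u → u ≠ y := by
        rintro u hu rfl
        rcases hz v hu.symm with h | h | h
        exacts [hvx h, hvs h, hvz h]
      exact ⟨a, b, c, hab, hac, hbc, key a ha (hvy' a ha), key b hb (hvy' b hb),
        key c hc (hvy' c hc)⟩
  -- a connected set that contains `s`, meets the neighbourhood of `z` and avoids `x`, `y`, `z`
  obtain ⟨R, hRc, hsR, hRz, hxR, hyR, hzR⟩ : ∃ R, ConnSet G R ∧ s ∈ R ∧ Linked G {z} R ∧
      x ∉ R ∧ y ∉ R ∧ z ∉ R := by
    by_cases hzs' : G.Adj z s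
    · exact ⟨{s}, ConnSet.singleton s, rfl, hzs'.linked rfl rfl, hxs', hys', hzs⟩
    -- The set is built from `s`, `t` and, unless `y₁ = z`, the component of the neighbour `y₁` of
    -- `t` in `X \ {z}`. This component avoids `y`, whose only neighbour in `X` is `z`, and is
    -- joined to `z` because `X` is connected.
    obtain ⟨y₁, hy₁, _, rfl, hy₁t⟩ := (hcomp X subset_rfl ⟨y, hyX⟩ fun a _ b hb _ => hb).2.2
    rename_i t
    have hst2 : ConnSet G {s, t} := (ConnSet.singleton t).insert rfl hst.symm
    by_cases hy₁z : y₁ = z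
    · subst hy₁z
      refine ⟨{s, t}, hst2, by simp, hy₁t.linked rfl (by simp), ?_, ?_, ?_⟩
      all_goals simp only [Set.mem_insert_iff, Set.mem_singleton_iff, not_or]
      exacts [⟨hxs', hxt⟩, ⟨hys', hyt'⟩, ⟨hzs, hzt⟩]
    have hy₁y : y₁ ≠ y := by
      rintro rfl
      rcases hz t hy₁t with h | h | h
      exacts [hxt h.symm, hst' h.symm, hzt h.symm]
    obtain ⟨R, hRX, hy₁R, hRc, hRcl⟩ := exists_component G (T := X \ {z}) (y := y₁) ⟨hy₁, hy₁z⟩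
    have hyR : y ∉ R := by
      intro hyR
      obtain ⟨a, -, b, hb, rfl, -, hab⟩ := hRc.exists_adj (C := {y}) hyR rfl hy₁R hy₁y
      rcases hz b hab with rfl | rfl | rfl
      exacts [hxX (hRX hb).1, hsX (hRX hb).1, (hRX hb).2 rfl]
    obtain ⟨a, -, b, hbX, haR, hbR, hab⟩ := hXc.exists_adj (C := R) hy₁ hy₁R hzX
      fun h => (hRX h).2 rfl
    have hbz : b = z := by
      by_contra hbz
      exact hbR (hRcl a haR b ⟨hbX, hbz⟩ hab)
    subst hbz
    refine ⟨R ∪ {s, t}, hRc.union hst2 hy₁R (by simp) (Or.inr hy₁t), by simp,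
      hab.symm.linked rfl (Or.inl haR), ?_, ?_, ?_⟩
    all_goals simp only [Set.mem_union, Set.mem_insert_iff, Set.mem_singleton_iff, not_or]
    exacts [⟨fun h => hxX (hRX h).1, hxs', hxt⟩, ⟨hyR, hys', hyt'⟩, ⟨hbR, hzs, hzt⟩]
  refine hK (isMinor_of_four (ConnSet.singleton x) (ConnSet.singleton y) (ConnSet.singleton z)
    hRc ?_ ?_ ?_ ?_ ?_ ?_ (fun _ => hyx.symm.linked rfl rfl) (fun _ => hzx'.symm.linked rfl rfl)
    (fun _ => hxs.linked rfl hsR) (fun _ => hyz.linked rfl rfl) (fun _ => hys.linked rfl hsR)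
    (fun _ => hRz))
  all_goals simp only [Set.disjoint_singleton_left, Set.mem_singleton_iff]
  exacts [hyx'.symm, hzx.symm, hxR, hyz', hyR, hzR]

/-- If `st` is an edge of a graph with at least three vertices, all of whose vertices other than
`s` and `t` have three neighbours, then the graph has a `K₄` minor. -/
theorem isMinor_K4_of_hasThree {V : Type*} [Finite V] (T : Set V) :
    ∀ (G : SimpleGraph V) (s t : V), (∀ u v, G.Adj u v → u ∈ T) → G.Adj s t →
      (∃ x ∈ T, x ≠ s ∧ x ≠ t) → (∀ x ∈ T, x ≠ s → x ≠ t → HasThree G x) →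
      IsMinor (⊤ : SimpleGraph (Fin 4)) G := by
  induction T using WellFoundedLT.induction with
  | ind T ih =>
  intro G s t hT hst ⟨x, hxT, hxs, hxt⟩ h3
  by_cases h1 : ∃ y, y ≠ t ∧ G.Adj y s
  · obtain ⟨y, hyt, hys⟩ := h1
    exact isMinor_K4_step ih hT hst h3 hys hyt
  by_cases h2 : ∃ y, y ≠ s ∧ G.Adj y t
  · obtain ⟨y, hys, hyt⟩ := h2
    exact isMinor_K4_step ih hT hst.symm (fun x hx h h' => h3 x hx h' h) hyt hys
  -- Now `st` is a component by itself. It is dropped, and any edge `xa` of the rest takes its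
  -- place; a second neighbour `b` of `x` is the required third vertex.
  push Not at h1 h2
  have key : ∀ y, y ≠ s → y ≠ t → ∀ v, G.Adj y v → v ≠ s ∧ v ≠ t := by
    intro y hys hyt v hyv
    exact ⟨fun h => h1 y hyt (h ▸ hyv), fun h => h2 y hys (h ▸ hyv)⟩
  obtain ⟨a, b, c, hab, -, -, ha, hb, -⟩ := h3 x hxT hxs hxt
  have hT' : ∀ y, y ≠ s → y ≠ t → ∀ v, G.Adj y v → (G.restrictTo (T \ {s, t})).Adj y v := by
    intro y hys hyt v hyv
    have := key y hys hyt v hyv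
    exact ⟨hyv, ⟨hT _ _ hyv, by simp [hys, hyt]⟩, ⟨hT _ _ hyv.symm, by simp [this]⟩⟩
  have hxb := hT' x hxs hxt b hb
  refine IsMinor.mono (ih (T \ {s, t}) ⟨Set.sdiff_subset, fun h => (h (hT _ _ hst)).2 (by simp)⟩
    (G.restrictTo (T \ {s, t})) x a (fun u v h => h.2.1) (hT' x hxs hxt a ha)
    ⟨b, hxb.2.2, hb.ne', hab.symm⟩ ?_) (G.restrictTo_le _)
  rintro y ⟨hyT, hy⟩ - -
  simp only [Set.mem_insert_iff, Set.mem_singleton_iff, not_or] at hy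
  obtain ⟨a, b, c, hab, hac, hbc, ha, hb, hc⟩ := h3 y hyT hy.1 hy.2
  exact ⟨a, b, c, hab, hac, hbc, hT' y hy.1 hy.2 a ha, hT' y hy.1 hy.2 b hb, hT' y hy.1 hy.2 c hc⟩

/-! ### Routed trees with hubs -/

/-- The pairs of colour `c` lead from `c` to its parent. -/
def Leads {V : Type*} (par : V → Option V) (col : V → V → Option V) (c : V) : Prop :=
  ∃ u, par c = some u ∧ Relation.ReflTransGen (fun x y => col x y = some c) c u

/-- A tree with hubs on the vertex set `S` of `G`, in which a vertex `c` need not be adjacent to its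
parent. Instead, there may be a route from `c` to its parent, consisting of the edges of `G` to
which `col` gives the colour `c`. Each vertex `x` is in the interior of at most one route, the one
of `via x`. -/
structure RoutedTree {V : Type*} (S : Set V) (G : SimpleGraph V) (par hub : V → Option V)
    (depth : V → ℚ) (col : V → V → Option V) (via : V → Option V) : Prop where
  par_mem : ∀ v u, par v = some u → v ∈ S ∧ u ∈ S
  par_depth : ∀ v u, par v = some u → depth u < depth v
  hub_step : ∀ v a, hub v = some a → ∃ u, par v = some u ∧ (par u = some a ∨ hub u = some a)
  hub_mem : ∀ v a, hub v = some a → a ∈ S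
  hub_depth : ∀ v a u, hub v = some a → par v = some u → depth a < depth u
  adj : ∀ x y, G.Adj x y → (par x = some y ∨ hub x = some y) ∨ (par y = some x ∨ hub y = some x)
  col_adj : ∀ x y c, col x y = some c → G.Adj x y
  col_symm : ∀ x y, col x y = col y x
  col_via : ∀ x y c, col x y = some c → x = c ∨ par c = some x ∨ via x = some c
  col_leads : ∀ x y c, col x y = some c → Leads par col c
  double : ∀ y a b, par y = some a → par a = some b → hub y = some b → Leads par col a
  par_adj : ∀ a b, par a = some b → G.Adj a b ∨ Leads par col a

namespace RoutedTree

variable {V : Type*} {S : Set V} {G G' : SimpleGraph V} {par hub : V → Option V} {depth : V → ℚ}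
  {col : V → V → Option V} {via : V → Option V} {x a b : V}

/-- A pendant vertex can be added. -/
theorem add_pendant [DecidableEq V] (h : RoutedTree S G' par hub depth col via) (hx : x ∉ S)
    (ha : a ∈ S) (hS : ∀ u v, G'.Adj u v → u ∈ S ∧ v ∈ S)
    (hG : ∀ u v, G.Adj u v ↔ G'.Adj u v ∨ (u = x ∧ v = a) ∨ (v = x ∧ u = a)) :
    RoutedTree (insert x S) G (fun v => if v = x then some a else par v)
      (fun v => if v = x then none else hub v) (fun v => if v = x then depth a + 1 else depth v)
      col via := by
  have hpx : ∀ v, par v ≠ some x := fun v hv => hx (h.par_mem v x hv).2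
  have hpx' : ∀ u, par x ≠ some u := fun v hv => hx (h.par_mem x v hv).1
  have hhx : ∀ v, hub v ≠ some x := fun v hv => hx (h.hub_mem v x hv)
  have hxa : x ≠ a := fun h => hx (h ▸ ha)
  have hl : ∀ c, Leads par col c → Leads (fun v => if v = x then some a else par v) col c := by
    rintro c ⟨u, hu, hr⟩
    refine ⟨u, ?_, hr⟩
    have : c ≠ x := fun e => hpx' u (e ▸ hu)
    simpa [this] using hu
  constructor
  · grind [h.par_mem]
  · grind [h.par_depth]
  · have := h.hub_step
    intro v a' hv
    have hvx : v ≠ x := by grind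
    obtain ⟨u, hu, hu'⟩ := this v a' (by simpa [hvx] using hv)
    refine ⟨u, by simpa [hvx] using hu, ?_⟩
    have : u ≠ x := fun e => hpx v (e ▸ hu)
    simpa [this] using hu'
  · grind [h.hub_mem]
  · grind [h.hub_depth]
  · intro u v huv
    rcases (hG u v).mp huv with huv | ⟨rfl, rfl⟩ | ⟨rfl, rfl⟩
    · have := hS u v huv
      have h1 : u ≠ x := fun e => hx (e ▸ this.1)
      have h2 : v ≠ x := fun e => hx (e ▸ this.2)
      simpa [h1, h2] using h.adj u v huv
    · simp
    · simp
  · intro u v c hc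
    exact (hG u v).mpr (Or.inl (h.col_adj u v c hc))
  · exact h.col_symm
  · intro u v c hc
    have hcx : c ≠ x := by
      rintro rfl
      obtain ⟨w, hw, -⟩ := h.col_leads u v c hc
      exact hpx' w hw
    simpa [hcx] using h.col_via u v c hc
  · intro u v c hc
    exact hl c (h.col_leads u v c hc)
  · intro y a' b' h1 h2 h3
    have hyx : y ≠ x := by grind
    have hax : a' ≠ x := by grind
    simp only [hyx, hax, if_false] at h1 h2 h3
    exact hl _ (h.double y a' b' h1 h2 h3)
  · intro a' b' h1
    by_cases hax : a' = x
    · simp only [hax, if_true, Option.some.injEq] at h1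
      exact Or.inl ((hG _ _).mpr (Or.inr (Or.inl ⟨hax, h1.symm⟩)))
    · simp only [hax, if_false] at h1
      rcases h.par_adj a' b' h1 with h2 | h2
      · exact Or.inl ((hG _ _).mpr (Or.inl h2))
      · exact Or.inr (hl _ h2)

/-- A vertex of degree two can be added that has the ends of an edge `ab` as neighbours, where `b`
is the parent or the hub of `a`. The edge `ab` may be deleted if `b` is the hub of `a` or there is
a route from `a` to `b`. -/
theorem add_triangle [DecidableEq V] (h : RoutedTree S G' par hub depth col via) (hx : x ∉ S)
    (hS : ∀ u v, G'.Adj u v → u ∈ S ∧ v ∈ S) (hab : G'.Adj a b)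
    (hb : par a = some b ∨ hub a = some b)
    (col' : V → V → Option V) (via' : V → Option V)
    (hG : ∀ u v, G'.Adj u v → ¬ (u = a ∧ v = b) → ¬ (u = b ∧ v = a) → G.Adj u v)
    (hG' : ∀ u v, G.Adj u v ↔ (G'.Adj u v ∧ G.Adj u v) ∨ (u = x ∧ (v = a ∨ v = b)) ∨
      (v = x ∧ (u = a ∨ u = b)))
    (hcol_adj : ∀ x y c, col' x y = some c → G.Adj x y)
    (hcol_symm : ∀ x y, col' x y = col' y x)
    (hcol_via : ∀ u v c, col' u v = some c → u = c ∨ par c = some u ∨ via' u = some c)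
    (hcol_leads : ∀ u v c, col' u v = some c → Leads par col' c)
    (hmono : ∀ c, Leads par col c → Leads par col' c)
    (hdouble : par a = some b → Leads par col' a) :
    RoutedTree (insert x S) G (fun v => if v = x then some a else par v)
      (fun v => if v = x then some b else hub v) (fun v => if v = x then depth a + 1 else depth v)
      col' via' := by
  have ha : a ∈ S := (hS _ _ hab).1
  have hbS : b ∈ S := (hS _ _ hab).2
  have hpx : ∀ v, par v ≠ some x := fun v hv => hx (h.par_mem v x hv).2
  have hpx' : ∀ u, par x ≠ some u := fun v hv => hx (h.par_mem x v hv).1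
  have hhx : ∀ v, hub v ≠ some x := fun v hv => hx (h.hub_mem v x hv)
  have hxa : x ≠ a := fun h => hx (h ▸ ha)
  have hl : ∀ c, Leads par col' c → Leads (fun v => if v = x then some a else par v) col' c := by
    rintro c ⟨u, hu, hr⟩
    refine ⟨u, ?_, hr⟩
    have : c ≠ x := fun e => hpx' u (e ▸ hu)
    simpa [this] using hu
  have hba : depth b < depth a := by
    rcases hb with hb | hb
    · exact h.par_depth a b hb
    · obtain ⟨u, hu, -⟩ := h.hub_step a b hb
      exact (h.hub_depth a b u hb hu).trans (h.par_depth a u hu)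
  constructor
  · grind [h.par_mem]
  · grind [h.par_depth]
  · intro v a' hv
    by_cases hvx : v = x
    · subst hvx
      simp only [if_true, Option.some.injEq] at hv
      subst hv
      exact ⟨a, by simp, by simpa [hxa.symm] using hb⟩
    · obtain ⟨u, hu, hu'⟩ := h.hub_step v a' (by simpa [hvx] using hv)
      refine ⟨u, by simpa [hvx] using hu, ?_⟩
      have : u ≠ x := fun e => hpx v (e ▸ hu)
      simpa [this] using hu'
  · grind [h.hub_mem]
  · grind [h.hub_depth]
  · intro u v huv
    rcases (hG' u v).mp huv with ⟨huv, -⟩ | ⟨rfl, rfl | rfl⟩ | ⟨rfl, rfl | rfl⟩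
    · have := hS u v huv
      have h1 : u ≠ x := fun e => hx (e ▸ this.1)
      have h2 : v ≠ x := fun e => hx (e ▸ this.2)
      simpa [h1, h2] using h.adj u v huv
    all_goals simp
  · exact hcol_adj
  · exact hcol_symm
  · intro u v c hc
    have hcx : c ≠ x := by
      rintro rfl
      obtain ⟨w, hw, -⟩ := hcol_leads u v c hc
      exact hpx' w hw
    simpa [hcx] using hcol_via u v c hc
  · intro u v c hc
    exact hl c (hcol_leads u v c hc)
  · intro y a' b' h1 h2 h3
    have hax : a' ≠ x := by grind
    -- The new vertex has parent `a` and hub `b`; if `b` is also the parent of `a`, the field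
    -- `double` demands a route from `a`, which is what `hdouble` supplies.
    by_cases hyx : y = x
    · subst hyx
      simp only [if_true, Option.some.injEq] at h1 h3
      subst h1 h3
      simp only [hax, if_false] at h2
      exact hl _ (hdouble h2)
    · simp only [hyx, hax, if_false] at h1 h2 h3
      exact hl _ (hmono _ (h.double y a' b' h1 h2 h3))
  · intro a' b' h1
    by_cases hax : a' = x
    · simp only [hax, if_true, Option.some.injEq] at h1
      exact Or.inl ((hG' _ _).mpr (Or.inr (Or.inl ⟨hax, Or.inl h1.symm⟩)))
    · simp only [hax, if_false] at h1
      rcases h.par_adj a' b' h1 with h2 | h2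
      · by_cases h3 : a' = a ∧ b' = b
        · obtain ⟨rfl, rfl⟩ := h3
          exact Or.inr (hl _ (hdouble h1))
        · refine Or.inl (hG _ _ h2 h3 ?_)
          rintro ⟨rfl, rfl⟩
          exact absurd (h.par_depth _ _ h1) (by linarith)
      · exact Or.inr (hl _ (hmono _ h2))

/-- Vertex `x` joined to the ends of the edge `ab`. -/
theorem add_ear [DecidableEq V] (h : RoutedTree S G' par hub depth col via) (hx : x ∉ S)
    (hS : ∀ u v, G'.Adj u v → u ∈ S ∧ v ∈ S) (hab : G'.Adj a b)
    (hb : par a = some b ∨ hub a = some b)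
    (hG : ∀ u v, G.Adj u v ↔ G'.Adj u v ∨ (u = x ∧ (v = a ∨ v = b)) ∨
      (v = x ∧ (u = a ∨ u = b))) :
    ∃ par hub depth col via, RoutedTree (insert x S) G par hub depth col via := by
  have hcolx : ∀ u v c, col u v = some c → u ≠ x ∧ v ≠ x := by
    intro u v c hc
    have := hS _ _ (h.col_adj u v c hc)
    exact ⟨fun e => hx (e ▸ this.1), fun e => hx (e ▸ this.2)⟩
  have hG' : ∀ u v, G.Adj u v ↔ (G'.Adj u v ∧ G.Adj u v) ∨ (u = x ∧ (v = a ∨ v = b)) ∨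
      (v = x ∧ (u = a ∨ u = b)) := by
    intro u v
    grind
  -- If `b` is the parent of `a`, the path `a x b` is coloured `a`, which gives `a` a route and
  -- makes `x` interior to this route only. If `b` is the hub of `a`, no route is called for.
  by_cases hpb : par a = some b
  · have hxa : x ≠ a := fun e => hx (e ▸ (hS _ _ hab).1)
    have hxb : x ≠ b := fun e => hx (e ▸ (hS _ _ hab).2)
    set col' : V → V → Option V := fun u v =>
      if (u = x ∧ (v = a ∨ v = b)) ∨ (v = x ∧ (u = a ∨ u = b)) then some a else col u v with hcol'
    have hla : Leads par col' a := by
      refine ⟨b, hpb, Relation.ReflTransGen.head (b := x) ?_ (Relation.ReflTransGen.single ?_)⟩ <;>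
        simp [hcol']
    have hmono : ∀ c, Leads par col c → Leads par col' c := by
      rintro c ⟨u, hu, hr⟩
      refine ⟨u, hu, Relation.ReflTransGen.mono (fun y z hyz => ?_) _ _ hr⟩
      have := hcolx y z c hyz
      simpa [hcol', this] using hyz
    refine ⟨_, _, _, _, _, h.add_triangle hx hS hab hb col' (fun v => if v = x then some a else via v)
      (fun u v huv _ _ => (hG u v).mpr (Or.inl huv)) hG' ?_ ?_ ?_ ?_ hmono fun _ => hla⟩
    · intro u v c hc
      have := h.col_adj u v
      grind
    · intro u v
      have := h.col_symm u v
      grind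
    · intro u v c hc
      have := h.col_via u v
      have := hcolx u v
      grind
    · intro u v c hc
      have := h.col_leads u v c
      have := hmono c
      grind
  · exact ⟨_, _, _, _, _, h.add_triangle hx hS hab hb col via
      (fun u v huv _ _ => (hG u v).mpr (Or.inl huv)) hG'
      (fun u v c hc => (hG u v).mpr (Or.inl (h.col_adj u v c hc))) h.col_symm h.col_via
      h.col_leads (fun _ => id) fun e => absurd e hpb⟩

/-- The edge `ab` subdivided by `x`. -/
theorem subdivide [DecidableEq V] (h : RoutedTree S G' par hub depth col via) (hx : x ∉ S)
    (hS : ∀ u v, G'.Adj u v → u ∈ S ∧ v ∈ S) (hab : G'.Adj a b)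
    (hb : par a = some b ∨ hub a = some b)
    (hG : ∀ u v, G.Adj u v ↔ (G'.Adj u v ∧ ¬ (u = a ∧ v = b) ∧ ¬ (u = b ∧ v = a)) ∨
      (u = x ∧ (v = a ∨ v = b)) ∨ (v = x ∧ (u = a ∨ u = b))) :
    ∃ par hub depth col via, RoutedTree (insert x S) G par hub depth col via := by
  have hcolx : ∀ u v c, col u v = some c → u ≠ x ∧ v ≠ x := by
    intro u v c hc
    have := hS _ _ (h.col_adj u v c hc)
    exact ⟨fun e => hx (e ▸ this.1), fun e => hx (e ▸ this.2)⟩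
  have hxa : x ≠ a := fun e => hx (e ▸ (hS _ _ hab).1)
  have hxb : x ≠ b := fun e => hx (e ▸ (hS _ _ hab).2)
  have hab' := hab.ne
  -- Both new edges inherit the colour of `ab`, so a route through `ab` now passes through `x`, and
  -- `x` is interior to no other route.
  set col' : V → V → Option V := fun u v =>
    if (u = x ∧ (v = a ∨ v = b)) ∨ (v = x ∧ (u = a ∨ u = b)) then col a b else
    if (u = a ∧ v = b) ∨ (u = b ∧ v = a) then none else col u v with hcol'
  set via' : V → Option V := fun v => if v = x then col a b else via v with hvia'
  have hstep : ∀ c u v, Relation.ReflTransGen (fun x y => col x y = some c) u v →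
      Relation.ReflTransGen (fun x y => col' x y = some c) u v := by
    intro c u v hr
    refine Relation.reflTransGen_closed (fun y z hyz => ?_) _ _ hr
    have h1 := hcolx y z c hyz
    have hs := h.col_symm a b
    by_cases h2 : (y = a ∧ z = b) ∨ (y = b ∧ z = a)
    · refine Relation.ReflTransGen.head (b := x) ?_ (Relation.ReflTransGen.single ?_) <;> grind
    · refine Relation.ReflTransGen.single ?_
      grind
  have hcol_adj : ∀ x y c, col' x y = some c → G.Adj x y := by
    intro u v c hc
    have := h.col_adj u v c
    grind
  have hcol_symm : ∀ x y, col' x y = col' y x := by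
    intro u v
    have := h.col_symm u v
    grind
  have hcol : ∀ u v c, col' u v = some c → (∃ w, col u w = some c) ∨
      (u = x ∧ col a b = some c) := by
    intro u v c hc
    have := h.col_symm a b
    grind
  have hsome : ∀ u v c, col' u v = some c → ∃ u v, col u v = some c := by
    intro u v c hc
    rcases hcol u v c hc with ⟨w, hw⟩ | ⟨-, hw⟩
    exacts [⟨_, _, hw⟩, ⟨_, _, hw⟩]
  have hcol_via : ∀ u v c, col' u v = some c → u = c ∨ par c = some u ∨ via' u = some c := by
    intro u v c hc
    rcases hcol u v c hc with ⟨w, hw⟩ | ⟨rfl, hw⟩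
    · have := h.col_via u w c hw
      have := hcolx u w c hw
      grind
    · simp [hvia', hw]
  have hmono : ∀ c, Leads par col c → Leads par col' c :=
    fun c ⟨u, hu, hr⟩ => ⟨u, hu, hstep c c u hr⟩
  -- If `b` is the hub of `a` or `a` has a route, the edge `ab` is dispensable and `x` becomes a
  -- child of `a` with hub `b`. Otherwise `x` is inserted between `a` and `b` in the tree and takes
  -- over the hub of `a`.
  by_cases hcase : par a = some b ∧ ¬ Leads par col a
  swap
  · refine ⟨_, _, _, _, _, h.add_triangle hx hS hab hb col' via' ?_ ?_ hcol_adj hcol_symm hcol_via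
      ?_ hmono ?_⟩
    · intro u v huv h1 h2
      exact (hG u v).mpr (Or.inl ⟨huv, h1, h2⟩)
    · intro u v
      grind
    · intro u v c hc
      obtain ⟨u', v', hc'⟩ := hsome u v c hc
      exact hmono c (h.col_leads u' v' c hc')
    · intro hpb
      by_contra hcon
      exact hcase ⟨hpb, fun hl => hcon (hmono a hl)⟩
  obtain ⟨hpb, hnl⟩ := hcase
  have hpx : ∀ v, par v ≠ some x := fun v hv => hx (h.par_mem v x hv).2
  have hpx' : ∀ u, par x ≠ some u := fun v hv => hx (h.par_mem x v hv).1
  have hhx : ∀ v, hub v ≠ some x := fun v hv => hx (h.hub_mem v x hv)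
  -- The parent of `a` is about to change from `b` to `x`. This spoils no route, since the colour
  -- `a` does not occur.
  have hcola : ∀ u v, col' u v ≠ some a := by
    intro u v hc
    obtain ⟨u', v', hc'⟩ := hsome u v a hc
    exact hnl (h.col_leads u' v' a hc')
  have hda := h.par_depth a b hpb
  have hbS := (hS _ _ hab).2
  set par' : V → Option V := fun v => if v = x then some b else if v = a then some x else par v
    with hpar'
  set hub' : V → Option V := fun v => if v = x then hub a else hub v with hhub'
  have hl : ∀ c, c ≠ a → Leads par col c → Leads par' col' c := by
    rintro c hca hc
    obtain ⟨u, hu, hr⟩ := hmono c hc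
    have : c ≠ x := fun e => hpx' u (e ▸ hu)
    exact ⟨u, by simpa [hpar', this, hca] using hu, hr⟩
  -- The depths are rational so that `x` fits between `b` and `a` without renumbering.
  refine ⟨par', hub', fun v => if v = x then (depth a + depth b) / 2 else depth v, col', via', ?_⟩
  have e1 : par' x = some b := by simp [hpar']
  have e2 : par' a = some x := by simp [hpar', hxa.symm]
  have e3 : ∀ v, v ≠ x → v ≠ a → par' v = par v := fun v h1 h2 => by simp [hpar', h1, h2]
  have e4 : hub' x = hub a := by simp [hhub']
  have e5 : ∀ v, v ≠ x → hub' v = hub v := fun v h1 => by simp [hhub', h1]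
  have e6 : ∀ v, hub x ≠ some v := by
    intro v hv
    obtain ⟨u, hu, -⟩ := h.hub_step x v hv
    exact hpx' u hu
  clear_value par' hub' col' via'
  constructor
  · intro v u hv
    have := h.par_mem v u
    have := h.par_mem a b hpb
    grind
  · intro v u hv
    have := h.par_depth v u
    grind
  · intro v a' hv
    by_cases hvx : v = x
    · subst hvx
      rw [e4] at hv
      obtain ⟨u, hu, hu'⟩ := h.hub_step a a' hv
      obtain rfl : b = u := by simpa [hpb] using hu
      exact ⟨b, e1, by rwa [e3 b hxb.symm hab'.symm, e5 b hxb.symm]⟩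
    · rw [e5 v hvx] at hv
      obtain ⟨u, hu, hu'⟩ := h.hub_step v a' hv
      by_cases hva : v = a
      · subst hva
        exact ⟨x, e2, Or.inr (e4.trans hv)⟩
      · have hux : u ≠ x := fun e => hpx v (e ▸ hu)
        refine ⟨u, (e3 v hvx hva).trans hu, ?_⟩
        by_cases hua : u = a
        · subst hua
          -- A child of `a` whose hub is the old parent `b` of `a` would lose the link to its hub.
          -- The invariant `double` excludes it, since it would give `a` a route.
          rcases hu' with hu' | hu'
          · exact absurd (h.double v u a' hu hu' hv) hnl
          · exact Or.inr ((e5 u hux).trans hu')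
        · rw [e3 u hux hua, e5 u hux]
          exact hu'
  · intro v a' hv
    have := h.hub_mem v a'
    have := h.hub_mem a a'
    grind
  · intro v a' u hv hu
    have h1 := h.hub_depth v a' u
    have h2 := h.hub_depth a a' b
    grind
  · intro u v huv
    have := h.adj u v
    rcases (hG u v).mp huv with ⟨huv, h1, h2⟩ | ⟨rfl, rfl | rfl⟩ | ⟨rfl, rfl | rfl⟩
    · have h3 := hS u v huv
      have h4 : u ≠ x := fun e => hx (e ▸ h3.1)
      have h5 : v ≠ x := fun e => hx (e ▸ h3.2)
      grind
    all_goals simp [e1, e2]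
  · exact hcol_adj
  · exact hcol_symm
  · intro u v c hc
    have hca : c ≠ a := fun e => hcola u v (e ▸ hc)
    have hcx : c ≠ x := by
      rintro rfl
      obtain ⟨u', v', hc'⟩ := hsome u v c hc
      obtain ⟨w, hw, -⟩ := h.col_leads u' v' c hc'
      exact hpx' w hw
    rw [e3 c hcx hca]
    exact hcol_via u v c hc
  · intro u v c hc
    have hca : c ≠ a := fun e => hcola u v (e ▸ hc)
    obtain ⟨u', v', hc'⟩ := hsome u v c hc
    exact hl c hca (h.col_leads u' v' c hc')
  · intro y a' b' h1 h2 h3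
    by_cases hyx : y = x
    · subst hyx
      have h4 : a' = b := by simpa [e1] using h1.symm
      subst h4
      rw [e3 _ hxb.symm hab'.symm] at h2
      rw [e4] at h3
      exact hl _ hab'.symm (h.double a a' b' hpb h2 h3)
    rw [e5 y hyx] at h3
    by_cases hya : y = a
    · subst hya
      have h4 : a' = x := by simpa [e2] using h1.symm
      subst h4
      have h5 : b = b' := by simpa [e1] using h2
      subst h5
      -- A hub lies strictly above the parent, so `b` cannot be both for the same vertex.
      exact absurd (h.hub_depth y b b h3 hpb) (lt_irrefl _)
    rw [e3 y hyx hya] at h1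
    have hax' : a' ≠ x := fun e => hpx y (e ▸ h1)
    by_cases haa : a' = a
    · subst haa
      have h4 : x = b' := by simpa [e2] using h2
      exact absurd h3 (h4 ▸ hhx y)
    · rw [e3 a' hax' haa] at h2
      exact hl _ haa (h.double y a' b' h1 h2 h3)
  · intro a' b' h1
    by_cases hax : a' = x
    · subst hax
      have h4 : b = b' := by simpa [e1] using h1
      subst h4
      exact Or.inl ((hG _ _).mpr (Or.inr (Or.inl ⟨rfl, Or.inr rfl⟩)))
    by_cases haa : a' = a
    · subst haa
      have h4 : x = b' := by simpa [e2] using h1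
      subst h4
      exact Or.inl ((hG _ _).mpr (Or.inr (Or.inr ⟨rfl, Or.inl rfl⟩)))
    rw [e3 a' hax haa] at h1
    rcases h.par_adj a' b' h1 with h2 | h2
    · refine Or.inl ((hG _ _).mpr (Or.inl ⟨h2, fun e => haa e.1, ?_⟩))
      rintro ⟨rfl, rfl⟩
      exact absurd (h.par_depth _ _ h1) (by linarith)
    · exact Or.inr (hl _ haa h2)

end RoutedTree

/-- A set closed in the contracted graph becomes closed in `G` when `x` is put into it exactly if
`a` belongs to it. -/
theorem ConnSet.contractTo {V : Type*} {G : SimpleGraph V} {S : Set V} {x a : V}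
    (h : ConnSet G S) (hxa : G.Adj x a) (ha : a ∈ S) : ConnSet (G.contractTo x a) (S \ {x}) := by
  refine ⟨⟨a, ha, hxa.ne'⟩, ?_⟩
  rintro C ⟨y, ⟨hyS, hyx⟩, hyC⟩ hcl z ⟨hzS, hzx⟩
  have hax := hxa.ne'
  have := h.2 {z | (z ≠ x ∧ z ∈ C) ∨ (z = x ∧ a ∈ C)} ⟨y, hyS, Or.inl ⟨hyx, hyC⟩⟩ ?_ hzS
  · rcases this with h1 | h1
    · exact h1.2
    · exact absurd h1.1 hzx
  · rintro u v hu huC hv huv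
    have key : ∀ p q, p ∈ S → q ∈ S → p ≠ x → q ≠ x → p ∈ C → (G.contractTo x a).Adj p q →
        q ∈ C := fun p q hp hq hpx hqx hpC hpq => hcl p q ⟨hp, hpx⟩ hpC ⟨hq, hqx⟩ hpq
    rcases huC with ⟨hux, huC⟩ | ⟨rfl, haC⟩
    · by_cases hvx : v = x
      · subst hvx
        refine Or.inr ⟨rfl, ?_⟩
        by_cases hua : u = a
        · exact hua ▸ huC
        · exact key u a hu ha hux hax huC ⟨hua, hux, hax, Or.inr (Or.inr ⟨rfl, huv.symm⟩)⟩
      · exact Or.inl ⟨hvx, key u v hu hv hux hvx huC ⟨huv.ne, hux, hvx, Or.inl huv⟩⟩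
    · refine Or.inl ⟨huv.ne', ?_⟩
      by_cases hva : v = a
      · exact hva ▸ haC
      · exact key a v ha hv hax huv.ne' haC
          ⟨Ne.symm hva, hax, huv.ne', Or.inr (Or.inl ⟨rfl, huv⟩)⟩

/-- Connected graphs without `K₄` minor have a routed tree with hubs. -/
theorem exists_routedTree {V : Type*} [Finite V] (S : Set V) : ∀ G : SimpleGraph V,
    (∀ u v, G.Adj u v → u ∈ S ∧ v ∈ S) → ConnSet G S → ¬ IsMinor (⊤ : SimpleGraph (Fin 4)) G →
    ∃ par hub depth col via, RoutedTree S G par hub depth col via := by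
  classical
  induction S using WellFoundedLT.induction with
  | ind S ih =>
  intro G hS hc hK
  obtain ⟨r, hr⟩ := hc.1
  by_cases hsing : ∀ q ∈ S, q = r
  · refine ⟨fun _ => none, fun _ => none, fun _ => 0, fun _ _ => none, fun _ => none, ?_⟩
    constructor <;> simp
    intro x y hxy
    have h1 := hsing x (hS x y hxy).1
    have h2 := hsing y (hS x y hxy).2
    exact hxy.ne (h1.trans h2.symm)
  push Not at hsing
  have hnbr : ∀ x ∈ S, ∃ a, G.Adj x a := by
    intro x hx
    obtain ⟨q, hq, hqr⟩ := hsing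
    obtain ⟨y, hy, hyx⟩ : ∃ y ∈ S, y ≠ x := by
      by_cases hrx : r = x
      · exact ⟨q, hq, hrx ▸ hqr⟩
      · exact ⟨r, hr, hrx⟩
    obtain ⟨a, -, b, -, rfl, -, hab⟩ := hc.exists_adj (C := {x}) hx rfl hy hyx
    exact ⟨b, hab⟩
  -- If every vertex had three neighbours, any edge could serve as `st` in `isMinor_K4_of_hasThree`.
  obtain ⟨x, hxS, hx⟩ : ∃ x ∈ S, ¬ HasThree G x := by
    obtain ⟨t, hrt⟩ := hnbr r hr
    by_contra hcon
    push Not at hcon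
    obtain ⟨a, b, c, hab, hac, hbc, ha, hb, hc⟩ := hcon r hr
    refine hK (isMinor_K4_of_hasThree S G r t (fun u v h => (hS u v h).1) hrt ?_
      fun x hx _ _ => hcon x hx)
    by_cases hat : a = t
    · exact ⟨b, (hS _ _ hb).2, hb.ne', hat ▸ hab.symm⟩
    · exact ⟨a, (hS _ _ ha).2, ha.ne', hat⟩
  obtain ⟨a, hxa⟩ := hnbr x hxS
  have haS := (hS _ _ hxa).2
  have hax := hxa.ne'
  have hS' : ∀ u v, (G.contractTo x a).Adj u v → u ∈ S \ {x} ∧ v ∈ S \ {x} := by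
    rintro u v ⟨-, hu, hv, h | ⟨rfl, h⟩ | ⟨rfl, h⟩⟩
    · exact ⟨⟨(hS _ _ h).1, hu⟩, ⟨(hS _ _ h).2, hv⟩⟩
    · exact ⟨⟨haS, hu⟩, ⟨(hS _ _ h).2, hv⟩⟩
    · exact ⟨⟨(hS _ _ h).2, hu⟩, ⟨haS, hv⟩⟩
  obtain ⟨par, hub, depth, col, via, hR⟩ := ih (S \ {x})
    ⟨Set.sdiff_subset, fun h => (h hxS).2 rfl⟩ (G.contractTo x a) hS' (hc.contractTo hxa haS)
    fun h => hK (h.of_contract hxa exists_adj_top_fin_four fun u v h => ⟨h.2.1, h.2.2.1, h.2.2.2⟩)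
  have hins : insert x (S \ {x}) = S := by
    rw [Set.insert_sdiff_singleton, Set.insert_eq_of_mem hxS]
  have hxS' : x ∉ S \ {x} := fun h => h.2 rfl
  rw [← hins]
  have hadj : ∀ u v, (G.contractTo x a).Adj u v ↔ u ≠ v ∧ u ≠ x ∧ v ≠ x ∧
    (G.Adj u v ∨ (u = a ∧ G.Adj x v) ∨ (v = a ∧ G.Adj x u)) := fun u v => Iff.rfl
  have hne : ∀ u v, G.Adj u v → u ≠ v := fun u v h => h.ne
  have hsymm : ∀ u v, G.Adj u v → G.Adj v u := fun u v h => h.symm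
  by_cases hb : ∃ b, b ≠ a ∧ G.Adj x b
  swap
  · push Not at hb
    have hb' : ∀ b, G.Adj x b ↔ b = a := fun b => ⟨fun h => by
      by_contra hba
      exact hb b hba h, fun h => h ▸ hxa⟩
    refine ⟨_, _, _, _, _, hR.add_pendant (G := G) (a := a) hxS' ⟨haS, hax⟩ hS' ?_⟩
    intro u v
    have h1 := hb' u
    have h2 := hb' v
    have h3 := hne u v
    have h4 := hsymm u v
    have h5 := hsymm v u
    grind
  obtain ⟨b, hba, hxb⟩ := hb
  have hb' : ∀ c, G.Adj x c ↔ c = a ∨ c = b := by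
    intro c
    constructor
    · intro hxc
      by_contra hcon
      push Not at hcon
      exact hx ⟨a, b, c, hba.symm, hcon.1.symm, hcon.2.symm, hxa, hxb, hxc⟩
    · rintro (rfl | rfl) <;> assumption
  have hab : (G.contractTo x a).Adj a b :=
    ⟨hba.symm, hax, hxb.ne', Or.inr (Or.inl ⟨rfl, hxb⟩)⟩
  -- The contracted graph contains `ab` in either case. If `ab` is an edge of `G`, then `x` is an
  -- ear on it; if not, `G` arises by subdividing it. The two bullets below allow for `a` or `b`
  -- being the lower end.
  by_cases hGab : G.Adj a b
  · have hG : ∀ u v, G.Adj u v ↔ (G.contractTo x a).Adj u v ∨ (u = x ∧ (v = a ∨ v = b)) ∨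
      (v = x ∧ (u = a ∨ u = b)) := by
      intro u v
      have h1 := hb' u
      have h2 := hb' v
      have h3 := hne u v
      have h4 := hsymm u v
      have h5 := hsymm v u
      grind
    rcases hR.adj a b hab with h1 | h1
    · exact hR.add_ear hxS' hS' hab h1 hG
    · exact hR.add_ear hxS' hS' hab.symm h1 fun u v => by rw [hG u v, or_comm (a := v = a),
        or_comm (a := u = a)]
  · have hG : ∀ u v, G.Adj u v ↔ ((G.contractTo x a).Adj u v ∧ ¬ (u = a ∧ v = b) ∧
        ¬ (u = b ∧ v = a)) ∨ (u = x ∧ (v = a ∨ v = b)) ∨ (v = x ∧ (u = a ∨ u = b)) := by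
      intro u v
      have h1 := hb' u
      have h2 := hb' v
      have h3 := hne u v
      have h4 := hsymm u v
      have h5 := hsymm v u
      grind
    rcases hR.adj a b hab with h1 | h1
    · exact hR.subdivide hxS' hS' hab h1 hG
    · exact hR.subdivide hxS' hS' hab.symm h1 fun u v => by rw [hG u v, or_comm (a := v = a),
        or_comm (a := u = a), and_comm (a := ¬ (u = a ∧ v = b))]

/-! ### Certification of graphs without `K₄` minor -/

/-- A function on a finite type can be replaced by one with small natural values that preserves
strict inequalities. -/
theorem exists_small_rank {V α : Type*} [Fintype V] [LinearOrder α] (f : V → α) :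
    ∃ g : V → ℕ, (∀ v, g v ≤ Fintype.card V) ∧ ∀ u v, f u < f v → g u < g v := by
  classical
  refine ⟨fun v => (Finset.univ.filter fun u => f u < f v).card, fun v => Finset.card_le_univ _,
    fun u v huv => Finset.card_lt_card ?_⟩
  rw [Finset.ssubset_iff_of_subset]
  · exact ⟨u, by simpa using huv, by simp⟩
  · intro w hw
    simp only [Finset.mem_filter, Finset.mem_univ, true_and] at hw ⊢
    exact hw.trans huv

/-- Along a relation towards `u` there is a rank function that decreases at some step from each
vertex. -/
theorem exists_rank_towards {V : Type*} [Fintype V] (r : V → V → Prop) (u : V) :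
    ∃ g : V → ℕ, (∀ v, g v ≤ Fintype.card V) ∧ ∀ z, Relation.ReflTransGen r z u → z ≠ u →
      ∃ z', r z z' ∧ Relation.ReflTransGen r z' u ∧ g z' < g z := by
  let N : ℕ → V → Prop := fun n => Nat.rec (fun z => z = u) (fun _ p z => ∃ z', r z z' ∧ p z') n
  have hN : ∀ z, Relation.ReflTransGen r z u → ∃ n, N n z := by
    intro z hz
    induction hz using Relation.ReflTransGen.head_induction_on with
    | refl => exact ⟨0, rfl⟩
    | head hab _ ih =>
      obtain ⟨n, hn⟩ := ih
      exact ⟨n + 1, _, hab, hn⟩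
  have hN' : ∀ n z, N n z → Relation.ReflTransGen r z u := by
    intro n
    induction n with
    | zero =>
      intro z hz
      rw [show z = u from hz]
    | succ n ih =>
      rintro z ⟨z', hz, hz'⟩
      exact Relation.ReflTransGen.head hz (ih z' hz')
  -- `N n z` means that `u` is reached from `z` in `n` steps, so `g` ranks the vertices by distance
  -- to `u`. The default `sInf ∅ = 0` is harmless, since only vertices that reach `u` are compared.
  obtain ⟨g, hg, hlt⟩ := exists_small_rank fun z => sInf {n | N n z}
  refine ⟨g, hg, fun z hz hzu => ?_⟩
  have hmem : N (sInf {n | N n z}) z := Nat.sInf_mem (s := {n | N n z}) (hN z hz)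
  rcases hn : sInf {n | N n z} with - | m
  · rw [hn] at hmem
    exact absurd hmem hzu
  · rw [hn] at hmem
    obtain ⟨z', hzz', hz'⟩ := hmem
    refine ⟨z', hzz', hN' m z' hz', hlt _ _ ?_⟩
    rw [hn]
    exact Nat.lt_succ_of_le (Nat.sInf_le hz')

/-- Depth, identifier of the parent and identifier of the hub of a vertex; `0` stands for a missing
parent or hub. -/
@[ext]
structure TreeLabel where
  depth : ℕ
  par : ℕ
  hub : ℕ

/-- The label of a vertex in a routed tree: its own tree label, the one of its parent, and, if the
vertex lies on a route, the identifier and the tree label of the target of the route and the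
distance to it. -/
@[ext]
structure RouteLabel where
  own : TreeLabel
  parent : TreeLabel
  target : ℕ
  claim : TreeLabel
  dist : ℕ

/-- The numbers in a label. -/
def RouteLabel.toVec (l : RouteLabel) : Fin 11 → ℕ :=
  ![l.own.depth, l.own.par, l.own.hub, l.parent.depth, l.parent.par, l.parent.hub, l.target,
    l.claim.depth, l.claim.par, l.claim.hub, l.dist]

theorem RouteLabel.toVec_injective : Function.Injective RouteLabel.toVec := by
  intro l l' h
  have h' : ∀ i, l.toVec i = l'.toVec i := fun i => congrFun h i
  ext
  exacts [h' 0, h' 1, h' 2, h' 3, h' 4, h' 5, h' 6, h' 7, h' 8, h' 9, h' 10]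

/-- The local conditions on the labels of a routed tree. -/
structure RouteCheck (i : ℕ) (l : RouteLabel) (s : Set (ℕ × RouteLabel)) : Prop where
  root : l.own.par = 0 → l.own.hub = 0
  depth_lt : l.own.par ≠ 0 → l.parent.depth < l.own.depth
  hub_eq : l.own.hub = 0 ∨ l.own.hub = l.parent.par ∨ l.own.hub = l.parent.hub
  parent : l.own.par ≠ 0 → ∃ q ∈ s, (q.1 = l.own.par ∧ q.2.own = l.parent) ∨
    (q.2.target = l.own.par ∧ q.2.claim = l.parent)
  route : l.target ≠ 0 → ∃ q ∈ s, (q.1 = l.target ∧ q.2.own = l.claim) ∨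
    (q.2.target = l.target ∧ q.2.claim = l.claim ∧ q.2.dist < l.dist)
  edge : ∀ q ∈ s, (q.1 = l.own.par ∨ q.1 = l.own.hub) ∨ (i = q.2.own.par ∨ i = q.2.own.hub)

/-- Labels that satisfy the local conditions describe a tree with hubs. -/
theorem RouteCheck.hubTree {V : Type} {G : SimpleGraph V} {ident : V → ℕ}
    (hinj : Function.Injective ident) (hpos : ∀ v, 1 ≤ ident v) {c : V → RouteLabel}
    (h : ∀ v, RouteCheck (ident v) (c v) (labelView G ident c v)) :
    HubTree G (fun v u => ident u = (c v).own.par) (fun v a => ident a = (c v).own.hub)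
      (fun v => (c v).own.depth) := by
  -- The claim is copied along decreasing distances until a neighbour confirms it as its own label.
  -- So every announced target exists and its claimed label is true, whatever the route looks like.
  have htarget : ∀ v, (c v).target ≠ 0 → ∃ w, ident w = (c v).target ∧ (c w).own = (c v).claim := by
    intro v
    induction hd : (c v).dist using Nat.strong_induction_on generalizing v with
    | _ n ih =>
      intro hv
      obtain ⟨_, ⟨w, -, rfl⟩, ⟨h1, h2⟩ | ⟨h1, h2, h3⟩⟩ := (h v).route hv
      · exact ⟨w, h1, h2⟩
      · obtain ⟨z, hz1, hz2⟩ := ih (c w).dist (hd ▸ h3) w rfl (by rwa [h1])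
        exact ⟨z, hz1.trans h1, hz2.trans h2⟩
  have hparent : ∀ v u, ident u = (c v).own.par → (c u).own = (c v).parent := by
    intro v u hu
    have h0 : (c v).own.par ≠ 0 := by
      have := hpos u
      omega
    obtain ⟨_, ⟨w, -, rfl⟩, ⟨h1, h2⟩ | ⟨h1, h2⟩⟩ := (h v).parent h0
    · rwa [← hinj (h1.trans hu.symm)]
    · obtain ⟨z, hz1, hz2⟩ := htarget w (by rwa [h1])
      rw [← hinj ((hz1.trans h1).trans hu.symm), hz2, h2]
  constructor
  · intro v u u' h1 h2
    exact hinj (h1.trans h2.symm)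
  · intro v u u' h1 h2
    exact hinj (h1.trans h2.symm)
  · intro v u hu
    have h0 : (c v).own.par ≠ 0 := by
      have := hpos u
      omega
    rw [hparent v u hu]
    exact (h v).depth_lt h0
  · intro v a ha
    have ha0 := hpos a
    have h0 : (c v).own.par ≠ 0 := fun e => by
      have := (h v).root e
      omega
    obtain ⟨u, hu⟩ : ∃ u, ident u = (c v).own.par := by
      obtain ⟨_, ⟨w, -, rfl⟩, ⟨h1, h2⟩ | ⟨h1, h2⟩⟩ := (h v).parent h0
      · exact ⟨w, h1⟩
      · obtain ⟨z, hz1, -⟩ := htarget w (by rwa [h1])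
        exact ⟨z, hz1.trans h1⟩
    refine ⟨u, hu, ?_⟩
    rw [hparent v u hu]
    rcases (h v).hub_eq with h1 | h1 | h1
    · omega
    · exact Or.inl (ha.trans h1)
    · exact Or.inr (ha.trans h1)
  · intro x y hxy
    rcases (h x).edge _ ⟨y, hxy, rfl⟩ with (h1 | h1) | (h1 | h1)
    exacts [Or.inl (Or.inl h1), Or.inl (Or.inr h1), Or.inr (Or.inl h1), Or.inr (Or.inr h1)]

/-- The identifier of an optional vertex; `0` if there is none. -/
def optIdent {V : Type} (ident : V → ℕ) : Option V → ℕ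
  | none => 0
  | some v => ident v

/-- The labels of a routed tree satisfy the local conditions. -/
theorem RoutedTree.exists_labels {V : Type} [Fintype V] {G : SimpleGraph V} {ident : V → ℕ}
    {par hub : V → Option V} {depth : V → ℚ} {col : V → V → Option V} {via : V → Option V}
    (h : RoutedTree Set.univ G par hub depth col via) {N : ℕ} (hN : ∀ v, ident v ≤ N)
    (hcard : Fintype.card V ≤ N) (hpos : ∀ v, 1 ≤ ident v) :
    ∃ c : V → RouteLabel, (∀ v i, (c v).toVec i ≤ N) ∧
      ∀ v, RouteCheck (ident v) (c v) (labelView G ident c v) := by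
  classical
  -- Only comparisons of depths matter, so the rational depths give way to ranks of at most
  -- `Fintype.card V`.
  obtain ⟨D, hD, hDlt⟩ := exists_small_rank depth
  let own : V → TreeLabel := fun v => ⟨D v, optIdent ident (par v), optIdent ident (hub v)⟩
  let parent : V → TreeLabel := fun v => ((par v).map own).getD ⟨0, 0, 0⟩
  let r : V → V → V → Prop := fun c y y' => via y = some c ∧ col y y' = some c
  have hf : ∀ c : V, ∃ g : V → ℕ, (∀ v, g v ≤ Fintype.card V) ∧ ∀ u, par c = some u →
      ∀ z, Relation.ReflTransGen (r c) z u → z ≠ u →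
      ∃ z', r c z z' ∧ Relation.ReflTransGen (r c) z' u ∧ g z' < g z := by
    intro c
    rcases hu : par c with - | u
    · exact ⟨fun _ => 0, by simp, by simp⟩
    · obtain ⟨g, hg, hg'⟩ := exists_rank_towards (r c) u
      refine ⟨g, hg, ?_⟩
      rintro u' hu'
      obtain rfl : u = u' := by simpa using hu'
      exact hg'
  choose f hf hf' using hf
  let onRoute : V → V → V → Prop := fun z c u =>
    via z = some c ∧ par c = some u ∧ z ≠ u ∧ Relation.ReflTransGen (r c) z u
  -- Since `via z` is a single vertex, `z` has to carry the data of one route only; this keeps the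
  -- label of bounded size.
  have huniq : ∀ {z c u c' u'}, onRoute z c u → onRoute z c' u' → c = c' ∧ u = u' := by
    rintro z c u c' u' ⟨h1, h2, -⟩ ⟨h3, h4, -⟩
    obtain rfl : c = c' := by simpa [h1] using h3
    exact ⟨rfl, by simpa [h2] using h4⟩
  let lab : V → RouteLabel := fun z =>
    if hz : ∃ p : V × V, onRoute z p.1 p.2 then
      ⟨own z, parent z, ident hz.choose.2, own hz.choose.2, f hz.choose.1 z⟩
    else ⟨own z, parent z, 0, ⟨0, 0, 0⟩, 0⟩
  have hown : ∀ z, (lab z).own = own z := by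
    intro z
    simp only [lab]
    split_ifs <;> rfl
  have hparent : ∀ z, (lab z).parent = parent z := by
    intro z
    simp only [lab]
    split_ifs <;> rfl
  have hroute : ∀ {z c u}, onRoute z c u →
      (lab z).target = ident u ∧ (lab z).claim = own u ∧ (lab z).dist = f c z := by
    intro z c u hz
    have hz' : ∃ p : V × V, onRoute z p.1 p.2 := ⟨(c, u), hz⟩
    obtain ⟨h1, h2⟩ := huniq hz'.choose_spec hz
    simp only [lab, dif_pos hz']
    rw [h1, h2]
    exact ⟨rfl, rfl, rfl⟩
  have hroute0 : ∀ z, (lab z).target ≠ 0 → ∃ c u, onRoute z c u := by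
    intro z hz
    by_contra hcon
    have hz' : ¬ ∃ p : V × V, onRoute z p.1 p.2 := fun ⟨p, hp⟩ => hcon ⟨p.1, p.2, hp⟩
    simp only [lab, dif_neg hz'] at hz
    exact hz rfl
  have hopt : ∀ o : Option V, optIdent ident o ≤ N := by
    rintro (- | v)
    · exact Nat.zero_le _
    · exact hN v
  have hownle : ∀ v, (own v).depth ≤ N ∧ (own v).par ≤ N ∧ (own v).hub ≤ N :=
    fun v => ⟨(hD v).trans hcard, hopt _, hopt _⟩
  have hparle : ∀ v, (parent v).depth ≤ N ∧ (parent v).par ≤ N ∧ (parent v).hub ≤ N := by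
    intro v
    rcases hu : par v with - | u
    · simp [parent, hu]
    · simpa [parent, hu] using hownle u
  have hpar_some : ∀ {v u}, par v = some u → parent v = own u := by
    intro v u hu
    simp [parent, hu]
  have hnext : ∀ {z c u}, par c = some u → z ≠ u → Relation.ReflTransGen (r c) z u →
      onRoute z c u := by
    intro z c u hu hzu hz
    rcases hz.cases_head with rfl | ⟨z', hz', -⟩
    · exact absurd rfl hzu
    · exact ⟨hz'.1, hu, hzu, hz⟩
  refine ⟨lab, ?_, ?_⟩
  · intro v i
    obtain ⟨h1, h2, h3⟩ := hownle v
    obtain ⟨h4, h5, h6⟩ := hparle v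
    have h7 : (lab v).target ≤ N ∧ (lab v).claim.depth ≤ N ∧ (lab v).claim.par ≤ N ∧
        (lab v).claim.hub ≤ N ∧ (lab v).dist ≤ N := by
      by_cases hv : ∃ c u, onRoute v c u
      · obtain ⟨c, u, hv⟩ := hv
        obtain ⟨e1, e2, e3⟩ := hroute hv
        rw [e1, e2, e3]
        exact ⟨hN u, (hownle u).1, (hownle u).2.1, (hownle u).2.2, (hf c v).trans hcard⟩
      · have hv' : ¬ ∃ p : V × V, onRoute v p.1 p.2 := fun ⟨p, hp⟩ => hv ⟨p.1, p.2, hp⟩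
        simp only [lab, dif_neg hv', Nat.zero_le, and_self]
    obtain ⟨h7, h8, h9, h10, h11⟩ := h7
    rw [← hown v] at h1 h2 h3
    rw [← hparent v] at h4 h5 h6
    fin_cases i <;> assumption
  · intro v
    have hp0 : (lab v).own.par ≠ 0 → ∃ u, par v = some u ∧ (lab v).own.par = ident u := by
      intro h0
      rw [hown] at h0 ⊢
      rcases hu : par v with - | u
      · simp [own, hu, optIdent] at h0
      · exact ⟨u, rfl, by simp [own, hu, optIdent]⟩
    constructor
    · intro h0
      rw [hown] at h0 ⊢
      rcases ha : hub v with - | a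
      · simp [own, ha, optIdent]
      · obtain ⟨u, hu, -⟩ := h.hub_step v a ha
        have := hpos u
        simp only [own, hu, optIdent] at h0
        omega
    · intro h0
      obtain ⟨u, hu, -⟩ := hp0 h0
      rw [hparent, hown, hpar_some hu]
      exact hDlt _ _ (h.par_depth v u hu)
    · rcases ha : hub v with - | a
      · left
        rw [hown]
        simp [own, ha, optIdent]
      · right
        obtain ⟨u, hu, hu'⟩ := h.hub_step v a ha
        rw [hparent, hown, hpar_some hu]
        rcases hu' with hu' | hu'
        · left
          simp [own, ha, hu', optIdent]
        · right
          simp [own, ha, hu', optIdent]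
    · intro h0
      obtain ⟨u, hu, hu0⟩ := hp0 h0
      rw [hparent, hpar_some hu, hu0]
      have hadj : G.Adj v u → ∃ q ∈ labelView G ident lab v, (q.1 = ident u ∧ q.2.own = own u) ∨
          (q.2.target = ident u ∧ q.2.claim = own u) :=
        fun hvu => ⟨_, ⟨u, hvu, rfl⟩, Or.inl ⟨rfl, hown u⟩⟩
      rcases h.par_adj v u hu with hvu | ⟨u', hu', hr⟩
      · exact hadj hvu
      obtain rfl : u = u' := by simpa [hu] using hu'
      -- By `col_via` a vertex at which a step of colour `v` starts is `v`, the target `u`, or has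
      -- `via` equal to `v`. Cutting the walk after its last visit to `v` leaves a neighbour of `v`
      -- from which the steps lie in `r v`.
      have key : ∀ z, Relation.ReflTransGen (fun x y => col x y = some v) z u →
          Relation.ReflTransGen (r v) z u ∨
            ∃ z', col v z' = some v ∧ Relation.ReflTransGen (r v) z' u := by
        intro z hz
        induction hz using Relation.ReflTransGen.head_induction_on with
        | refl => exact Or.inl Relation.ReflTransGen.refl
        | head hab hb ih =>
          rename_i y y'
          rcases ih with ih | ih
          · rcases h.col_via y y' v hab with rfl | h1 | h1
            · exact Or.inr ⟨y', hab, ih⟩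
            · obtain rfl : u = y := by simpa [hu] using h1
              exact Or.inl Relation.ReflTransGen.refl
            · exact Or.inl (Relation.ReflTransGen.head ⟨h1, hab⟩ ih)
          · exact Or.inr ih
      have hvu : v ≠ u := fun e => by
        have := h.par_depth v u hu
        rw [e] at this
        exact lt_irrefl _ this
      obtain ⟨z', hz1, hz2⟩ : ∃ z', col v z' = some v ∧ Relation.ReflTransGen (r v) z' u := by
        rcases key v hr with h1 | h1
        · rcases h1.cases_head with h2 | ⟨z', h2, h3⟩
          · exact absurd h2 hvu
          · exact ⟨z', h2.2, h3⟩
        · exact h1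
      have hvz := h.col_adj _ _ _ hz1
      by_cases hzu : z' = u
      · exact hadj (hzu ▸ hvz)
      · obtain ⟨e1, e2, -⟩ := hroute (hnext hu hzu hz2)
        exact ⟨_, ⟨z', hvz, rfl⟩, Or.inr ⟨e1, e2⟩⟩
    · intro h0
      obtain ⟨c, u, hv⟩ := hroute0 v h0
      obtain ⟨e1, e2, e3⟩ := hroute hv
      obtain ⟨-, hu, hvu, hr⟩ := hv
      obtain ⟨z', hz1, hz2, hz3⟩ := hf' c u hu v hr hvu
      have hvz := h.col_adj _ _ _ hz1.2
      rw [e1, e2, e3]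
      refine ⟨_, ⟨z', hvz, rfl⟩, ?_⟩
      by_cases hzu : z' = u
      · subst hzu
        exact Or.inl ⟨rfl, hown z'⟩
      · obtain ⟨e1', e2', e3'⟩ := hroute (hnext hu hzu hz2)
        exact Or.inr ⟨e1', e2', by rw [e3']; exact hz3⟩
    · rintro _ ⟨w, hw, rfl⟩
      rw [hown]
      simp only [hown]
      rcases h.adj v w hw with (h1 | h1) | (h1 | h1)
      · exact Or.inl (Or.inl (by simp [own, h1, optIdent]))
      · exact Or.inl (Or.inr (by simp [own, h1, optIdent]))
      · exact Or.inr (Or.inl (by simp [own, h1, optIdent]))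
      · exact Or.inr (Or.inr (by simp [own, h1, optIdent]))

/-- The exponent `k + 1` accommodates both identifiers, of size at most `n ^ k`, and depths and
distances, of size at most `n`, even for `k = 0`. -/
theorem pow_le_succ_pow_succ (n k : ℕ) : n ^ k ≤ (n + 1) ^ (k + 1) :=
  (Nat.pow_le_pow_left (Nat.le_succ n) k).trans (Nat.pow_le_pow_right (Nat.succ_pos n) (Nat.le_succ k))

theorem self_le_succ_pow_succ (n k : ℕ) : n ≤ (n + 1) ^ (k + 1) :=
  (Nat.le_succ n).trans (Nat.le_self_pow (Nat.succ_ne_zero k) _)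

/-- The class of graphs without `K₄` minor has a certification with logarithmic certificates. -/
theorem hasLogCertification_K4 (k : ℕ) :
    HasLogCertification k (minorFree (⊤ : SimpleGraph (Fin 4))) := by
  refine hasLogCertification_of_labels RouteLabel.toVec RouteLabel.toVec_injective RouteCheck
    (k + 1) ?_ ?_
  · intro V _ G ident hG hid hfree
    obtain ⟨par, hub, depth, col, via, hR⟩ := exists_routedTree Set.univ G (by simp)
      (connSet_univ_iff.mpr hG) hfree
    exact hR.exists_labels (fun v => (hid.le_pow v).trans (pow_le_succ_pow_succ _ _))
      (self_le_succ_pow_succ _ _) hid.one_le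
  · intro V _ G ident hG hid c hc
    refine (RouteCheck.hubTree hid.injective hid.one_le hc).not_isMinor_of_three ?_
    simp only [SimpleGraph.top_adj]
    decide

/-! ### Normal spanning trees -/

/-- A rooted spanning tree of `G`, given by its parent function. -/
structure SpanningParent {V : Type*} (G : SimpleGraph V) (r : V) (par : V → Option V)
    (depth : V → ℕ) : Prop where
  root : ∀ v, par v = none ↔ v = r
  adj : ∀ {v u}, par v = some u → G.Adj v u
  depth_eq : ∀ {v u}, par v = some u → depth v = depth u + 1

/-- The relation between a vertex and its parent. -/
def IsParent {V : Type*} (par : V → Option V) (v u : V) : Prop := par v = some u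

namespace SpanningParent

open Relation

variable {V : Type*} {G : SimpleGraph V} {r : V} {par : V → Option V} {depth : V → ℕ}

/-- Over the empty graph and without hubs, a spanning tree inherits the facts on ancestors and
depths proved for hub trees. -/
theorem hubTree_bot (h : SpanningParent G r par depth) :
    HubTree (⊥ : SimpleGraph V) (IsParent par) (fun _ _ => False) depth where
  parent_unique h1 h2 := Option.some.inj (h1.symm.trans h2)
  hub_unique h1 := h1.elim
  depth_lt h1 := by rw [h.depth_eq h1]; exact Nat.lt_succ_self _
  hub_step h1 := h1.elim
  adj h1 := h1.elim

theorem reflTransGen_root (h : SpanningParent G r par depth) (v : V) :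
    ReflTransGen (IsParent par) v r := by
  induction hd : depth v using Nat.strong_induction_on generalizing v with
  | _ n ih =>
    rcases hv : par v with - | u
    · rw [(h.root v).mp hv]
    · exact ReflTransGen.head hv (ih (depth u) (by have := h.depth_eq hv; omega) u rfl)

/-- The depth drops by one at each step to the root, so all values from `depth r` to `depth v`
occur, and there are at most `Fintype.card V` of them. -/
theorem depth_lt_card [Fintype V] (h : SpanningParent G r par depth) (v : V) :
    depth v < Fintype.card V + depth r := by
  classical
  have key : ∀ n v, depth v = n → ∀ m, depth r ≤ m → m ≤ n → ∃ u, depth u = m := by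
    intro n
    induction n with
    | zero =>
      intro v hv m _ hm
      exact ⟨v, by omega⟩
    | succ n ih =>
      intro v hv m hrm hm
      by_cases hmn : m = n + 1
      · exact ⟨v, by omega⟩
      rcases hp : par v with - | u
      · rw [(h.root v).mp hp] at hv
        omega
      · exact ih u (by have := h.depth_eq hp; omega) m hrm (by omega)
  by_contra hcon
  push Not at hcon
  have hsub : Finset.Icc (depth r) (depth v) ⊆ Finset.univ.image depth := by
    intro m hm
    rw [Finset.mem_Icc] at hm
    obtain ⟨u, hu⟩ := key _ v rfl m hm.1 hm.2
    exact Finset.mem_image.mpr ⟨u, Finset.mem_univ _, hu⟩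
  have := (Finset.card_le_card hsub).trans Finset.card_image_le
  rw [Nat.card_Icc, Finset.card_univ] at this
  omega

end SpanningParent

/-- Breadth first search trees exist. -/
theorem exists_spanningParent {V : Type*} {G : SimpleGraph V} (hG : G.Connected) (r : V) :
    ∃ par depth, SpanningParent G r par depth ∧ depth r = 0 := by
  classical
  have hex : ∀ v, v ≠ r → ∃ u, G.Adj v u ∧ G.dist v r = G.dist u r + 1 := by
    intro v hv
    obtain ⟨p, hp⟩ := hG.exists_walk_length_eq_dist v r
    cases p with
    | nil => exact absurd rfl hv
    | @cons _ u _ hvu p =>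
      refine ⟨u, hvu, le_antisymm ?_ ?_⟩
      · have h1 := hG.dist_triangle (u := v) (v := u) (w := r)
        rw [SimpleGraph.dist_eq_one_iff_adj.mpr hvu] at h1
        omega
      · rw [← hp, SimpleGraph.Walk.length_cons]
        exact Nat.succ_le_succ (SimpleGraph.dist_le p)
  choose f hf1 hf2 using hex
  refine ⟨fun v => if hv : v = r then none else some (f v hv), fun v => G.dist v r, ⟨?_, ?_, ?_⟩,
    by simp⟩
  · intro v
    by_cases hv : v = r <;> simp [hv]
  · intro v u huv
    by_cases hv : v = r
    · simp [hv] at huv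
    · simp only [hv, dite_false, Option.some.injEq] at huv
      exact huv ▸ hf1 v hv
  · intro v u huv
    by_cases hv : v = r
    · simp [hv] at huv
    · simp only [hv, dite_false, Option.some.injEq] at huv
      exact huv ▸ hf2 v hv

open Relation in
/-- A rooted spanning tree is normal if adjacent vertices are comparable. -/
structure NormalTree {V : Type*} (G : SimpleGraph V) (r : V) (par : V → Option V)
    (depth : V → ℕ) : Prop extends SpanningParent G r par depth where
  comparable_of_adj : ∀ {x y}, G.Adj x y →
    ReflTransGen (IsParent par) x y ∨ ReflTransGen (IsParent par) y x

open Relation in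
/-- Every finite connected graph has a normal spanning tree: one that maximises the sum of the
depths. -/
theorem exists_normalTree {V : Type*} [Fintype V] {G : SimpleGraph V} (hG : G.Connected) (r : V) :
    ∃ par depth, NormalTree G r par depth ∧ depth r = 0 := by
  classical
  let A : Set ℕ := {n | ∃ par depth, SpanningParent G r par depth ∧ depth r = 0 ∧ n = ∑ v, depth v}
  have hne : A.Nonempty := by
    obtain ⟨par, depth, h, h0⟩ := exists_spanningParent hG r
    exact ⟨_, par, depth, h, h0, rfl⟩
  have hbdd : BddAbove A := by
    refine ⟨Fintype.card V * Fintype.card V, ?_⟩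
    rintro n ⟨par, depth, h, h0, rfl⟩
    calc ∑ v, depth v ≤ ∑ _v : V, Fintype.card V :=
          Finset.sum_le_sum fun v _ => by have := h.depth_lt_card v; omega
      _ = Fintype.card V * Fintype.card V := by simp
  obtain ⟨par, depth, h, h0, hsum⟩ := Nat.sSup_mem hne hbdd
  have hmax : ∀ par' depth', SpanningParent G r par' depth' → depth' r = 0 →
      ∑ v, depth' v ≤ ∑ v, depth v := by
    intro par' depth' h' h0'
    rw [← hsum]
    exact le_csSup hbdd ⟨par', depth', h', h0', rfl⟩
  have hT := h.hubTree_bot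
  -- an edge between incomparable vertices would allow a tree with a larger sum of depths
  have key : ∀ x y, G.Adj x y → depth x ≤ depth y → ReflTransGen (IsParent par) y x := by
    intro x y hxy hd
    by_contra hyx
    have hxr : x ≠ r := by
      rintro rfl
      exact hyx (h.reflTransGen_root y)
    -- Re-hanging the subtree of `x` below `y` raises each depth in it by `e`, which is positive as
    -- `depth x ≤ depth y`. The result is a tree because `y` lies outside this subtree.
    let e := depth y + 1 - depth x
    let par' : V → Option V := fun v => if v = x then some y else par v
    let depth' : V → ℕ := fun v => if ReflTransGen (IsParent par) v x then depth v + e else depth v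
    have hpar' : ∀ v, v ≠ x → par' v = par v := fun v hv => by simp [par', hv]
    have h' : SpanningParent G r par' depth' := by
      refine ⟨?_, ?_, ?_⟩
      · intro v
        by_cases hv : v = x
        · subst hv
          simp [par', hxr]
        · rw [hpar' v hv]
          exact h.root v
      · intro v u huv
        by_cases hv : v = x
        · subst hv
          have : y = u := by simpa [par'] using huv
          exact this ▸ hxy
        · rw [hpar' v hv] at huv
          exact h.adj huv
      · intro v u huv
        by_cases hv : v = x
        · subst hv
          have : y = u := by simpa [par'] using huv
          subst this
          simp only [depth', ReflTransGen.refl, if_true, hyx, if_false, e]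
          omega
        · rw [hpar' v hv] at huv
          have hiff : ReflTransGen (IsParent par) v x ↔ ReflTransGen (IsParent par) u x := by
            constructor
            · intro hvx
              rcases hvx.cases_head with rfl | ⟨w, hw, hwx⟩
              · exact absurd rfl hv
              · rwa [hT.parent_unique (show IsParent par v u from huv) hw]
            · exact fun hux => ReflTransGen.head huv hux
          have := h.depth_eq huv
          simp only [depth', hiff]
          split_ifs <;> omega
    have hr' : depth' r = 0 := by
      have : ¬ ReflTransGen (IsParent par) r x := by
        intro hrx
        have := hT.eq_of_depth_le hrx (by omega)
        exact hxr this.symm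
      simp [depth', this, h0]
    have hlt : ∑ v, depth v < ∑ v, depth' v := by
      refine Finset.sum_lt_sum (fun v _ => ?_) ⟨x, Finset.mem_univ x, ?_⟩
      · simp only [depth']
        split_ifs <;> omega
      · simp only [depth', ReflTransGen.refl, if_true, e]
        omega
    exact absurd (hmax par' depth' h' hr') (by omega)
  refine ⟨par, depth, ⟨h, fun {x y} hxy => ?_⟩, h0⟩
  rcases le_total (depth x) (depth y) with hd | hd
  · exact Or.inr (key x y hxy hd)
  · exact Or.inl (key y x hxy.symm hd)

namespace NormalTree

open Relation

variable {V : Type*} {G : SimpleGraph V} {r : V} {par : V → Option V} {depth : V → ℕ}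

theorem depth_lt_of_transGen (h : NormalTree G r par depth) {x y : V}
    (hxy : TransGen (IsParent par) x y) : depth y < depth x :=
  h.hubTree_bot.depth_lt_of_transGen hxy

theorem depth_le (h : NormalTree G r par depth) {x y : V}
    (hxy : ReflTransGen (IsParent par) x y) : depth y ≤ depth x :=
  h.hubTree_bot.depth_le hxy

theorem parent_unique (_ : NormalTree G r par depth) {x y z : V} (hy : IsParent par x y)
    (hz : IsParent par x z) : y = z := Option.some.inj (hy.symm.trans hz)

/-- The subtree of a vertex, without the subtree of another one, is connected. -/
theorem connSet_subtree_diff (h : NormalTree G r par depth) {v w : V}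
    (hvw : ¬ ReflTransGen (IsParent par) v w) :
    ConnSet G {x | ReflTransGen (IsParent par) x v ∧ ¬ ReflTransGen (IsParent par) x w} := by
  refine ConnSet.of_reflTransGen (r := IsParent par) (w := v) ⟨ReflTransGen.refl, hvw⟩
    (fun x hx => hx.1) ?_
  rintro x y ⟨hxv, hxw⟩ hne hxy
  refine ⟨h.adj hxy, ?_, fun hyw => hxw (ReflTransGen.head hxy hyw)⟩
  rcases hxv.cases_head with rfl | ⟨z, hz, hzv⟩
  · exact absurd rfl hne
  · rwa [h.parent_unique hxy hz]

/-- The subtree of a vertex is connected. -/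
theorem connSet_subtree (h : NormalTree G r par depth) (v : V) :
    ConnSet G {x | ReflTransGen (IsParent par) x v} := by
  refine ConnSet.of_reflTransGen (r := IsParent par) (w := v) ReflTransGen.refl
    (fun x hx => hx) ?_
  rintro x y hxv hne hxy
  refine ⟨h.adj hxy, ?_⟩
  rcases ReflTransGen.cases_head hxv with rfl | ⟨z, hz, hzv⟩
  · exact absurd rfl hne
  · rwa [← h.parent_unique hxy hz] at hzv

/-- The ancestors of a vertex are connected. -/
theorem connSet_ancestors (h : NormalTree G r par depth) (v : V) :
    ConnSet G {x | ReflTransGen (IsParent par) v x} := by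
  refine ⟨⟨v, ReflTransGen.refl⟩, ?_⟩
  rintro C ⟨x, hx, hxC⟩ hcl
  have key : ∀ y, ReflTransGen (IsParent par) v y → (v ∈ C ↔ y ∈ C) := by
    intro y hy
    induction hy with
    | refl => rfl
    | tail hvb hbc ih =>
      rw [ih]
      exact ⟨fun hb => hcl _ _ hvb hb (hvb.tail hbc) (h.adj hbc),
        fun hc => hcl _ _ (hvb.tail hbc) hc hvb (h.adj hbc).symm⟩
  intro y hy
  exact (key y hy).mp ((key x hx).mpr hxC)

/-- The path from `x` to its proper ancestor `y`, without `y`. -/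
def path (par : V → Option V) (x y : V) : Set V :=
  {z | ReflTransGen (IsParent par) x z ∧ TransGen (IsParent par) z y}

theorem connSet_path (h : NormalTree G r par depth) {x y : V}
    (hxy : TransGen (IsParent par) x y) : ConnSet G (path par x y) := by
  refine ⟨⟨x, ReflTransGen.refl, hxy⟩, ?_⟩
  rintro C ⟨z, hz, hzC⟩ hcl
  have key : ∀ z, ReflTransGen (IsParent par) x z → TransGen (IsParent par) z y →
      (x ∈ C ↔ z ∈ C) := by
    intro z hz
    induction hz with
    | refl => exact fun _ => Iff.rfl
    | tail hvb hbc ih =>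
      intro hcy
      have hby := TransGen.head hbc hcy
      rw [ih hby]
      exact ⟨fun hb => hcl _ _ ⟨hvb, hby⟩ hb ⟨hvb.tail hbc, hcy⟩ (h.adj hbc),
        fun hc => hcl _ _ ⟨hvb.tail hbc, hcy⟩ hc ⟨hvb, hby⟩ (h.adj hbc).symm⟩
  intro w hw
  exact (key w hw.1 hw.2).mp ((key z hz.1 hz.2).mpr hzC)

theorem path_linked (h : NormalTree G r par depth) {x y : V}
    (hxy : TransGen (IsParent par) x y) : Linked G (path par x y) {y} := by
  obtain ⟨z, hxz, hzy⟩ := TransGen.tail'_iff.mp hxy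
  exact ⟨z, ⟨hxz, TransGen.single hzy⟩, y, rfl, h.adj hzy⟩

/-- Adjacent vertices are properly comparable. -/
theorem transGen_of_adj (h : NormalTree G r par depth) {x y : V} (hxy : G.Adj x y) :
    TransGen (IsParent par) x y ∨ TransGen (IsParent par) y x := by
  rcases h.comparable_of_adj hxy with h1 | h1
  · rcases reflTransGen_iff_eq_or_transGen.mp h1 with h2 | h2
    · exact absurd h2.symm hxy.ne
    · exact Or.inl h2
  · rcases reflTransGen_iff_eq_or_transGen.mp h1 with h2 | h2
    · exact absurd h2 hxy.ne
    · exact Or.inr h2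

/-- Some vertex of the subtree of `v` is adjacent to `a`, which is a proper ancestor of the parent
of `v`. -/
def BackLink (G : SimpleGraph V) (par : V → Option V) (v a : V) : Prop :=
  ∃ x u, ReflTransGen (IsParent par) x v ∧ G.Adj x a ∧ IsParent par v u ∧
    TransGen (IsParent par) u a

theorem BackLink.linked {v a : V} (hva : BackLink G par v a) :
    Linked G {x | ReflTransGen (IsParent par) x v} {a} := by
  obtain ⟨x, -, hx, hxa, -⟩ := hva
  exact ⟨x, hx, a, rfl, hxa⟩

/-- Edges lead to the parent or are back links. -/
theorem adj_cases (h : NormalTree G r par depth) {x y : V} (hxy : G.Adj x y) :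
    (IsParent par x y ∨ BackLink G par x y) ∨ (IsParent par y x ∨ BackLink G par y x) := by
  have key : ∀ x y, G.Adj x y → TransGen (IsParent par) x y →
      IsParent par x y ∨ BackLink G par x y := by
    intro x y hxy hT
    obtain ⟨u, hu, huy⟩ := TransGen.head'_iff.mp hT
    rcases reflTransGen_iff_eq_or_transGen.mp huy with h2 | h2
    · exact Or.inl (h2 ▸ hu)
    · exact Or.inr ⟨x, u, ReflTransGen.refl, hxy, hu, h2⟩
  rcases h.transGen_of_adj hxy with h1 | h1
  · exact Or.inl (key x y hxy h1)
  · exact Or.inr (key y x hxy.symm h1)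

/-- The edge behind a back link of `v` also starts in the subtree of the parent of `v`. This is
`hub_step` with ends of back links as hubs. -/
theorem BackLink.step {v a : V} (hva : BackLink G par v a) :
    ∃ u, IsParent par v u ∧ (IsParent par u a ∨ BackLink G par u a) := by
  obtain ⟨x, u, hx, hxa, hu, hua⟩ := hva
  refine ⟨u, hu, ?_⟩
  obtain ⟨u', hu', hua'⟩ := TransGen.head'_iff.mp hua
  rcases reflTransGen_iff_eq_or_transGen.mp hua' with h2 | h2
  · exact Or.inl (h2 ▸ hu')
  · exact Or.inr ⟨x, u', hx.tail hu, hxa, hu', h2⟩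

end NormalTree

/-! ### Cacti -/

/-- The graph on four vertices with the given edges. -/
def graphOfList (l : List (Fin 4 × Fin 4)) : SimpleGraph (Fin 4) :=
  SimpleGraph.fromRel fun i j => (i, j) ∈ l

instance (l : List (Fin 4 × Fin 4)) : DecidableRel (graphOfList l).Adj := fun i j =>
  decidable_of_iff' _ (SimpleGraph.fromRel_adj _ i j)

/-- `K₄` without the edge between `2` and `3`. -/
abbrev diamondGraph : SimpleGraph (Fin 4) := graphOfList [(0, 1), (0, 2), (0, 3), (1, 2), (1, 3)]

/-- The cycle `0 2 1 3`. -/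
abbrev fourCycle : SimpleGraph (Fin 4) := graphOfList [(0, 2), (0, 3), (1, 2), (1, 3)]

/-- A tree with hubs in which every vertex has at most one child with a hub and the hub is passed on
to this child along the path from the child of the hub, up to a vertex adjacent to the hub. -/
structure CactusTree {V : Type*} (G : SimpleGraph V) (P Q : V → V → Prop) (depth : V → ℕ) : Prop
    extends HubTree G P Q depth where
  hub_pass : ∀ {y v a}, P y v → Q y a → ((∀ b, ¬ Q v b) ∧ P v a) ∨ (Q v a ∧ ¬ G.Adj v a)
  child_unique : ∀ {y y' v a a'}, P y v → P y' v → Q y a → Q y' a' → y = y'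

namespace CactusTree

open Relation

variable {V W : Type*} {G : SimpleGraph V} {H : SimpleGraph W} {P Q : V → V → Prop}
  {depth : V → ℕ}

/-- Hubs outside the subtree of `w` of descendants of `w` are the hub of `w`. -/
theorem hub_eq_of_descendant (h : CactusTree G P Q depth) {w a y b : V} (ha : Q w a)
    (hy : ReflTransGen P y w) (hyb : Q y b) (hb : ¬ ReflTransGen P b w) : b = a := by
  induction hy using ReflTransGen.head_induction_on with
  | refl => exact h.hub_unique hyb ha
  | head hyv hvw ih =>
    rename_i y v
    rcases h.hub_pass hyv hyb with ⟨hno, hvb⟩ | ⟨hvb, -⟩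
    · rcases hvw.cases_head with rfl | ⟨z, hz, hzw⟩
      · exact absurd ha (hno a)
      · rw [h.parent_unique hvb hz] at hb
        exact absurd hzw hb
    · exact ih hvb

/-- The vertices between `w` and its hub `a` have the hub `a`, except for the last one, which has
none. -/
theorem hub_of_between (h : CactusTree G P Q depth) {w q a z : V} (hq : P w q) (ha : Q w a)
    (hqz : ReflTransGen P q z) (hza : TransGen P z a) : Q z a ∨ (P z a ∧ ∀ b, ¬ Q z b) := by
  induction hqz with
  | refl =>
    rcases h.hub_pass hq ha with h1 | h1
    · exact Or.inr ⟨h1.2, h1.1⟩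
    · exact Or.inl h1.1
  | tail hqb hbc ih =>
    rename_i b c
    rcases ih (TransGen.head hbc hza) with h1 | ⟨h1, -⟩
    · rcases h.hub_pass hbc h1 with h2 | h2
      · exact Or.inr ⟨h2.2, h2.1⟩
      · exact Or.inl h2.1
    · rw [h.parent_unique hbc h1] at hza
      exact absurd (h.depth_lt_of_transGen hza) (lt_irrefl _)

/-- A proper ancestor of `w` below its hub has a child with the same hub which is an ancestor of
`w`. -/
theorem exists_child_of_between (h : CactusTree G P Q depth) {w a x : V} (ha : Q w a)
    (hwx : ReflTransGen P w x) (hne : x ≠ w) (hxa : TransGen P x a) :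
    ∃ c, ReflTransGen P w c ∧ P c x ∧ Q c a := by
  rcases hwx.cases_tail with h1 | ⟨c, hwc, hcx⟩
  · exact absurd h1 hne
  refine ⟨c, hwc, hcx, ?_⟩
  rcases hwc.cases_head with rfl | ⟨q, hq, hqc⟩
  · exact ha
  rcases h.hub_of_between hq ha hqc (TransGen.head hcx hxa) with h1 | ⟨h1, -⟩
  · exact h1
  · rw [h.parent_unique hcx h1] at hxa
    exact absurd (h.depth_lt_of_transGen hxa) (lt_irrefl _)

/-- Let `a` be the hub of `w` and `z` a vertex between `w` and `a`. The descendants of `z` with a hub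
outside the subtree of `z` have the hub `a`, and are comparable to `w`. -/
theorem hub_of_descendant_between (h : CactusTree G P Q depth) {w q a z x y : V} (hq : P w q)
    (ha : Q w a) (hqz : ReflTransGen P q z) (hza : TransGen P z a) (hxz : ReflTransGen P x z)
    (hxy : Q x y) (hyz : ¬ ReflTransGen P y z) :
    y = a ∧ (ReflTransGen P x w ∨ ReflTransGen P w x) := by
  have hz := h.hub_of_between hq ha hqz hza
  have haz : ¬ ReflTransGen P a z := fun h1 =>
    absurd (h.depth_lt_of_transGen hza) (by have := h.depth_le h1; omega)
  have hta : ∀ v, ReflTransGen P v z → TransGen P v a := fun v hv => TransGen.trans_right hv hza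
  -- A child with hub `a` of a vertex on the path above `w` is, by `child_unique`, the child through
  -- which the path runs.
  have hchild : ∀ x v, P x v → ReflTransGen P v z → Q x a → ReflTransGen P w v →
      ReflTransGen P x w ∨ ReflTransGen P w x := by
    intro x v hxv hvz hxa hwv
    by_cases hvw : v = w
    · exact Or.inl (hvw ▸ ReflTransGen.single hxv)
    · obtain ⟨c, hwc, hcv, hca⟩ := h.exists_child_of_between ha hwv hvw (hta v hvz)
      rw [h.child_unique hxv hcv hxa hca]
      exact Or.inr hwc
  induction hxz using ReflTransGen.head_induction_on with
  | refl =>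
    rcases hz with h1 | h1
    · exact ⟨h.hub_unique hxy h1, Or.inr (ReflTransGen.head hq hqz)⟩
    · exact absurd hxy (h1.2 y)
  | head hxv hvz ih =>
    rename_i x v
    rcases h.hub_pass hxv hxy with ⟨hno, hvy⟩ | ⟨hvy, -⟩
    · rcases hvz.cases_head with rfl | ⟨u, hu, huz⟩
      · rcases hz with h1 | h1
        · exact absurd h1 (hno a)
        · have hya := h.parent_unique hvy h1.1
          subst hya
          exact ⟨rfl, hchild x _ hxv ReflTransGen.refl hxy (ReflTransGen.head hq hqz)⟩
      · rw [h.parent_unique hvy hu] at hyz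
        exact absurd huz hyz
    · obtain ⟨rfl, h1 | h1⟩ := ih hvy
      · exact ⟨rfl, Or.inl (ReflTransGen.head hxv h1)⟩
      · exact ⟨rfl, hchild x v hxv hvz hxy h1⟩

/-- Let `a` be the hub of `w`, `q` its parent and `z` a vertex between `w` and `a`. The subtree of
`z` without the subtree of `w` is joined to the other vertices only by the edge from `q` to `w` and
the edge from `z` to its parent. -/
theorem adj_between (h : CactusTree G P Q depth) {w q a z x y : V} (hq : P w q) (ha : Q w a)
    (hqz : ReflTransGen P q z) (hza : TransGen P z a)
    (hx : ReflTransGen P x z ∧ ¬ ReflTransGen P x w)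
    (hy : ¬ (ReflTransGen P y z ∧ ¬ ReflTransGen P y w)) (hxy : G.Adj x y) :
    (x = q ∧ y = w) ∨ (x = z ∧ P z y) := by
  obtain ⟨hxz, hxw⟩ := hx
  have hyz : ReflTransGen P y z → ReflTransGen P y w := fun h1 => by
    by_contra h2
    exact hy ⟨h1, h2⟩
  have haz : ¬ ReflTransGen P a z := fun h1 =>
    absurd (h.depth_lt_of_transGen hza) (by have := h.depth_le h1; omega)
  rcases h.adj hxy with (h1 | h1) | (h1 | h1)
  · rcases hxz.cases_head with rfl | ⟨u, hu, huz⟩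
    · exact Or.inr ⟨rfl, h1⟩
    · rw [← h.parent_unique h1 hu] at huz
      exact absurd (ReflTransGen.head h1 (hyz huz)) hxw
  · have hxy' := (h.transGen_of_hub h1).to_reflTransGen
    have hyz' : ¬ ReflTransGen P y z := fun h2 => hxw (hxy'.trans (hyz h2))
    obtain ⟨rfl, h2 | h2⟩ := h.hub_of_descendant_between hq ha hqz hza hxz h1 hyz'
    · exact absurd h2 hxw
    -- Here `x` is a proper ancestor of `w`, and its child on the path has the same hub. Then
    -- `hub_pass` forbids an edge from `x` to this hub.
    · obtain ⟨c, -, hcx, hcy⟩ := h.exists_child_of_between ha h2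
        (fun e => hxw (e ▸ ReflTransGen.refl)) (h.transGen_of_hub h1)
      rcases h.hub_pass hcx hcy with h3 | h3
      · exact absurd h1 (h3.1 _)
      · exact absurd hxy h3.2
  · have hyw := hyz (ReflTransGen.head h1 hxz)
    rcases hyw.cases_head with rfl | ⟨u, hu, huw⟩
    · exact Or.inl ⟨h.parent_unique h1 hq, rfl⟩
    · rw [← h.parent_unique h1 hu] at huw
      exact absurd huw hxw
  · have hyx := (h.transGen_of_hub h1).to_reflTransGen
    have hyw := hyz (hyx.trans hxz)
    have hxa := h.hub_eq_of_descendant ha hyw h1 hxw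
    exact absurd (hxa ▸ hxz) haz

/-- In a model of a minor, let `w` be the deepest top vertex, and let `B₁` and `B₂` contain its
parent and its hub. A fourth branch set that is joined to `B₁` and `B₂` contains the first vertex
outside `B₁` on the path from `w` to its hub, which is in `B₂` if `B₁` and `B₂` are joined. -/
theorem exists_mem_of_linked (h : CactusTree G P Q depth) {B₁ B₂ B₄ : Set V} {w q a : V}
    (hq : P w q) (ha : Q w a) (c₁ : ConnSet G B₁) (c₂ : ConnSet G B₂) (c₄ : ConnSet G B₄)
    (hq₁ : q ∈ B₁) (ha₂ : a ∈ B₂) (d₁₂ : ∀ x ∈ B₁, x ∉ B₂) (d₁₄ : ∀ x ∈ B₁, x ∉ B₄)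
    (hw₁ : w ∉ B₁) (hw₂ : w ∉ B₂) (hw₄ : w ∉ B₄)
    (l₁₄ : Linked G B₁ B₄) (l₂₄ : Linked G B₂ B₄) :
    ∃ z z', ReflTransGen P q z ∧ TransGen P z a ∧ P z z' ∧ z' ∈ B₄ ∧
      (Linked G B₁ B₂ → z' ∈ B₂) := by
  have hqa : TransGen P q a := by
    obtain ⟨u, hu, hua⟩ := TransGen.head'_iff.mp (h.transGen_of_hub ha)
    rw [h.parent_unique hu hq] at hua
    rcases reflTransGen_iff_eq_or_transGen.mp hua with h1 | h1
    · exact absurd (h1 ▸ ha₂) (d₁₂ q hq₁)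
    · exact h1
  -- `zz'` is the tree edge at which the path from `q` up to `a` first leaves `B₁`.
  obtain ⟨z, z', hqz, hz₁, hzz', hz'₁, hza⟩ : ∃ z z', ReflTransGen P q z ∧ z ∈ B₁ ∧ P z z' ∧
      z' ∉ B₁ ∧ TransGen P z a := by
    have key : ∀ q, ReflTransGen P q a → q ∈ B₁ → ∃ z z', ReflTransGen P q z ∧ z ∈ B₁ ∧ P z z' ∧
        z' ∉ B₁ ∧ TransGen P z a := by
      intro q hqa
      induction hqa using ReflTransGen.head_induction_on with
      | refl => exact fun h1 => absurd ha₂ (d₁₂ _ h1)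
      | head hbc hca ih =>
        rename_i b c
        intro hb
        by_cases hc : c ∈ B₁
        · obtain ⟨z, z', h1, h2⟩ := ih hc
          exact ⟨z, z', ReflTransGen.head hbc h1, h2⟩
        · exact ⟨b, c, ReflTransGen.refl, hb, hbc, hc, TransGen.head' hbc hca⟩
    exact key q hqa.to_reflTransGen hq₁
  have haz : ¬ ReflTransGen P a z := fun h1 =>
    absurd (h.depth_lt_of_transGen hza) (by have := h.depth_le h1; omega)
  have hzw : ¬ ReflTransGen P z w := fun h1 => by
    have := h.depth_le h1
    have := h.depth_le hqz
    have := h.depth_lt hq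
    omega
  -- Only the edges `qw` and `zz'` leave `M`. Their inner ends are in `B₁` and their outer ends are
  -- not, so `B₁` lies inside `M` while `B₂` and `B₄` lie outside. As `w` is in none of these sets,
  -- every link from `B₁` to another one is `zz'`.
  let M : Set V := {x | ReflTransGen P x z ∧ ¬ ReflTransGen P x w}
  have hbd : ∀ x y, x ∈ M → y ∉ M → G.Adj x y → (x = q ∧ y = w) ∨ (x = z ∧ P z y) :=
    fun x y hx hy hxy => h.adj_between hq ha hqz hza hx hy hxy
  have hzM : z ∈ M := ⟨ReflTransGen.refl, hzw⟩
  have haM : a ∉ M := fun h1 => haz h1.1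
  have hB₂ : ∀ x ∈ B₂, x ∉ M := by
    intro x hx hxM
    obtain ⟨u, hu, v, hv, huM, hvM, huv⟩ := c₂.exists_adj (C := M) hx hxM ha₂ haM
    rcases hbd u v huM hvM huv with ⟨rfl, -⟩ | ⟨rfl, -⟩
    exacts [d₁₂ _ hq₁ hu, d₁₂ _ hz₁ hu]
  have hB₁ : ∀ x ∈ B₁, x ∈ M := by
    intro x hx
    by_contra hxM
    obtain ⟨u, hu, v, hv, huM, hvM, huv⟩ := c₁.exists_adj (C := M) hz₁ hzM hx hxM
    rcases hbd u v huM hvM huv with ⟨-, rfl⟩ | ⟨-, h1⟩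
    · exact hw₁ hv
    · exact hz'₁ (h.parent_unique h1 hzz' ▸ hv)
  have hB₄ : ∀ x ∈ B₄, x ∉ M := by
    obtain ⟨x₂, hx₂, x₄, hx₄, hx⟩ := l₂₄
    have hx₄M : x₄ ∉ M := by
      intro hM
      rcases hbd x₄ x₂ hM (hB₂ x₂ hx₂) hx.symm with ⟨rfl, -⟩ | ⟨rfl, -⟩
      exacts [d₁₄ _ hq₁ hx₄, d₁₄ _ hz₁ hx₄]
    intro x hx hxM
    obtain ⟨u, hu, v, hv, huM, hvM, huv⟩ := c₄.exists_adj (C := M) hx hxM hx₄ hx₄M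
    rcases hbd u v huM hvM huv with ⟨rfl, -⟩ | ⟨rfl, -⟩
    exacts [d₁₄ _ hq₁ hu, d₁₄ _ hz₁ hu]
  refine ⟨z, z', hqz, hza, hzz', ?_, ?_⟩
  · obtain ⟨x₁, hx₁, x₄, hx₄, hx⟩ := l₁₄
    rcases hbd x₁ x₄ (hB₁ x₁ hx₁) (hB₄ x₄ hx₄) hx with ⟨-, rfl⟩ | ⟨-, h1⟩
    · exact absurd hx₄ hw₄
    · exact h.parent_unique hzz' h1 ▸ hx₄
  · rintro ⟨x₁, hx₁, x₂, hx₂, hx⟩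
    rcases hbd x₁ x₂ (hB₁ x₁ hx₁) (hB₂ x₂ hx₂) hx with ⟨-, rfl⟩ | ⟨-, h1⟩
    · exact absurd hx₂ hw₂
    · exact h.parent_unique hzz' h1 ▸ hx₂

/-- A cactus has no diamond minor. -/
theorem not_isMinor_diamond (h : CactusTree G P Q depth) : ¬ IsMinor diamondGraph G := by
  rw [isMinor_iff]
  rintro ⟨B, h1, h2, h3⟩
  obtain ⟨i, w, hw, -, -, hn⟩ := h.exists_deepest h1 h2 h3
  -- A vertex of degree three is excluded by pigeonhole. For one of degree two, the neighbours `a`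
  -- and `b` are joined to each other and to the fourth vertex `c`, so that `z'` would lie in two
  -- branch sets.
  have hcase : (∃ a b c, a ≠ b ∧ a ≠ c ∧ b ≠ c ∧ diamondGraph.Adj i a ∧ diamondGraph.Adj i b ∧
      diamondGraph.Adj i c) ∨ (∃ a b c, a ≠ b ∧ a ≠ c ∧ b ≠ c ∧ i ≠ c ∧ diamondGraph.Adj i a ∧
      diamondGraph.Adj i b ∧ diamondGraph.Adj a b ∧ diamondGraph.Adj a c ∧
      diamondGraph.Adj b c) := by
    clear hw hn
    revert i
    decide
  rcases hcase with ⟨a, b, c, hab, hac, hbc, ha, hb, hc⟩ | ⟨a, b, c, hab, hac, hbc, hic, ha, hb,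
    lab, lac, lbc⟩
  · obtain ⟨x, hx, hx'⟩ := hn a ha
    obtain ⟨y, hy, hy'⟩ := hn b hb
    obtain ⟨z, hz, hz'⟩ := hn c hc
    have hxy : x ≠ y := fun e => h2 a b hab x hx (e ▸ hy)
    have hxz : x ≠ z := fun e => h2 a c hac x hx (e ▸ hz)
    have hyz : y ≠ z := fun e => h2 b c hbc y hy (e ▸ hz)
    rcases hx' with hx' | hx' <;> rcases hy' with hy' | hy' <;> rcases hz' with hz' | hz'
    all_goals first
      | exact hxy (h.parent_unique hx' hy')
      | exact hxz (h.parent_unique hx' hz')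
      | exact hyz (h.parent_unique hy' hz')
      | exact hxy (h.hub_unique hx' hy')
      | exact hxz (h.hub_unique hx' hz')
      | exact hyz (h.hub_unique hy' hz')
  · obtain ⟨x, hx, hx'⟩ := hn a ha
    obtain ⟨y, hy, hy'⟩ := hn b hb
    have hxy : x ≠ y := fun e => h2 a b hab x hx (e ▸ hy)
    have hwa := h2 i a ha.ne w hw
    have hwb := h2 i b hb.ne w hw
    have hwc := h2 i c hic w hw
    rcases hx' with hx' | hx' <;> rcases hy' with hy' | hy'
    · exact hxy (h.parent_unique hx' hy')
    · obtain ⟨z, z', -, -, -, h4, h5⟩ := h.exists_mem_of_linked hx' hy' (h1 a) (h1 b) (h1 c) hx hy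
        (h2 a b hab) (h2 a c hac) hwa hwb hwc (h3 a c lac) (h3 b c lbc)
      exact h2 b c hbc z' (h5 (h3 a b lab)) h4
    · obtain ⟨z, z', -, -, -, h4, h5⟩ := h.exists_mem_of_linked hy' hx' (h1 b) (h1 a) (h1 c) hy hx
        (h2 b a hab.symm) (h2 b c hbc) hwb hwa hwc (h3 b c lbc) (h3 a c lac)
      exact h2 a c hac z' (h5 (h3 b a lab.symm)) h4
    · exact hxy (h.hub_unique hx' hy')

/-- A cactus all of whose cycles are triangles has no `C₄` minor. -/
theorem not_isMinor_fourCycle (h : CactusTree G P Q depth)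
    (htri : ∀ {y v a}, P y v → Q y a → P v a) : ¬ IsMinor fourCycle G := by
  rw [isMinor_iff]
  rintro ⟨B, h1, h2, h3⟩
  obtain ⟨i, w, hw, -, -, hn⟩ := h.exists_deepest h1 h2 h3
  obtain ⟨a, b, c, hab, hac, hbc, hic, ha, hb, lac, lbc⟩ : ∃ a b c, a ≠ b ∧ a ≠ c ∧ b ≠ c ∧ i ≠ c ∧
      fourCycle.Adj i a ∧ fourCycle.Adj i b ∧ fourCycle.Adj a c ∧ fourCycle.Adj b c := by
    clear hw hn
    revert i
    decide
  obtain ⟨x, hx, hx'⟩ := hn a ha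
  obtain ⟨y, hy, hy'⟩ := hn b hb
  have hxy : x ≠ y := fun e => h2 a b hab x hx (e ▸ hy)
  have hwa := h2 i a ha.ne w hw
  have hwb := h2 i b hb.ne w hw
  have hwc := h2 i c hic w hw
  -- If all cycles are triangles, only `q` lies between `w` and its hub, so `z'` is the hub itself
  -- and already belongs to another branch set.
  have key : ∀ {q a z z'}, P w q → Q w a → ReflTransGen P q z → TransGen P z a → P z z' →
      z' = a := by
    intro q a z z' hq ha hqz hza hzz'
    have hqa := htri hq ha
    rcases hqz.cases_head with rfl | ⟨u, hu, huz⟩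
    · exact h.parent_unique hzz' hqa
    · rw [h.parent_unique hu hqa] at huz
      exact absurd (h.depth_lt_of_transGen hza) (by have := h.depth_le huz; omega)
  rcases hx' with hx' | hx' <;> rcases hy' with hy' | hy'
  · exact hxy (h.parent_unique hx' hy')
  · obtain ⟨z, z', h6, h7, h8, h4, -⟩ := h.exists_mem_of_linked hx' hy' (h1 a) (h1 b) (h1 c) hx hy
      (h2 a b hab) (h2 a c hac) hwa hwb hwc (h3 a c lac) (h3 b c lbc)
    exact h2 b c hbc z' (key hx' hy' h6 h7 h8 ▸ hy) h4
  · obtain ⟨z, z', h6, h7, h8, h4, -⟩ := h.exists_mem_of_linked hy' hx' (h1 b) (h1 a) (h1 c) hy hx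
      (h2 b a hab.symm) (h2 b c hbc) hwb hwa hwc (h3 b c lbc) (h3 a c lac)
    exact h2 a c hac z' (key hy' hx' h6 h7 h8 ▸ hx) h4
  · exact hxy (h.hub_unique hx' hy')

end CactusTree

/-! ### Certification of cacti -/

/-- Three branch sets give a triangle minor. -/
theorem isMinor_of_three {V : Type*} {G : SimpleGraph V} {A B C : Set V} (hA : ConnSet G A)
    (hB : ConnSet G B) (hC : ConnSet G C) (hAB : Disjoint A B) (hAC : Disjoint A C)
    (hBC : Disjoint B C) (l01 : Linked G A B) (l02 : Linked G A C) (l12 : Linked G B C) :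
    IsMinor (⊤ : SimpleGraph (Fin 3)) G := by
  refine ⟨![A, B, C], ?_, ?_, ?_⟩
  · intro i
    rw [induce_connected_iff]
    fin_cases i <;> assumption
  · intro i j hij
    fin_cases i <;> fin_cases j
    all_goals first
      | exact absurd rfl hij
      | assumption
      | exact Disjoint.symm (by assumption)
  · intro i j hij
    change Linked G _ _
    fin_cases i <;> fin_cases j
    all_goals first
      | exact absurd hij (SimpleGraph.irrefl _)
      | assumption
      | exact Linked.symm (by assumption)

/-- Sets of small and of large depth are disjoint. -/
theorem disjoint_of_depth {V : Type*} {depth : V → ℕ} {A B : Set V} (n : ℕ)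
    (hA : ∀ x ∈ A, n ≤ depth x) (hB : ∀ x ∈ B, depth x < n) : Disjoint A B :=
  Set.disjoint_left.mpr fun x h1 h2 => absurd (hA x h1) (by have := hB x h2; omega)

/-! ### Back links and excluded minors in normal spanning trees -/

namespace NormalTree

open Relation

variable {V : Type*} {G : SimpleGraph V} {r : V} {par : V → Option V} {depth : V → ℕ}

theorem depth_path (h : NormalTree G r par depth) {x y z : V} (hz : z ∈ path par x y) :
    depth z ≤ depth x ∧ depth y < depth z :=
  ⟨h.depth_le hz.1, h.depth_lt_of_transGen hz.2⟩

/-- In a graph without diamond minor, the back links from a vertex have the same end. -/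
theorem backLink_unique (h : NormalTree G r par depth) (hG : ¬ IsMinor diamondGraph G)
    {v a a' : V} (ha : BackLink G par v a) (ha' : BackLink G par v a') : a = a' := by
  have key : ∀ {a a'}, BackLink G par v a → BackLink G par v a' →
      TransGen (IsParent par) a' a → False := by
    intro a a' ha ha' haa
    apply hG
    obtain ⟨x, u, hx, hxa, hu, hua⟩ := ha
    obtain ⟨x', u', hx', hxa', hu', hua'⟩ := ha'
    obtain rfl := h.parent_unique hu hu'
    have d1 := h.depth_eq hu
    have d2 := h.depth_lt_of_transGen hua'
    have d3 := h.depth_lt_of_transGen haa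
    have e0 : ∀ x ∈ {x | ReflTransGen (IsParent par) x v}, depth v ≤ depth x :=
      fun x hx => h.depth_le hx
    have e1 : ∀ x ∈ path par a' a, depth x ≤ depth a' ∧ depth a < depth x :=
      fun x hx => h.depth_path hx
    have e2 : ∀ x ∈ path par u a', depth x ≤ depth u ∧ depth a' < depth x :=
      fun x hx => h.depth_path hx
    -- With `a` above `a'`, the subtree of `v` and the tree path from `a'` towards `a` play the
    -- vertices of degree three; the path from the parent of `v` towards `a'` and the vertex `a`
    -- play the others.
    refine isMinor_of_four (h.connSet_subtree v) (h.connSet_path haa) (h.connSet_path hua')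
      (ConnSet.singleton a)
      (disjoint_of_depth (depth v) e0 fun x hx => by have := e1 x hx; omega)
      (disjoint_of_depth (depth v) e0 fun x hx => by have := e2 x hx; omega)
      (disjoint_of_depth (depth v) e0 ?_)
      (disjoint_of_depth (depth a' + 1) (fun x hx => (e2 x hx).2)
        fun x hx => by have := e1 x hx; omega).symm
      (disjoint_of_depth (depth a + 1) (fun x hx => (e1 x hx).2) ?_)
      (disjoint_of_depth (depth a' + 1) (fun x hx => (e2 x hx).2) ?_)
      (fun _ => hxa'.linked hx' ⟨ReflTransGen.refl, haa⟩)
      (fun _ => (h.adj hu).linked ReflTransGen.refl ⟨ReflTransGen.refl, hua'⟩)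
      (fun _ => hxa.linked hx rfl)
      (fun _ => ((h.path_linked hua').mono subset_rfl ?_).symm)
      (fun _ => h.path_linked haa) fun h1 => absurd h1 (by decide)
    · rintro _ rfl
      omega
    · rintro _ rfl
      omega
    · rintro _ rfl
      omega
    · rintro _ rfl
      exact ⟨ReflTransGen.refl, haa⟩
  by_contra hne
  obtain ⟨x, u, -, -, hu, hua⟩ := id ha
  obtain ⟨x', u', -, -, hu', hua'⟩ := id ha'
  obtain rfl := h.parent_unique hu hu'
  rcases h.hubTree_bot.comparable hua.to_reflTransGen hua'.to_reflTransGen with h1 | h1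
  · rcases reflTransGen_iff_eq_or_transGen.mp h1 with h2 | h2
    · exact hne h2.symm
    · exact key ha' ha h2
  · rcases reflTransGen_iff_eq_or_transGen.mp h1 with h2 | h2
    · exact hne h2
    · exact key ha ha' h2

/-- In a graph without diamond minor, the parent of a vertex with a back link has either the same
back link, which does not come from an edge at the parent, or the end of the back link as parent. -/
theorem backLink_pass (h : NormalTree G r par depth) (hG : ¬ IsMinor diamondGraph G)
    {y v a : V} (hv : IsParent par y v) (ha : BackLink G par y a) :
    ((∀ b, ¬ BackLink G par v b) ∧ IsParent par v a) ∨ (BackLink G par v a ∧ ¬ G.Adj v a) := by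
  obtain ⟨v', hv', hstep⟩ := ha.step
  obtain rfl := h.parent_unique hv hv'
  have dv := h.depth_eq hv
  have ey : ∀ x ∈ {x | ReflTransGen (IsParent par) x y}, depth y ≤ depth x :=
    fun x hx => h.depth_le hx
  rcases hstep with hva | hva
  · refine Or.inl ⟨?_, hva⟩
    rintro b ⟨x', u, hx', hxb, hu, hub⟩
    obtain rfl := h.parent_unique hva hu
    -- Otherwise `y` would also have a back link to `b`, which lies strictly above `a`. So the
    -- subtree of `v` without that of `y` is a separate branch set containing `x'`.
    have hxy : ¬ ReflTransGen (IsParent par) x' y := by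
      intro hxy
      have hb : BackLink G par y b := ⟨x', v, hxy, hxb, hv, TransGen.head hva hub⟩
      have := h.depth_lt_of_transGen hub
      rw [h.backLink_unique hG ha hb] at this
      exact lt_irrefl _ this
    have hvy : ¬ ReflTransGen (IsParent par) v y := fun h1 => by
      have := h.depth_le h1
      omega
    have da := h.depth_eq hva
    have db := h.depth_lt_of_transGen hub
    have e0 : ∀ x ∈ {x | ReflTransGen (IsParent par) x v ∧ ¬ ReflTransGen (IsParent par) x y},
        depth v ≤ depth x := fun x hx => h.depth_le hx.1
    have e1 : ∀ x ∈ path par a b, depth x ≤ depth a ∧ depth b < depth x :=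
      fun x hx => h.depth_path hx
    apply hG
    refine isMinor_of_four (h.connSet_subtree_diff hvy) (h.connSet_path hub) (h.connSet_subtree y)
      (ConnSet.singleton b)
      (disjoint_of_depth (depth v) e0 fun x hx => by have := e1 x hx; omega)
      (Set.disjoint_left.mpr fun x h1 h2 => h1.2 h2)
      (disjoint_of_depth (depth v) e0 ?_)
      (disjoint_of_depth (depth y) ey fun x hx => by have := e1 x hx; omega).symm
      (disjoint_of_depth (depth b + 1) (fun x hx => (e1 x hx).2) ?_)
      (disjoint_of_depth (depth y) ey ?_)
      (fun _ => (h.adj hva).linked ⟨ReflTransGen.refl, hvy⟩ ⟨ReflTransGen.refl, hub⟩)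
      (fun _ => (h.adj hv).symm.linked ⟨ReflTransGen.refl, hvy⟩ ReflTransGen.refl)
      (fun _ => hxb.linked ⟨hx', hxy⟩ rfl)
      (fun _ => (ha.linked.mono subset_rfl ?_).symm)
      (fun _ => h.path_linked hub) fun h1 => absurd h1 (by decide)
    · rintro _ rfl
      omega
    · rintro _ rfl
      omega
    · rintro _ rfl
      omega
    · rintro _ rfl
      exact ⟨ReflTransGen.refl, hub⟩
  · refine Or.inr ⟨hva, fun hadj => hG ?_⟩
    obtain ⟨-, u, -, -, hu, hua⟩ := hva
    have du := h.depth_eq hu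
    have da := h.depth_lt_of_transGen hua
    have e3 : ∀ x ∈ path par u a, depth x ≤ depth u ∧ depth a < depth x :=
      fun x hx => h.depth_path hx
    -- The edge `va` would be a chord of the cycle through the subtree of `y`, `v`, the tree path
    -- above `v`, and `a`.
    refine isMinor_of_four (ConnSet.singleton v) (ConnSet.singleton a) (h.connSet_subtree y)
      (h.connSet_path hua)
      (Set.disjoint_singleton.mpr hadj.ne)
      (disjoint_of_depth (depth y) ey ?_).symm
      (disjoint_of_depth (depth := depth) (depth v) ?_ fun x hx => by have := e3 x hx; omega)
      (disjoint_of_depth (depth y) ey ?_).symm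
      (disjoint_of_depth (depth a + 1) (fun x hx => (e3 x hx).2) ?_).symm
      (disjoint_of_depth (depth y) ey fun x hx => by have := e3 x hx; omega)
      (fun _ => hadj.linked rfl rfl)
      (fun _ => (h.adj hv).symm.linked rfl ReflTransGen.refl)
      (fun _ => (h.adj hu).linked rfl ⟨ReflTransGen.refl, hua⟩)
      (fun _ => ha.linked.symm)
      (fun _ => (h.path_linked hua).symm) fun h1 => absurd h1 (by decide)
    · rintro _ rfl
      omega
    · rintro _ rfl
      exact le_rfl
    · rintro _ rfl
      omega
    · rintro _ rfl
      omega

/-- In a graph without diamond minor, back links start in the subtree of at most one child. -/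
theorem child_unique (h : NormalTree G r par depth) (hG : ¬ IsMinor diamondGraph G)
    {y y' v a a' : V} (hy : IsParent par y v) (hy' : IsParent par y' v) (ha : BackLink G par y a)
    (ha' : BackLink G par y' a') : y = y' := by
  by_contra hne
  obtain ⟨x, w, hx, hxa, hw, hwa⟩ := ha
  obtain ⟨x', w', hx', hxa', hw', hwa'⟩ := ha'
  obtain rfl := h.parent_unique hy hw
  obtain rfl := h.parent_unique hy' hw'
  obtain ⟨u, hu, hua⟩ := TransGen.head'_iff.mp hwa
  obtain ⟨u', hu', hua'⟩ := TransGen.head'_iff.mp hwa'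
  obtain rfl := h.parent_unique hu hu'
  have dy := h.depth_eq hy
  have dy' := h.depth_eq hy'
  have du := h.depth_eq hu
  have e1 : ∀ x ∈ {x | ReflTransGen (IsParent par) u x}, depth x ≤ depth u :=
    fun x hx => h.depth_le hx
  have ey : ∀ x ∈ {x | ReflTransGen (IsParent par) x y}, depth y ≤ depth x :=
    fun x hx => h.depth_le hx
  have ey' : ∀ x ∈ {x | ReflTransGen (IsParent par) x y'}, depth y' ≤ depth x :=
    fun x hx => h.depth_le hx
  apply hG
  -- Two children with back links yield two disjoint subtrees, each joined to both `v` and the set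
  -- of its proper ancestors; `v` is joined to this set by a tree edge.
  refine isMinor_of_four (ConnSet.singleton v) (h.connSet_ancestors u) (h.connSet_subtree y)
    (h.connSet_subtree y')
    (disjoint_of_depth (depth := depth) (depth v) ?_ fun x hx => by have := e1 x hx; omega)
    (disjoint_of_depth (depth y) ey ?_).symm
    (disjoint_of_depth (depth y') ey' ?_).symm
    (disjoint_of_depth (depth y) ey fun x hx => by have := e1 x hx; omega).symm
    (disjoint_of_depth (depth y') ey' fun x hx => by have := e1 x hx; omega).symm
    (Set.disjoint_left.mpr fun z h1 h2 => ?_)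
    (fun _ => (h.adj hu).linked rfl ReflTransGen.refl)
    (fun _ => (h.adj hy).symm.linked rfl ReflTransGen.refl)
    (fun _ => (h.adj hy').symm.linked rfl ReflTransGen.refl)
    (fun _ => hxa.symm.linked hua hx)
    (fun _ => hxa'.symm.linked hua' hx') fun h1 => absurd h1 (by decide)
  · rintro _ rfl
    exact le_rfl
  · rintro _ rfl
    omega
  · rintro _ rfl
    omega
  · rcases h.hubTree_bot.comparable h1 h2 with h3 | h3
    · exact hne (h.hubTree_bot.eq_of_depth_le h3 (by omega))
    · exact hne (h.hubTree_bot.eq_of_depth_le h3 (by omega)).symm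

/-- A graph without diamond minor is a cactus. -/
theorem cactusTree (h : NormalTree G r par depth) (hG : ¬ IsMinor diamondGraph G) :
    CactusTree G (IsParent par) (BackLink G par) depth where
  parent_unique := h.parent_unique
  hub_unique := h.backLink_unique hG
  depth_lt := h.hubTree_bot.depth_lt
  hub_step := fun ha => ha.step
  adj := h.adj_cases
  hub_pass := h.backLink_pass hG
  child_unique := h.child_unique hG

/-- In a graph without `C₄` minor, the end of a back link of a vertex is its grandparent. -/
theorem isParent_of_backLink (h : NormalTree G r par depth) (hG : ¬ IsMinor fourCycle G)
    {y v a : V} (hv : IsParent par y v) (ha : BackLink G par y a) : IsParent par v a := by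
  obtain ⟨v', hv', hstep⟩ := ha.step
  obtain rfl := h.parent_unique hv hv'
  rcases hstep with hva | ⟨-, u, -, -, hu, hua⟩
  · exact hva
  have dy := h.depth_eq hv
  have du := h.depth_eq hu
  have da := h.depth_lt_of_transGen hua
  have e3 : ∀ x ∈ path par u a, depth x ≤ depth u ∧ depth a < depth x :=
    fun x hx => h.depth_path hx
  have ey : ∀ x ∈ {x | ReflTransGen (IsParent par) x y}, depth y ≤ depth x :=
    fun x hx => h.depth_le hx
  -- Otherwise the path from the parent of `v` towards `a` and the subtree of `y` are two routes
  -- between `v` and `a`, which form a four-cycle minor.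
  refine absurd (isMinor_of_four (ConnSet.singleton v) (ConnSet.singleton a) (h.connSet_subtree y)
    (h.connSet_path hua)
    (Set.disjoint_singleton.mpr fun e => ?_)
    (disjoint_of_depth (depth y) ey ?_).symm
    (disjoint_of_depth (depth := depth) (depth v) ?_ fun x hx => by have := e3 x hx; omega)
    (disjoint_of_depth (depth y) ey ?_).symm
    (disjoint_of_depth (depth a + 1) (fun x hx => (e3 x hx).2) ?_).symm
    (disjoint_of_depth (depth y) ey fun x hx => by have := e3 x hx; omega)
    (fun h1 => absurd h1 (by decide))
    (fun _ => (h.adj hv).symm.linked rfl ReflTransGen.refl)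
    (fun _ => (h.adj hu).linked rfl ⟨ReflTransGen.refl, hua⟩)
    (fun _ => ha.linked.symm)
    (fun _ => (h.path_linked hua).symm) fun h1 => absurd h1 (by decide)) hG
  · rw [e] at du
    omega
  · rintro _ rfl
    omega
  · rintro _ rfl
    exact le_rfl
  · rintro _ rfl
    omega
  · rintro _ rfl
    omega

/-- A graph without triangle minor has no back links. -/
theorem not_backLink (h : NormalTree G r par depth)
    (hG : ¬ IsMinor (⊤ : SimpleGraph (Fin 3)) G) (y a : V) : ¬ BackLink G par y a := by
  rintro ⟨x, v, hx, hxa, hv, hva⟩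
  have dy := h.depth_eq hv
  have da := h.depth_lt_of_transGen hva
  have ey : ∀ x ∈ {x | ReflTransGen (IsParent par) x y}, depth y ≤ depth x :=
    fun x hx => h.depth_le hx
  have e1 : ∀ x ∈ path par v a, depth x ≤ depth v ∧ depth a < depth x :=
    fun x hx => h.depth_path hx
  refine hG (isMinor_of_three (h.connSet_subtree y) (h.connSet_path hva) (ConnSet.singleton a)
    (disjoint_of_depth (depth y) ey fun x hx => by have := e1 x hx; omega)
    (disjoint_of_depth (depth y) ey ?_)
    (disjoint_of_depth (depth a + 1) (fun x hx => (e1 x hx).2) ?_)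
    ((h.adj hv).linked ReflTransGen.refl ⟨ReflTransGen.refl, hva⟩)
    (hxa.linked hx rfl) (h.path_linked hva))
  · rintro _ rfl
    omega
  · rintro _ rfl
    omega

end NormalTree

/-! ### Labels and local conditions for cacti -/

/-- The numbers in a label. -/
def TreeLabel.toVec (l : TreeLabel) : Fin 3 → ℕ := ![l.depth, l.par, l.hub]

theorem TreeLabel.toVec_injective : Function.Injective TreeLabel.toVec := by
  intro l l' h
  have h' : ∀ i, l.toVec i = l'.toVec i := fun i => congrFun h i
  ext
  exacts [h' 0, h' 1, h' 2]

/-- The local conditions on the labels of a cactus. -/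
structure CactusCheck (i : ℕ) (l : TreeLabel) (s : Set (ℕ × TreeLabel)) : Prop where
  root : l.par = 0 → l.hub = 0
  parent : l.par ≠ 0 → ∃ q ∈ s, q.1 = l.par ∧ q.2.depth < l.depth ∧
    (l.hub = 0 ∨ (q.2.hub = 0 ∧ l.hub = q.2.par) ∨ q.2.hub = l.hub)
  not_adj : ∀ q ∈ s, q.2.par = i → q.2.hub = l.hub → l.hub ≠ 0 → ∀ q' ∈ s, q'.1 ≠ l.hub
  child_unique : ∀ q ∈ s, ∀ q' ∈ s, q.2.par = i → q'.2.par = i → q.2.hub ≠ 0 → q'.2.hub ≠ 0 →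
    q.1 = q'.1
  edge : ∀ q ∈ s, (q.1 = l.par ∨ q.1 = l.hub) ∨ (i = q.2.par ∨ i = q.2.hub)

/-- Labels that satisfy the local conditions describe a cactus. -/
theorem CactusCheck.cactusTree {V : Type} {G : SimpleGraph V} {ident : V → ℕ}
    (hinj : Function.Injective ident) (hpos : ∀ v, 1 ≤ ident v) {c : V → TreeLabel}
    (h : ∀ v, CactusCheck (ident v) (c v) (labelView G ident c v)) :
    CactusTree G (fun v u => ident u = (c v).par) (fun v a => ident a = (c v).hub)
      (fun v => (c v).depth) := by
  have hparent : ∀ v u, ident u = (c v).par → G.Adj v u ∧ (c u).depth < (c v).depth ∧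
      ((c v).hub = 0 ∨ ((c u).hub = 0 ∧ (c v).hub = (c u).par) ∨ (c u).hub = (c v).hub) := by
    intro v u hu
    have := hpos u
    obtain ⟨_, ⟨w, hw, rfl⟩, h1, h2⟩ := (h v).parent (by omega)
    rw [hinj (hu.trans h1.symm)]
    exact ⟨hw, h2⟩
  have hne : ∀ {v a}, ident a = (c v).hub → (c v).hub ≠ 0 := by
    intro v a ha
    have := hpos a
    omega
  refine ⟨⟨?_, ?_, ?_, ?_, ?_⟩, ?_, ?_⟩
  · intro v u u' h1 h2
    exact hinj (h1.trans h2.symm)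
  · intro v u u' h1 h2
    exact hinj (h1.trans h2.symm)
  · intro v u hu
    exact (hparent v u hu).2.1
  · intro v a ha
    obtain ⟨_, ⟨u, hu, rfl⟩, h1, -⟩ := (h v).parent fun e => hne ha ((h v).root e)
    refine ⟨u, h1, ?_⟩
    rcases (hparent v u h1).2.2 with h2 | h2 | h2
    · exact absurd h2 (hne ha)
    · exact Or.inl (ha.trans h2.2)
    · exact Or.inr (ha.trans h2.symm)
  · intro x y hxy
    exact (h x).edge _ ⟨y, hxy, rfl⟩
  · intro y v a hv ha
    obtain ⟨hyv, -, h2⟩ := hparent y v hv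
    rcases h2 with h2 | h2 | h2
    · exact absurd h2 (hne ha)
    · refine Or.inl ⟨fun b hb => hne hb h2.1, ha.trans h2.2⟩
    · refine Or.inr ⟨ha.trans h2.symm, fun hva => ?_⟩
      exact (h v).not_adj _ ⟨y, hyv.symm, rfl⟩ hv.symm h2.symm (h2 ▸ hne ha) _ ⟨a, hva, rfl⟩
        (ha.trans h2.symm)
  · intro y y' v a a' hy hy' ha ha'
    exact hinj ((h v).child_unique _ ⟨y, (hparent y v hy).1.symm, rfl⟩ _
      ⟨y', (hparent y' v hy').1.symm, rfl⟩ hy.symm hy'.symm (hne ha) (hne ha'))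

open Classical in
/-- The identifier of a vertex related to `v`; `0` if there is none. -/
noncomputable def relIdent {V : Type} (ident : V → ℕ) (R : V → V → Prop) (v : V) : ℕ :=
  if h : ∃ u, R v u then ident h.choose else 0

section relIdent

variable {V : Type} {ident : V → ℕ} {R : V → V → Prop}

theorem relIdent_eq (hR : ∀ {v u u'}, R v u → R v u' → u = u') {v u : V} (h : R v u) :
    relIdent ident R v = ident u := by
  have hex : ∃ u, R v u := ⟨u, h⟩
  rw [relIdent, dif_pos hex, hR hex.choose_spec h]

theorem exists_of_relIdent_ne_zero {v : V} (h : relIdent ident R v ≠ 0) : ∃ u, R v u := by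
  by_contra hex
  rw [relIdent, dif_neg hex] at h
  exact h rfl

theorem rel_of_relIdent_eq (hinj : Function.Injective ident) (hpos : ∀ v, 1 ≤ ident v)
    {v u : V} (h : relIdent ident R v = ident u) : R v u := by
  have hex : ∃ u, R v u := exists_of_relIdent_ne_zero (ident := ident) (by
    have := hpos u
    omega)
  rw [relIdent, dif_pos hex] at h
  exact hinj h ▸ hex.choose_spec

theorem relIdent_eq_zero {v : V} (h : ∀ u, ¬ R v u) : relIdent ident R v = 0 := by
  by_contra h0
  obtain ⟨u, hu⟩ := exists_of_relIdent_ne_zero h0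
  exact h u hu

theorem relIdent_le {N : ℕ} (hN : ∀ v, ident v ≤ N) (v : V) : relIdent ident R v ≤ N := by
  rw [relIdent]
  split_ifs
  · exact hN _
  · exact Nat.zero_le _

end relIdent

/-- The labels of the vertices of a cactus. -/
noncomputable def cactusLabel {V : Type} (ident : V → ℕ) (P Q : V → V → Prop) (depth : V → ℕ)
    (v : V) : TreeLabel := ⟨depth v, relIdent ident P v, relIdent ident Q v⟩

theorem CactusTree.cactusCheck {V : Type} {G : SimpleGraph V} {P Q : V → V → Prop}
    {depth : V → ℕ} (h : CactusTree G P Q depth) (hP : ∀ {v u}, P v u → G.Adj v u)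
    {ident : V → ℕ} (hinj : Function.Injective ident) (hpos : ∀ v, 1 ≤ ident v) (v : V) :
    CactusCheck (ident v) (cactusLabel ident P Q depth v)
      (labelView G ident (cactusLabel ident P Q depth) v) where
  root h0 := by
    by_contra h1
    obtain ⟨a, ha⟩ := exists_of_relIdent_ne_zero h1
    obtain ⟨u, hu, -⟩ := h.hub_step ha
    have h2 : ident u = 0 := (relIdent_eq (R := P) h.parent_unique hu).symm.trans h0
    have := hpos u
    omega
  parent h0 := by
    obtain ⟨u, hu⟩ := exists_of_relIdent_ne_zero h0
    refine ⟨_, ⟨u, hP hu, rfl⟩, (relIdent_eq (R := P) h.parent_unique hu).symm, h.depth_lt hu, ?_⟩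
    by_cases hQ : ∃ a, Q v a
    · obtain ⟨a, ha⟩ := hQ
      simp only [cactusLabel, relIdent_eq (R := Q) h.hub_unique ha]
      rcases h.hub_pass hu ha with h1 | h1
      · exact Or.inr (Or.inl ⟨relIdent_eq_zero h1.1, (relIdent_eq (R := P) h.parent_unique h1.2).symm⟩)
      · exact Or.inr (Or.inr (relIdent_eq (R := Q) h.hub_unique h1.1))
    · exact Or.inl (relIdent_eq_zero fun a ha => hQ ⟨a, ha⟩)
  not_adj := by
    rintro _ ⟨y, -, rfl⟩ h1 h2 h3 _ ⟨a, ha, rfl⟩ h4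
    have hva := rel_of_relIdent_eq hinj hpos h4.symm
    have hya := rel_of_relIdent_eq hinj hpos (h2.trans h4.symm)
    rcases h.hub_pass (rel_of_relIdent_eq hinj hpos h1) hya with h5 | h5
    · exact h5.1 a hva
    · exact h5.2 ha
  child_unique := by
    rintro _ ⟨y, -, rfl⟩ _ ⟨y', -, rfl⟩ h1 h2 h3 h4
    obtain ⟨a, ha⟩ := exists_of_relIdent_ne_zero h3
    obtain ⟨a', ha'⟩ := exists_of_relIdent_ne_zero h4
    exact congrArg ident (h.child_unique (rel_of_relIdent_eq hinj hpos h1)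
      (rel_of_relIdent_eq hinj hpos h2) ha ha')
  edge := by
    rintro _ ⟨y, hy, rfl⟩
    rcases h.adj hy with (h1 | h1) | (h1 | h1)
    · exact Or.inl (Or.inl (relIdent_eq (R := P) h.parent_unique h1).symm)
    · exact Or.inl (Or.inr (relIdent_eq (R := Q) h.hub_unique h1).symm)
    · exact Or.inr (Or.inl (relIdent_eq (R := P) h.parent_unique h1).symm)
    · exact Or.inr (Or.inr (relIdent_eq (R := Q) h.hub_unique h1).symm)

/-- Classes of cacti with an additional local condition `E` on the labels are certified. -/
theorem hasLogCertification_of_cactus (k : ℕ) {𝒞 : GraphClass}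
    (E : TreeLabel → Set (ℕ × TreeLabel) → Prop)
    (complete : ∀ (V : Type) [Fintype V] (G : SimpleGraph V) (ident : V → ℕ), 𝒞 V G →
      IsIdentifierAssignment k ident → ∀ r par depth, NormalTree G r par depth →
      ¬ IsMinor diamondGraph G ∧
        ∀ v, E (cactusLabel ident (IsParent par) (NormalTree.BackLink G par) depth v)
          (labelView G ident
            (cactusLabel ident (IsParent par) (NormalTree.BackLink G par) depth) v))
    (sound : ∀ (V : Type) [Fintype V] (G : SimpleGraph V) (ident : V → ℕ),
      IsIdentifierAssignment k ident → ∀ c : V → TreeLabel,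
      (∀ v, CactusCheck (ident v) (c v) (labelView G ident c v)) →
      (∀ v, E (c v) (labelView G ident c v)) → 𝒞 V G) :
    HasLogCertification k 𝒞 := by
  refine hasLogCertification_of_labels TreeLabel.toVec TreeLabel.toVec_injective
    (fun i l s => CactusCheck i l s ∧ E l s) (k + 1) ?_ ?_
  · intro V _ G ident hG hid hC
    obtain ⟨r⟩ := hG.nonempty
    obtain ⟨par, depth, hT, h0⟩ := exists_normalTree hG r
    obtain ⟨hfree, hE⟩ := complete V G ident hC hid r par depth hT
    refine ⟨cactusLabel ident (IsParent par) (NormalTree.BackLink G par) depth, ?_, fun v =>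
      ⟨(hT.cactusTree hfree).cactusCheck hT.adj hid.injective hid.one_le v, hE v⟩⟩
    have hN : ∀ v, ident v ≤ (Fintype.card V + 1) ^ (k + 1) :=
      fun v => (hid.le_pow v).trans (pow_le_succ_pow_succ _ _)
    intro v i
    fin_cases i
    · have := hT.depth_lt_card v
      exact (show depth v ≤ Fintype.card V by omega).trans (self_le_succ_pow_succ _ _)
    · exact relIdent_le hN v
    · exact relIdent_le hN v
  · intro V _ G ident hG hid c hc
    exact sound V G ident hid c (fun v => (hc v).1) fun v => (hc v).2

/-- The class of graphs without diamond minor has a certification with logarithmic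
certificates. -/
theorem hasLogCertification_diamond (k : ℕ) : HasLogCertification k (minorFree diamondGraph) := by
  refine hasLogCertification_of_cactus k (fun _ _ => True) ?_ ?_
  · intro V _ G ident hG _ r par depth _
    exact ⟨hG, fun _ => trivial⟩
  · intro V _ G ident hid c hc _
    exact (CactusCheck.cactusTree hid.injective hid.one_le hc).not_isMinor_diamond

/-- The class of graphs without `C₄` minor has a certification with logarithmic certificates. -/
theorem hasLogCertification_fourCycle (k : ℕ) : HasLogCertification k (minorFree fourCycle) := by
  -- The extra condition says that a hub is the parent of the parent, which is visible because
  -- parents are neighbours.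
  refine hasLogCertification_of_cactus k
    (fun l s => l.hub ≠ 0 → ∀ q ∈ s, q.1 = l.par → q.2.par = l.hub) ?_ ?_
  · intro V _ G ident hG hid r par depth hT
    have hfree : ¬ IsMinor diamondGraph G := fun h =>
      hG (h.of_injective id Function.injective_id (by decide))
    refine ⟨hfree, ?_⟩
    rintro v h0 _ ⟨u, hu, rfl⟩ hvu
    obtain ⟨a, ha⟩ := exists_of_relIdent_ne_zero h0
    have hu := rel_of_relIdent_eq hid.injective hid.one_le (Eq.symm hvu)
    exact (relIdent_eq (R := IsParent par) hT.parent_unique (hT.isParent_of_backLink hG hu ha)).trans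
      (relIdent_eq (R := NormalTree.BackLink G par) (hT.backLink_unique hfree) ha).symm
  · intro V _ G ident hid c hc hE
    refine (CactusCheck.cactusTree hid.injective hid.one_le hc).not_isMinor_fourCycle ?_
    intro y v a hv ha
    have h1 := hid.one_le v
    have h2 := hid.one_le a
    obtain ⟨_, ⟨w, hw, rfl⟩, h3, -⟩ := (hc y).parent (by omega)
    obtain rfl := hid.injective (h3.trans hv.symm)
    exact ha.trans (hE y (by omega) _ ⟨w, hw, rfl⟩ h3).symm

/-- The class of graphs without triangle minor has a certification with logarithmic
certificates. -/
theorem hasLogCertification_K3 (k : ℕ) :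
    HasLogCertification k (minorFree (⊤ : SimpleGraph (Fin 3))) := by
  refine hasLogCertification_of_cactus k (fun l _ => l.hub = 0) ?_ ?_
  · intro V _ G ident hG hid r par depth hT
    have hfree : ¬ IsMinor diamondGraph G := fun h =>
      hG (h.of_injective (Fin.castSucc : Fin 3 → Fin 4) (Fin.castSucc_injective 3) (by
        simp only [SimpleGraph.top_adj]
        decide))
    exact ⟨hfree, fun v => relIdent_eq_zero fun a ha => hT.not_backLink hG v a ha⟩
  · intro V _ G ident hid c hc hE
    refine (CactusCheck.cactusTree hid.injective hid.one_le hc).toHubTree.not_isMinor_of_two ?_ ?_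
    · intro v a ha
      have := hid.one_le a
      have := hE v
      omega
    · simp only [SimpleGraph.top_adj]
      decide

/-! ### Simple certified classes -/

/-- The class of graphs with at most `N` vertices is certified by the list of all identifiers. -/
theorem hasLogCertification_card_le (k N : ℕ) :
    HasLogCertification k fun V _ => Nat.card V ≤ N := by
  refine hasLogCertification_of_labels (L := Fin N → ℕ) id Function.injective_id
    -- All vertices hold the same list of `N` numbers and find their own identifier in it, so the
    -- vertices inject into the slots.
    (fun i l s => (∀ q ∈ s, q.2 = l) ∧ ∃ j, l j = i) k ?_ ?_
  · intro V _ G ident hG hid hcard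
    rw [Nat.card_eq_fintype_card] at hcard
    obtain ⟨f⟩ : Nonempty (V ↪ Fin N) := Function.Embedding.nonempty_of_card_le (by simpa)
    obtain ⟨r⟩ := hG.nonempty
    have : Nonempty V := ⟨r⟩
    refine ⟨fun _ j => ident (Function.invFun f j), fun v j => ?_, fun v => ⟨?_, f v, ?_⟩⟩
    · exact (hid.le_pow _).trans (Nat.pow_le_pow_left (Nat.le_succ _) k)
    · rintro _ ⟨w, -, rfl⟩
      rfl
    · exact congrArg ident (Function.leftInverse_invFun f.injective v)
  · intro V _ G ident hG hid c hc
    obtain ⟨r⟩ := hG.nonempty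
    have hconst : ∀ v, c v = c r := fun v => hG.eq_of_adj_eq
      (fun x y hxy => ((hc x).1 _ ⟨y, hxy, rfl⟩).symm) v r
    choose f hf using fun v => (hc v).2
    have hinj : Function.Injective f := by
      intro v w hvw
      apply hid.injective
      rw [← hf v, ← hf w, hvw, hconst v, hconst w]
    rw [Nat.card_eq_fintype_card]
    simpa using Fintype.card_le_of_injective f hinj

/-- All edges contain a fixed vertex. -/
def IsStar {V : Type*} (G : SimpleGraph V) : Prop := ∃ c, ∀ x y, G.Adj x y → x = c ∨ y = c

/-- The class of stars is certified by the identifier of the centre. -/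
theorem hasLogCertification_isStar (k : ℕ) : HasLogCertification k fun _ G => IsStar G := by
  refine hasLogCertification_of_labels (L := ℕ) (m := 1) (fun l _ => l)
    (fun a b h => congrFun h 0) (fun i l s => ∀ q ∈ s, q.2 = l ∧ (i = l ∨ q.1 = l)) k ?_ ?_
  · rintro V _ G ident hG hid ⟨c, hc⟩
    refine ⟨fun _ => ident c, fun _ _ =>
      (hid.le_pow _).trans (Nat.pow_le_pow_left (Nat.le_succ _) k), fun v => ?_⟩
    rintro _ ⟨w, hw, rfl⟩
    refine ⟨rfl, ?_⟩
    rcases hc v w hw with h | h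
    · exact Or.inl (congrArg ident h)
    · exact Or.inr (congrArg ident h)
  · intro V _ G ident hG hid c hc
    obtain ⟨r⟩ := hG.nonempty
    have hconst : ∀ v, c v = c r := fun v => hG.eq_of_adj_eq
      (fun x y hxy => (hc x _ ⟨y, hxy, rfl⟩).1.symm) v r
    have hedge : ∀ x y, G.Adj x y → ident x = c r ∨ ident y = c r := by
      intro x y hxy
      rw [← hconst x]
      exact (hc x _ ⟨y, hxy, rfl⟩).2
    by_cases hz : ∃ z, ident z = c r
    · obtain ⟨z, hz⟩ := hz
      refine ⟨z, fun x y hxy => ?_⟩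
      rw [← hz] at hedge
      exact (hedge x y hxy).imp (fun h => hid.injective h) fun h => hid.injective h
    -- If no vertex has the announced identifier, there are no edges and any vertex serves as the
    -- centre.
    · exact ⟨r, fun x y hxy => (hedge x y hxy).elim (fun h => absurd ⟨x, h⟩ hz)
        fun h => absurd ⟨y, h⟩ hz⟩

/-- The class of graphs of maximum degree two is certified without certificates. -/
theorem hasLogCertification_degree_le_two (k : ℕ) :
    HasLogCertification k fun _ G => ∀ x, ¬ HasThree G x := by
  refine hasLogCertification_of_labels (L := Unit) (m := 0) (fun _ => Fin.elim0)
    (fun _ _ _ => rfl) (fun _ _ s => ¬ ∃ p ∈ s, ∃ q ∈ s, ∃ q' ∈ s, p.1 ≠ q.1 ∧ p.1 ≠ q'.1 ∧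
      q.1 ≠ q'.1) k ?_ ?_
  · intro V _ G ident hG hid hdeg
    refine ⟨fun _ => (), fun _ i => i.elim0, ?_⟩
    rintro v ⟨_, ⟨a, ha, rfl⟩, _, ⟨b, hb, rfl⟩, _, ⟨c, hc, rfl⟩, h1, h2, h3⟩
    exact hdeg v ⟨a, b, c, fun e => h1 (congrArg ident e), fun e => h2 (congrArg ident e),
      fun e => h3 (congrArg ident e), ha, hb, hc⟩
  · rintro V _ G ident hG hid c hc v ⟨x, y, z, h1, h2, h3, hx, hy, hz⟩
    exact hc v ⟨_, ⟨x, hx, rfl⟩, _, ⟨y, hy, rfl⟩, _, ⟨z, hz, rfl⟩, hid.injective.ne h1,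
      hid.injective.ne h2, hid.injective.ne h3⟩

/-! ### Small minors of connected graphs -/

/-- The path `0 1 2` and an isolated vertex. -/
abbrev pathAndVertex : SimpleGraph (Fin 4) := graphOfList [(0, 1), (1, 2)]

/-- Two disjoint edges. -/
abbrev twoEdges : SimpleGraph (Fin 4) := graphOfList [(0, 1), (2, 3)]

/-- The path `0 1 2 3`. -/
abbrev fourPath : SimpleGraph (Fin 4) := graphOfList [(0, 1), (1, 2), (2, 3)]

/-- The star `K₁,₃` with centre `0`. -/
abbrev clawGraph : SimpleGraph (Fin 4) := graphOfList [(0, 1), (0, 2), (0, 3)]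

/-- A triangle and an isolated vertex. -/
abbrev triangleAndVertex : SimpleGraph (Fin 4) := graphOfList [(0, 1), (0, 2), (1, 2)]

/-- A triangle with a pendant edge. -/
abbrev pawGraph : SimpleGraph (Fin 4) := graphOfList [(0, 1), (0, 2), (1, 2), (0, 3)]

/-- Four vertices give a minor on four vertices. -/
theorem isMinor_of_four_vertices {V : Type*} {G : SimpleGraph V} {H : SimpleGraph (Fin 4)}
    {a b c d : V} (hab : a ≠ b) (hac : a ≠ c) (had : a ≠ d) (hbc : b ≠ c) (hbd : b ≠ d)
    (hcd : c ≠ d) (l01 : H.Adj 0 1 → G.Adj a b) (l02 : H.Adj 0 2 → G.Adj a c)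
    (l03 : H.Adj 0 3 → G.Adj a d) (l12 : H.Adj 1 2 → G.Adj b c) (l13 : H.Adj 1 3 → G.Adj b d)
    (l23 : H.Adj 2 3 → G.Adj c d) : IsMinor H G :=
  isMinor_of_four (ConnSet.singleton a) (ConnSet.singleton b) (ConnSet.singleton c)
    (ConnSet.singleton d) (Set.disjoint_singleton.mpr hab) (Set.disjoint_singleton.mpr hac)
    (Set.disjoint_singleton.mpr had) (Set.disjoint_singleton.mpr hbc)
    (Set.disjoint_singleton.mpr hbd) (Set.disjoint_singleton.mpr hcd)
    (fun h => (l01 h).linked rfl rfl) (fun h => (l02 h).linked rfl rfl)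
    (fun h => (l03 h).linked rfl rfl) (fun h => (l12 h).linked rfl rfl)
    (fun h => (l13 h).linked rfl rfl) fun h => (l23 h).linked rfl rfl

/-- A nonempty proper set of vertices of a connected graph is left by an edge. -/
theorem SimpleGraph.Connected.exists_adj_not_mem {V : Type*} {G : SimpleGraph V} (hG : G.Connected)
    {C : Set V} {x y : V} (hx : x ∈ C) (hy : y ∉ C) : ∃ a b, a ∈ C ∧ b ∉ C ∧ G.Adj a b := by
  obtain ⟨a, -, b, -, h⟩ := (connSet_univ_iff.mpr hG).exists_adj (C := C) (Set.mem_univ x) hx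
    (Set.mem_univ y) hy
  exact ⟨a, b, h⟩

theorem isMinor_fourPath_of_adj {V : Type*} {G : SimpleGraph V} {a b c d : V}
    (hac : a ≠ c) (had : a ≠ d) (hbd : b ≠ d) (hab : G.Adj a b) (hbc : G.Adj b c)
    (hcd : G.Adj c d) : IsMinor fourPath G :=
  isMinor_of_four_vertices hab.ne hac had hbc.ne hbd hcd.ne (fun _ => hab)
    (fun h => absurd h (by decide)) (fun h => absurd h (by decide)) (fun _ => hbc)
    (fun h => absurd h (by decide)) fun _ => hcd

/-- A triangle minor in a connected graph without paw minor covers all vertices. -/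
theorem exists_mem_of_not_isMinor_paw {V : Type*} {G : SimpleGraph V} (hG : G.Connected)
    (hfree : ¬ IsMinor pawGraph G) {A B C : Set V} (hA : ConnSet G A) (hB : ConnSet G B)
    (hC : ConnSet G C) (hAB : Disjoint A B) (hAC : Disjoint A C) (hBC : Disjoint B C)
    (l01 : Linked G A B) (l02 : Linked G A C) (l12 : Linked G B C) (v : V) :
    v ∈ A ∨ v ∈ B ∨ v ∈ C := by
  by_contra hv
  obtain ⟨x, hx⟩ := hA.1
  obtain ⟨a, b, ha, hb, hab⟩ := hG.exists_adj_not_mem (C := {v | v ∈ A ∨ v ∈ B ∨ v ∈ C})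
    (Or.inl hx) hv
  have hbA : Disjoint A {b} := Set.disjoint_singleton_right.mpr fun h => hb (Or.inl h)
  have hbB : Disjoint B {b} := Set.disjoint_singleton_right.mpr fun h => hb (Or.inr (Or.inl h))
  have hbC : Disjoint C {b} := Set.disjoint_singleton_right.mpr fun h => hb (Or.inr (Or.inr h))
  have hcon := ConnSet.singleton (G := G) b
  rcases ha with ha | ha | ha
  · exact hfree (isMinor_of_four hA hB hC hcon hAB hAC hbA hBC hbB hbC (fun _ => l01) (fun _ => l02)
      (fun _ => hab.linked ha rfl) (fun _ => l12) (fun h => absurd h (by decide))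
      fun h => absurd h (by decide))
  · exact hfree (isMinor_of_four hB hA hC hcon hAB.symm hBC hbB hAC hbA hbC (fun _ => l01.symm)
      (fun _ => l12) (fun _ => hab.linked ha rfl) (fun _ => l02) (fun h => absurd h (by decide))
      fun h => absurd h (by decide))
  · exact hfree (isMinor_of_four hC hA hB hcon hAC.symm hBC.symm hbC hAB hbA hbB
      (fun _ => l02.symm) (fun _ => l12.symm) (fun _ => hab.linked ha rfl) (fun _ => l01)
      (fun h => absurd h (by decide)) fun h => absurd h (by decide))

/-! ### Connected graphs without a path, claw or paw minor -/

section Connected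

variable {V : Type*} [Fintype V] {G : SimpleGraph V}

theorem exists_not_mem_of_card_lt {S : Finset V} {n : ℕ} (hS : S.card ≤ n)
    (hn : n < Fintype.card V) : ∃ y, y ∉ S := by
  by_contra hcon
  push Not at hcon
  have := Finset.card_le_card (fun x _ => hcon x : Finset.univ ⊆ S)
  rw [Finset.card_univ] at this
  omega

theorem SimpleGraph.Connected.exists_adj_of_card (hG : G.Connected) (hcard : 2 ≤ Fintype.card V) :
    ∃ a b, G.Adj a b := by
  classical
  obtain ⟨x⟩ := hG.nonempty
  obtain ⟨y, hy⟩ := exists_not_mem_of_card_lt (S := {x}) (n := 1) (by simp) (by omega)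
  obtain ⟨a, b, -, -, hab⟩ := hG.exists_adj_not_mem (C := {x}) rfl
    (fun h => hy (Finset.mem_singleton.mpr h))
  exact ⟨a, b, hab⟩

theorem SimpleGraph.Connected.exists_path_of_card (hG : G.Connected)
    (hcard : 3 ≤ Fintype.card V) : ∃ a b c, a ≠ c ∧ G.Adj a b ∧ G.Adj b c := by
  classical
  obtain ⟨x, y, hxy⟩ := hG.exists_adj_of_card (by omega)
  obtain ⟨z, hz⟩ := exists_not_mem_of_card_lt (S := {x, y}) (n := 2) Finset.card_le_two (by omega)
  obtain ⟨a, b, ha, hb, hab⟩ := hG.exists_adj_not_mem (C := {x, y}) (Or.inl rfl)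
    (fun h => hz (by simpa using h))
  simp only [Set.mem_insert_iff, Set.mem_singleton_iff, not_or] at ha hb
  rcases ha with rfl | rfl
  · exact ⟨y, a, b, fun e => hb.2 e.symm, hxy.symm, hab⟩
  · exact ⟨x, a, b, fun e => hb.1 e.symm, hxy, hab⟩

theorem isMinor_pathAndVertex (hG : G.Connected) (hcard : 4 ≤ Fintype.card V) :
    IsMinor pathAndVertex G := by
  classical
  obtain ⟨a, b, c, hac, hab, hbc⟩ := hG.exists_path_of_card (by omega)
  obtain ⟨d, hd⟩ := exists_not_mem_of_card_lt (S := {a, b, c}) (n := 3) Finset.card_le_three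
    (by omega)
  simp only [Finset.mem_insert, Finset.mem_singleton, not_or] at hd
  exact isMinor_of_four_vertices hab.ne hac (Ne.symm hd.1) hbc.ne (Ne.symm hd.2.1)
    (Ne.symm hd.2.2) (fun _ => hab) (fun h => absurd h (by decide))
    (fun h => absurd h (by decide)) (fun _ => hbc) (fun h => absurd h (by decide))
    fun h => absurd h (by decide)

/-- A connected graph without path on four vertices is a star or has at most three vertices. -/
theorem isStar_or_card_le (hG : G.Connected) (hfree : ¬ IsMinor fourPath G) :
    IsStar G ∨ Nat.card V ≤ 3 := by
  classical
  rw [Nat.card_eq_fintype_card]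
  by_contra! hcon
  obtain ⟨hstar, hcard⟩ := hcon
  obtain ⟨a, b, c, hac, hab, hbc⟩ := hG.exists_path_of_card (by omega)
  obtain ⟨d, hd⟩ := exists_not_mem_of_card_lt (S := {a, b, c}) (n := 3) Finset.card_le_three hcard
  obtain ⟨x, y, hx, hy, hxy⟩ := hG.exists_adj_not_mem (C := {a, b, c}) (Or.inl rfl)
    (fun h => hd (by simpa using h))
  simp only [Set.mem_insert_iff, Set.mem_singleton_iff, not_or] at hx hy
  obtain ⟨hya, hyb, hyc⟩ := hy
  rcases hx with rfl | rfl | rfl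
  · exact hfree (isMinor_fourPath_of_adj hyb hyc hac hxy.symm hab hbc)
  -- A vertex at distance two from `x`, together with a further neighbour of `x`, gives a path on
  -- four vertices.
  · have hnear : ∀ z, z ≠ x → G.Adj x z := by
      intro z hzx
      by_contra hz
      obtain ⟨v, w, hv, hw, hvw⟩ := hG.exists_adj_not_mem (C := {z | z = x ∨ G.Adj x z})
        (Or.inl rfl) (show z ∉ {z | z = x ∨ G.Adj x z} from fun h => h.elim hzx hz)
      have hw' : w ≠ x ∧ ¬ G.Adj x w := ⟨fun e => hw (Or.inl e), fun e => hw (Or.inr e)⟩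
      rcases hv with rfl | hv
      · exact hw'.2 hvw
      · have hother : ∃ u, G.Adj x u ∧ u ≠ v := by
          by_cases hav : a = v
          · exact ⟨c, hbc, fun e => hac (hav.trans e.symm)⟩
          · exact ⟨a, hab.symm, hav⟩
        obtain ⟨u, hu, huv⟩ := hother
        exact hfree (isMinor_fourPath_of_adj hw'.1 (fun e => hw'.2 (e ▸ hu)) (Ne.symm huv)
          hvw.symm hv.symm hu)
    refine hstar ⟨x, fun u v huv => ?_⟩
    by_contra! huv'
    -- One of the three neighbours `a`, `c`, `y` of `x` is off the edge `uv`; then `v u x w` is a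
    -- path.
    have hother : ∃ w, G.Adj x w ∧ w ≠ u ∧ w ≠ v := by
      by_contra! hno
      have h1 := hno a hab.symm
      have h2 := hno c hbc
      have h3 := hno y hxy
      by_cases h4 : a = u
      · by_cases h5 : c = u
        · exact hac (h4.trans h5.symm)
        · by_cases h6 : y = u
          · exact hya (h6.trans h4.symm)
          · exact hyc ((h3 h6).trans (h2 h5).symm)
      · by_cases h5 : c = u
        · by_cases h6 : y = u
          · exact hyc (h6.trans h5.symm)
          · exact hya ((h3 h6).trans (h1 h4).symm)
        · exact hac ((h1 h4).trans (h2 h5).symm)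
    obtain ⟨w, hw, hwu, hwv⟩ := hother
    exact hfree (isMinor_fourPath_of_adj huv'.2 (Ne.symm hwv) (Ne.symm hwu) huv.symm
      (hnear u huv'.1).symm hw)
  · exact hfree (isMinor_fourPath_of_adj hac (Ne.symm hya) (Ne.symm hyb) hab hbc hxy)

/-- Two disjoint edges cannot share a centre, and three vertices do not accommodate four branch
sets. As `twoEdges` is a subgraph of `fourPath`, this and `isStar_or_card_le` show that both minors
define the same connected graphs. -/
theorem not_isMinor_twoEdges (h : IsStar G ∨ Nat.card V ≤ 3) : ¬ IsMinor twoEdges G := by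
  intro hm
  rcases h with ⟨c, hc⟩ | h
  · rw [isMinor_iff] at hm
    obtain ⟨B, -, h2, h3⟩ := hm
    obtain ⟨x, hx, y, hy, hxy⟩ := h3 0 1 (by decide)
    obtain ⟨z, hz, w, hw, hzw⟩ := h3 2 3 (by decide)
    rcases hc x y hxy with rfl | rfl <;> rcases hc z w hzw with rfl | rfl
    · exact h2 0 2 (by decide) _ hx hz
    · exact h2 0 3 (by decide) _ hx hw
    · exact h2 1 2 (by decide) _ hy hz
    · exact h2 1 3 (by decide) _ hy hw
  · have := hm.card_le
    rw [Nat.card_eq_fintype_card] at h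
    rw [Fintype.card_fin] at this
    omega

/-- In a graph of maximum degree two, a connected set has at most two neighbours. -/
theorem ncard_boundary_le_two (hdeg : ∀ x, ¬ HasThree G x) {B : Set V} (hB : ConnSet G B) :
    {y | y ∉ B ∧ ∃ x ∈ B, G.Adj x y}.ncard ≤ 2 := by
  classical
  have hnb : ∀ b, {y | G.Adj b y}.ncard ≤ 2 := by
    intro b
    by_contra! hcon
    obtain ⟨x, y, z, hx, hy, hz, hxy, hxz, hyz⟩ := (Set.two_lt_ncard_iff (Set.toFinite _)).mp hcon
    exact hdeg b ⟨x, y, z, hxy, hxz, hyz, hx, hy, hz⟩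
  -- `B` is built up one boundary vertex `b` at a time. This removes `b` from the boundary and adds
  -- at most one vertex, since one of the at most two neighbours of `b` is already inside.
  have key : ∀ n, 1 ≤ n → n ≤ B.ncard → ∃ D ⊆ B, D.ncard = n ∧
      {y | y ∉ D ∧ ∃ x ∈ D, G.Adj x y}.ncard ≤ 2 := by
    intro n hn
    induction n, hn using Nat.le_induction with
    | base =>
      intro _
      obtain ⟨b, hb⟩ := hB.1
      refine ⟨{b}, by simpa using hb, by simp, (Set.ncard_le_ncard ?_ (Set.toFinite _)).trans
        (hnb b)⟩
      rintro y ⟨-, x, rfl, hxy⟩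
      exact hxy
    | succ n hn ih =>
      intro hle
      obtain ⟨D, hDB, hD, hbd⟩ := ih (by omega)
      obtain ⟨d, hd⟩ : D.Nonempty := by
        rw [← Set.ncard_pos (Set.toFinite _)]
        omega
      obtain ⟨z, hzB, hzD⟩ : ∃ z ∈ B, z ∉ D := by
        by_contra! hcon
        have := Set.ncard_le_ncard (show B ⊆ D from hcon) (Set.toFinite _)
        omega
      obtain ⟨a, -, b, hbB, haD, hbD, hab⟩ := hB.exists_adj (C := D) (hDB hd) hd hzB hzD
      refine ⟨insert b D, Set.insert_subset hbB hDB, ?_, ?_⟩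
      · rw [Set.ncard_insert_of_notMem hbD (Set.toFinite _), hD]
      · have hsub : {y | y ∉ insert b D ∧ ∃ x ∈ insert b D, G.Adj x y} ⊆
            ({y | y ∉ D ∧ ∃ x ∈ D, G.Adj x y} \ {b}) ∪ ({y | G.Adj b y} \ {a}) := by
          rintro y ⟨hy, x, hx, hxy⟩
          have hyb : y ≠ b := fun e => hy (Or.inl e)
          have hyD : y ∉ D := fun e => hy (Or.inr e)
          rcases hx with rfl | hx
          · exact Or.inr ⟨hxy, fun e => hyD (e ▸ haD)⟩
          · exact Or.inl ⟨⟨hyD, x, hx, hxy⟩, hyb⟩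
        have h1 := (Set.ncard_le_ncard hsub (Set.toFinite _)).trans (Set.ncard_union_le _ _)
        have h2 := Set.ncard_sdiff_singleton_of_mem
          (show b ∈ {y | y ∉ D ∧ ∃ x ∈ D, G.Adj x y} from ⟨hbD, a, haD, hab⟩)
        have h3 := Set.ncard_sdiff_singleton_of_mem (show a ∈ {y | G.Adj b y} from hab.symm)
        have h4 := hnb b
        omega
  obtain ⟨D, hDB, hD, hbd⟩ := key B.ncard ((Set.ncard_pos (Set.toFinite _)).mpr hB.1) le_rfl
  rwa [Set.eq_of_subset_of_ncard_le hDB hD.ge (Set.toFinite _)] at hbd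

/-- The links to `C` and `D` already provide two boundary vertices of `B`, so there is no third. -/
theorem eq_or_eq_of_boundary (hdeg : ∀ x, ¬ HasThree G x) {B C D : Set V} {z : V}
    (hB : ConnSet G B) (hBC : ∀ x ∈ B, x ∉ C) (hBD : ∀ x ∈ B, x ∉ D) (hCD : ∀ x ∈ C, x ∉ D)
    (lC : Linked G B C) (lD : Linked G B D) (hzB : z ∉ B) (lz : Linked G B {z}) :
    z ∈ C ∨ z ∈ D := by
  by_contra! hz
  obtain ⟨x, hx, y, hy, hxy⟩ := lC
  obtain ⟨x', hx', y', hy', hxy'⟩ := lD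
  obtain ⟨x'', hx'', _, rfl, hxz⟩ := lz
  have h1 : 2 < {y | y ∉ B ∧ ∃ x ∈ B, G.Adj x y}.ncard := by
    rw [Set.two_lt_ncard_iff (Set.toFinite _)]
    exact ⟨y, y', _, ⟨fun h => hBC _ h hy, x, hx, hxy⟩, ⟨fun h => hBD _ h hy', x', hx', hxy'⟩,
      ⟨hzB, x'', hx'', hxz⟩, fun e => hCD y hy (e ▸ hy'), fun e => hz.1 (e ▸ hy),
      fun e => hz.2 (e ▸ hy')⟩
  have h2 := ncard_boundary_le_two hdeg hB
  omega

theorem not_isMinor_clawGraph_iff : ¬ IsMinor clawGraph G ↔ ∀ x, ¬ HasThree G x := by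
  constructor
  · rintro hfree x ⟨a, b, c, hab, hac, hbc, ha, hb, hc⟩
    exact hfree (isMinor_of_four_vertices ha.ne hb.ne hc.ne hab hac hbc (fun _ => ha) (fun _ => hb)
      (fun _ => hc) (fun h => absurd h (by decide)) (fun h => absurd h (by decide))
      fun h => absurd h (by decide))
  · intro hdeg
    rw [isMinor_iff]
    rintro ⟨B, h1, h2, h3⟩
    obtain ⟨x, hx, z, hz, hxz⟩ := h3 0 3 (by decide)
    rcases eq_or_eq_of_boundary hdeg (h1 0) (h2 0 1 (by decide)) (h2 0 2 (by decide))
      (h2 1 2 (by decide)) (h3 0 1 (by decide)) (h3 0 2 (by decide))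
      (fun h => h2 0 3 (by decide) z h hz) (hxz.linked hx rfl) with h | h
    · exact h2 1 3 (by decide) z h hz
    · exact h2 2 3 (by decide) z h hz

open Relation in
/-- A connected graph with a triangle minor and without paw minor has maximum degree two. -/
theorem not_isMinor_K3_or_degree_le_two (hG : G.Connected) (hfree : ¬ IsMinor pawGraph G) :
    ¬ IsMinor (⊤ : SimpleGraph (Fin 3)) G ∨ ∀ x, ¬ HasThree G x := by
  obtain ⟨r⟩ := hG.nonempty
  obtain ⟨par, depth, h, -⟩ := exists_normalTree hG r
  -- An edge that is not in the tree closes a cycle with it. Without paw minor this cycle covers all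
  -- vertices, so the tree is a path from `x` to `y`.
  have hends : ∀ {x u y}, G.Adj x y → IsParent par x u → TransGen (IsParent par) u y →
      ∀ v, ReflTransGen (IsParent par) x v ∧ ReflTransGen (IsParent par) v y := by
    intro x u y hxy hu huy v
    have d1 := h.depth_eq hu
    have d2 := h.depth_lt_of_transGen huy
    have e1 : ∀ x ∈ NormalTree.path par u y, depth x ≤ depth u ∧ depth y < depth x :=
      fun x hx => h.depth_path hx
    have hxy' := ReflTransGen.head hu huy.to_reflTransGen
    rcases exists_mem_of_not_isMinor_paw hG hfree (ConnSet.singleton x) (h.connSet_path huy)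
      (ConnSet.singleton y)
      (Set.disjoint_singleton_left.mpr fun hx => by have := e1 x hx; omega)
      (Set.disjoint_singleton.mpr hxy.ne)
      (Set.disjoint_singleton_right.mpr fun hy => by have := e1 y hy; omega)
      ((h.adj hu).linked rfl ⟨ReflTransGen.refl, huy⟩) (hxy.linked rfl rfl) (h.path_linked huy) v
      with rfl | hv | rfl
    · exact ⟨ReflTransGen.refl, hxy'⟩
    · exact ⟨ReflTransGen.head hu hv.1, hv.2.to_reflTransGen⟩
    · exact ⟨hxy', ReflTransGen.refl⟩
  have hcase : ∀ {x y}, G.Adj x y → TransGen (IsParent par) x y → IsParent par x y ∨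
      ∀ v, ReflTransGen (IsParent par) x v ∧ ReflTransGen (IsParent par) v y := by
    intro x y hxy hT
    obtain ⟨u, hu, huy⟩ := TransGen.head'_iff.mp hT
    rcases reflTransGen_iff_eq_or_transGen.mp huy with h1 | h1
    · exact Or.inl (h1 ▸ hu)
    · exact Or.inr (hends hxy hu h1)
  by_cases hback : ∃ x y, ∀ v, ReflTransGen (IsParent par) x v ∧ ReflTransGen (IsParent par) v y
  · right
    obtain ⟨x, y, hall⟩ := hback
    have heq : ∀ {v w}, depth v = depth w → v = w := by
      intro v w hvw
      rcases h.hubTree_bot.comparable (hall v).1 (hall w).1 with h1 | h1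
      · exact h.hubTree_bot.eq_of_depth_le h1 (by omega)
      · exact (h.hubTree_bot.eq_of_depth_le h1 (by omega)).symm
    have hx : ∀ v, depth v ≤ depth x := fun v => h.depth_le (hall v).1
    have hy : ∀ v, depth y ≤ depth v := fun v => h.depth_le (hall v).2
    -- Every further edge outside the tree also joins the two ends of the path, so the neighbours of
    -- a vertex are confined to two depths, and depths identify vertices.
    have hnb : ∀ {z w}, G.Adj z w → depth z = depth w + 1 ∨ depth w = depth z + 1 ∨
        (depth z = depth x ∧ depth w = depth y) ∨ (depth z = depth y ∧ depth w = depth x) := by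
      intro z w hzw
      have hback : ∀ {z w}, (∀ v, ReflTransGen (IsParent par) z v ∧
          ReflTransGen (IsParent par) v w) → depth z = depth x ∧ depth w = depth y := by
        intro z w h1
        have := h.depth_le (h1 x).1
        have := h.depth_le (h1 y).2
        have := hx z
        have := hy w
        omega
      rcases h.transGen_of_adj hzw with h1 | h1
      · rcases hcase hzw h1 with h2 | h2
        · exact Or.inl (h.depth_eq h2)
        · exact Or.inr (Or.inr (Or.inl (hback h2)))
      · rcases hcase hzw.symm h1 with h2 | h2
        · exact Or.inr (Or.inl (h.depth_eq h2))
        · exact Or.inr (Or.inr (Or.inr (hback h2).symm))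
    rintro z ⟨a, b, c, hab, hac, hbc, ha, hb, hc⟩
    have hab' : depth a ≠ depth b := fun e => hab (heq e)
    have hac' : depth a ≠ depth c := fun e => hac (heq e)
    have hbc' : depth b ≠ depth c := fun e => hbc (heq e)
    have := hnb ha
    have := hnb hb
    have := hnb hc
    have := hx a
    have := hx b
    have := hx c
    have := hy a
    have := hy b
    have := hy c
    omega
  · left
    have hT : HubTree G (IsParent par) (fun _ _ => False) depth := by
      refine ⟨h.parent_unique, fun h1 => h1.elim, h.hubTree_bot.depth_lt, fun h1 => h1.elim, ?_⟩
      intro x y hxy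
      rcases h.transGen_of_adj hxy with h1 | h1
      · rcases hcase hxy h1 with h2 | h2
        · exact Or.inl (Or.inl h2)
        · exact absurd ⟨x, y, h2⟩ hback
      · rcases hcase hxy.symm h1 with h2 | h2
        · exact Or.inr (Or.inl h2)
        · exact absurd ⟨y, x, h2⟩ hback
    refine hT.not_isMinor_of_two (fun _ _ h1 => h1) ?_
    simp only [SimpleGraph.top_adj]
    decide

/-- With maximum degree two, all neighbours of each branch set of the triangle lie in the other two.
By connectivity the three sets cover the graph and leave no room for a fourth. -/
theorem not_isMinor_triangleAndVertex (hG : G.Connected)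
    (h : ¬ IsMinor (⊤ : SimpleGraph (Fin 3)) G ∨ ∀ x, ¬ HasThree G x) :
    ¬ IsMinor triangleAndVertex G := by
  intro hm
  rcases h with h | hdeg
  · refine h (hm.of_injective (Fin.castSucc : Fin 3 → Fin 4) (Fin.castSucc_injective 3) ?_)
    simp only [SimpleGraph.top_adj]
    decide
  · rw [isMinor_iff] at hm
    obtain ⟨B, h1, h2, h3⟩ := hm
    have hstep : ∀ i j l : Fin 4, i ≠ j → i ≠ l → j ≠ l → triangleAndVertex.Adj i j →
        triangleAndVertex.Adj i l → ∀ a b, a ∈ B i → G.Adj a b → b ∈ B i ∨ b ∈ B j ∨ b ∈ B l := by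
      intro i j l hij hil hjl lij lil a b ha hab
      by_cases hb : b ∈ B i
      · exact Or.inl hb
      · exact Or.inr (eq_or_eq_of_boundary hdeg (h1 i) (h2 i j hij) (h2 i l hil) (h2 j l hjl)
          (h3 i j lij) (h3 i l lil) hb (hab.linked ha rfl))
    obtain ⟨x, hx⟩ := (h1 0).1
    obtain ⟨y, hy⟩ := (h1 3).1
    obtain ⟨a, b, ha, hb, hab⟩ := hG.exists_adj_not_mem (C := {v | v ∈ B 0 ∨ v ∈ B 1 ∨ v ∈ B 2})
      (Or.inl hx) (y := y) (by
        rintro (h | h | h)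
        exacts [h2 0 3 (by decide) y h hy, h2 1 3 (by decide) y h hy, h2 2 3 (by decide) y h hy])
    apply hb
    rcases ha with ha | ha | ha
    · exact hstep 0 1 2 (by decide) (by decide) (by decide) (by decide) (by decide) a b ha hab
    · rcases hstep 1 0 2 (by decide) (by decide) (by decide) (by decide) (by decide) a b ha hab
        with h | h | h
      exacts [Or.inr (Or.inl h), Or.inl h, Or.inr (Or.inr h)]
    · rcases hstep 2 0 1 (by decide) (by decide) (by decide) (by decide) (by decide) a b ha hab
        with h | h | h
      exacts [Or.inr (Or.inr h), Or.inl h, Or.inr (Or.inl h)]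

end Connected

theorem hasLogCertification_fourPath (k : ℕ) : HasLogCertification k (minorFree fourPath) :=
  ((hasLogCertification_isStar k).union (hasLogCertification_card_le k 3)).congr
    fun _ _ _ hG => ⟨fun h hm => not_isMinor_twoEdges h
      (hm.of_injective id Function.injective_id (by decide)), isStar_or_card_le hG⟩

theorem hasLogCertification_twoEdges (k : ℕ) : HasLogCertification k (minorFree twoEdges) :=
  ((hasLogCertification_isStar k).union (hasLogCertification_card_le k 3)).congr
    fun _ _ _ hG => ⟨fun h => not_isMinor_twoEdges h, fun h => isStar_or_card_le hG fun hm =>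
      h (hm.of_injective id Function.injective_id (by decide))⟩

theorem hasLogCertification_clawGraph (k : ℕ) : HasLogCertification k (minorFree clawGraph) :=
  (hasLogCertification_degree_le_two k).congr fun _ _ _ _ => not_isMinor_clawGraph_iff.symm

theorem hasLogCertification_pawGraph (k : ℕ) : HasLogCertification k (minorFree pawGraph) :=
  ((hasLogCertification_K3 k).union (hasLogCertification_degree_le_two k)).congr
    fun _ _ _ hG => ⟨fun h hm => not_isMinor_triangleAndVertex hG h
      (hm.of_injective id Function.injective_id (by decide)),
      not_isMinor_K3_or_degree_le_two hG⟩

theorem hasLogCertification_triangleAndVertex (k : ℕ) :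
    HasLogCertification k (minorFree triangleAndVertex) :=
  ((hasLogCertification_K3 k).union (hasLogCertification_degree_le_two k)).congr
    fun _ _ _ hG => ⟨not_isMinor_triangleAndVertex hG, fun h =>
      not_isMinor_K3_or_degree_le_two hG fun hm =>
        h (hm.of_injective id Function.injective_id (by decide))⟩

/-! ### All graphs with at most four vertices -/

/-- Certification only depends on the isomorphism type of the forbidden minor. -/
theorem HasLogCertification.of_iso {k : ℕ} {W U : Type*} {H : SimpleGraph W} {K : SimpleGraph U}
    (h : HasLogCertification k (minorFree K)) (e : H ≃g K) :
    HasLogCertification k (minorFree H) :=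
  h.congr fun _ _ _ _ => not_congr
    ⟨fun hm => hm.of_injective e e.injective fun _ _ hij => e.map_adj_iff.mpr hij,
      fun hm => hm.of_injective e.symm e.symm.injective fun _ _ hij => e.symm.map_adj_iff.mpr hij⟩

/-- If `H` is a minor of all connected graphs that are large enough, then the graphs without this
minor are certified. -/
theorem hasLogCertification_of_card_le (k : ℕ) {W : Type*} [Fintype W] {H : SimpleGraph W}
    (hH : ∀ (V : Type) [Fintype V] (G : SimpleGraph V), G.Connected →
      Fintype.card W ≤ Fintype.card V → IsMinor H G) : HasLogCertification k (minorFree H) := by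
  -- For empty `W` the truncated bound is `0`, which no connected graph meets, in accordance with
  -- `H` being a minor of every graph.
  refine (hasLogCertification_card_le k (Fintype.card W - 1)).congr fun V _ G hG => ?_
  have := hG.nonempty
  have hpos : 0 < Fintype.card V := Fintype.card_pos
  rw [Nat.card_eq_fintype_card]
  constructor
  · intro hle hm
    have := hm.card_le
    omega
  · intro hm
    by_contra hle
    exact hm (hH V G hG (by omega))

/-- The symmetric relation on four vertices with the given values on the six pairs. -/
def relOfBools (x : Fin 6 → Bool) (i j : Fin 4) : Bool :=
  ![![false, x 0, x 1, x 2], ![x 0, false, x 3, x 4], ![x 1, x 3, false, x 5],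
    ![x 2, x 4, x 5, false]] i j

theorem exists_relOfBools (H : SimpleGraph (Fin 4)) :
    ∃ x, ∀ i j, H.Adj i j ↔ relOfBools x i j = true := by
  classical
  refine ⟨![H.Adj 0 1, H.Adj 0 2, H.Adj 0 3, H.Adj 1 2, H.Adj 1 3, H.Adj 2 3], ?_⟩
  intro i j
  fin_cases i <;> fin_cases j <;> simp [relOfBools, H.adj_comm 1 0, H.adj_comm 2, H.adj_comm 3 0,
    H.adj_comm 3 1]

/-- The edges of the graphs on four vertices that are not contained in `pathAndVertex`, up to
isomorphism. -/
def fourVertexGraphs : List (List (Fin 4 × Fin 4)) :=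
  [[(0, 1), (2, 3)], [(0, 1), (1, 2), (2, 3)], [(0, 1), (0, 2), (0, 3)], [(0, 1), (0, 2), (1, 2)],
    [(0, 1), (0, 2), (1, 2), (0, 3)], [(0, 2), (0, 3), (1, 2), (1, 3)],
    [(0, 1), (0, 2), (0, 3), (1, 2), (1, 3)], [(0, 1), (0, 2), (0, 3), (1, 2), (1, 3), (2, 3)]]

/-- The completeness of the case list, checked over all 64 graphs; the encoding by six Booleans
makes this decidable. -/
theorem exists_perm_relOfBools : ∀ x : Fin 6 → Bool, ∃ σ : Equiv.Perm (Fin 4),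
    (∀ i j, relOfBools x i j = true → pathAndVertex.Adj (σ i) (σ j)) ∨
      ∃ l ∈ fourVertexGraphs, ∀ i j, (graphOfList l).Adj (σ i) (σ j) ↔ relOfBools x i j = true := by
  decide +kernel

theorem hasLogCertification_fin_four (k : ℕ) (H : SimpleGraph (Fin 4)) :
    HasLogCertification k (minorFree H) := by
  obtain ⟨x, hx⟩ := exists_relOfBools H
  obtain ⟨σ, h | ⟨l, hl, h⟩⟩ := exists_perm_relOfBools x
  · refine hasLogCertification_of_card_le k fun V _ G hG hcard => ?_
    exact (isMinor_pathAndVertex hG (by simpa using hcard)).of_injective σ σ.injective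
      fun i j hij => h i j ((hx i j).mp hij)
  · have e : H ≃g graphOfList l := ⟨σ, fun {i j} => (h i j).trans (hx i j).symm⟩
    refine HasLogCertification.of_iso ?_ e
    simp only [fourVertexGraphs, List.mem_cons, List.not_mem_nil, or_false] at hl
    rcases hl with rfl | rfl | rfl | rfl | rfl | rfl | rfl | rfl
    · exact hasLogCertification_twoEdges k
    · exact hasLogCertification_fourPath k
    · exact hasLogCertification_clawGraph k
    · exact hasLogCertification_triangleAndVertex k
    · exact hasLogCertification_pawGraph k
    · exact hasLogCertification_fourCycle k
    · exact hasLogCertification_diamond k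
    · have htop : graphOfList [(0, 1), (0, 2), (0, 3), (1, 2), (1, 3), (2, 3)] = ⊤ := by
        ext i j
        revert i j
        simp only [SimpleGraph.top_adj]
        decide
      rw [htop]
      exact hasLogCertification_K4 k

theorem hasLogCertification_fin_three (k : ℕ) (H : SimpleGraph (Fin 3)) :
    HasLogCertification k (minorFree H) := by
  by_cases htop : H = ⊤
  · rw [htop]
    exact hasLogCertification_K3 k
  obtain ⟨i, j, hij, hadj⟩ : ∃ i j, i ≠ j ∧ ¬ H.Adj i j := by
    by_contra! hcon
    exact htop (top_le_iff.mp fun i j hij => hcon i j hij)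
  obtain ⟨l, hli, hlj, hl⟩ : ∃ l, l ≠ i ∧ l ≠ j ∧ ∀ m, m = i ∨ m = j ∨ m = l := by
    clear hadj
    revert i j
    decide
  refine hasLogCertification_of_card_le k fun V _ G hG hcard => ?_
  obtain ⟨a, b, c, hac, hab, hbc⟩ := hG.exists_path_of_card (by simpa using hcard)
  have hba := hab.ne'
  have hbc' := hbc.ne
  -- The missing edge `ij` goes to the ends of a path on three vertices and the remaining vertex to
  -- its middle.
  refine isMinor_of_injective (fun m => if m = i then a else if m = j then c else b) ?_ ?_
  · intro m m' h
    rcases hl m with rfl | rfl | rfl <;> rcases hl m' with rfl | rfl | rfl <;>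
      simp_all [eq_comm]
  · intro m m' h
    have := hab.symm
    have := hbc.symm
    have := hij.symm
    rcases hl m with rfl | rfl | rfl <;> rcases hl m' with rfl | rfl | rfl <;>
      simp_all [H.adj_comm]

theorem theorem1 {W : Type*} [Fintype W] (H : SimpleGraph W) (hH : Fintype.card W ≤ 4) (k : ℕ) :
    HasLogCertification k (minorFree H) := by
  have e : ∀ n, Fintype.card W = n → ∃ K : SimpleGraph (Fin n), Nonempty (H ≃g K) := fun n hn =>
    ⟨H.comap (Fintype.equivFinOfCardEq hn).symm,
      ⟨⟨Fintype.equivFinOfCardEq hn, by simp [SimpleGraph.comap_adj]⟩⟩⟩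
  obtain hW | hW | hW | hW | hW : Fintype.card W = 0 ∨ Fintype.card W = 1 ∨ Fintype.card W = 2 ∨
      Fintype.card W = 3 ∨ Fintype.card W = 4 := by omega
  · have := Fintype.card_eq_zero_iff.mp hW
    exact hasLogCertification_of_card_le k fun V _ G _ _ => isMinor_of_injective
      (fun w => isEmptyElim w) (fun w => isEmptyElim w) fun w => isEmptyElim w
  · have := (Fintype.card_le_one_iff_subsingleton.mp hW.le)
    refine hasLogCertification_of_card_le k fun V _ G hG _ => ?_
    obtain ⟨v⟩ := hG.nonempty
    exact isMinor_of_injective (fun _ => v) (fun i j _ => Subsingleton.elim i j)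
      fun i j hij => absurd (Subsingleton.elim i j) hij.ne
  · obtain ⟨K, ⟨e⟩⟩ := e 2 hW
    refine HasLogCertification.of_iso (hasLogCertification_of_card_le k fun V _ G hG hcard => ?_) e
    obtain ⟨a, b, hab⟩ := hG.exists_adj_of_card (by simpa using hcard)
    refine isMinor_of_injective ![a, b] ?_ ?_
    · intro i j h
      fin_cases i <;> fin_cases j <;> simp_all [hab.ne, hab.ne']
    · intro i j h
      fin_cases i <;> fin_cases j <;> simp_all [hab.symm]
  · obtain ⟨K, ⟨e⟩⟩ := e 3 hW
    exact (hasLogCertification_fin_three k K).of_iso e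
  · obtain ⟨K, ⟨e⟩⟩ := e 4 hW
    exact (hasLogCertification_fin_four k K).of_iso e
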